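/- **Setting.** For every $N\ge 0$ let $s=s(N)\in(N,\infty]$, and assume that $\lambda:=\lim_{N\to\infty}N/s(N)$ exists (so $\lambda\in[0,1]$). For $u\in\mathbb C$ put $w_s(u)=\max\{1,|u|\}^{-s}$ (for $s=\infty$: the characteristic function of the closed unit disk), and for a polynomial $p$ put $\widetilde p=p\,w_s$. Put $\iota(z)=\mathrm i\,\mathrm{sgn}(\mathrm{Im}\,z)$, and let $\epsilon f(u)=\frac12\int_{\mathbb R}f(t)\,\mathrm{sgn}(t-u)\,dt$ for $u\in\mathbb R$ and $\epsilon f(u)=\iota(u)f(\overline u)$ for $u\in\mathbb C\setminus\mathbb R$. For real polynomials let $$\langle f|g\rangle=\int_{\mathbb R}\int_{\mathbb R}\widetilde f(x)\widetilde g(y)\,\mathrm{sgn}(y-x)\,dy\,dx-2\mathrm i\int_{\mathbb C}\overline{\widetilde f(z)}\,\widetilde g(z)\,\mathrm{sgn}(\mathrm{Im}\,z)\,dA(z).$$ For each $N$ let $\pi_0,\dots,\pi_{N-1}$ be real polynomials, $\deg\pi_n=n$, skew-orthonormal: $\langle\pi_{2n}|\pi_{2m}\rangle=\langle\pi_{2n+1}|\pi_{2m+1}\rangle=0$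 and $\langle\pi_{2n}|\pi_{2m+1}\rangle=-\langle\pi_{2m+1}|\pi_{2n}\rangle=\delta_{mn}$, and normalized by $\int_{\mathbb R}\widetilde\pi_{2n+1}=0$. Put $s_k=\int_{\mathbb R}\widetilde\pi_k$ and $J=\lfloor N/2\rfloor$. **The kernel.** Set $$\mathbf K_N^{(1,1)}(u,v)=2\sum_{j<J}\big[\widetilde\pi_{2j}(u)\widetilde\pi_{2j+1}(v)-\widetilde\pi_{2j}(v)\widetilde\pi_{2j+1}(u)\big]-\delta_N\,2\sum_{j<J}\frac{s_{2j}}{s_{2J}}\big[\widetilde\pi_{2J}(u)\widetilde\pi_{2j+1}(v)-\widetilde\pi_{2J}(v)\widetilde\pi_{2j+1}(u)\big],$$ where $\delta_N=1$ for odd $N$ and $\delta_N=0$ for even $N$. The entries $(1,2)$, $(2,1)$, $(2,2)$ arise by applying $\epsilon$ to each weighted polynomial evaluated at $v$, at $u$, and at both, respectively, and then adding, with $\chi_{\mathbb R}$ the characteristic function of $\mathbb R$, $$\delta_N\frac{\widetilde\pi_{2J}(u)\chi_{\mathbb R}(v)}{s_{2J}},\qquad -\delta_N\frac{\widetilde\pi_{2J}(v)\chi_{\mathbb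 R}(u)}{s_{2J}},\qquad \delta_N\frac{\epsilon\widetilde\pi_{2J}(u)\chi_{\mathbb R}(v)-\epsilon\widetilde\pi_{2J}(v)\chi_{\mathbb R}(u)}{s_{2J}}+\tfrac12\mathrm{sgn}(u-v),$$ respectively, where $\mathrm{sgn}(u-v):=0$ if $u$ or $v$ is not real. For $\xi\in\{1,-1\}$ the scaled kernel is $$\mathbf K_{N,\xi}(u,v)=\mathbf D_u\,\mathbf K_N\big(\xi+\tfrac uN,\xi+\tfrac vN\big)\,\mathbf D_v^{\mathsf T},$$ where $\mathbf D_u=\mathrm{diag}(\frac1N,1)$ for $u\in\mathbb R$ and $\mathbf D_u=\mathrm{diag}(\frac1N,\frac1N)$ for $u\in\mathbb C\setminus\mathbb R$. **The limit.** Let $\omega(\tau)=\min\{1,e^{-\mathrm{Re}\,\tau/\lambda}\}$ (for $\lambda=0$: the characteristic function of $\{\mathrm{Re}\,\tau\le0\}$), $M(z)={}_1F_1(\tfrac32,1;z)=\frac1{\Gamma(3/2)}\sum_{n\ge0}\frac{\Gamma(n+3/2)}{\Gamma(n+1)}\frac{z^n}{n!}$, $$\varkappa_\xi(u,v)=\omega(u\xi)\omega(v\xi)\frac\xi4\int_0^1\tau(1-\lambda\tau)\big[M'(u\xi\tau)M(v\xi\tau)-M(u\xi\tau)M'(v\xi\tau)\big]d\tau,$$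 $$A_\xi(a,b)=\int_0^a\!\int_0^b\varkappa_\xi(u,v)\,dv\,du+\Big(\int_0^b-\int_0^a\Big)\Big[\frac{\omega(v\xi)}4\int_0^1(1-\lambda u)M(v\xi u)\,du\Big]dv,$$ with integrals from $0$ to $a$ and to $b$ along line segments. For a function $A$ on $\mathbb C\times\mathbb C$ write $DA$ and $AD$ for its derivative in the first and in the second variable: along $\mathbb R$ at a real point and along the ray from $0$ through $z$ at a non-real point $z$ (that is, $Df(z)=\frac1z\frac{d}{dt}f(z+tz)|_{t=0}$). For $x,y\in\mathbb R$ and $z,w\in\mathbb C\setminus\mathbb R$ set $$\mathbf K[A](x,y)=\begin{bmatrix}DAD(x,y)&-DA(x,y)\\-AD(x,y)&A(x,y)+\frac12\mathrm{sgn}(x-y)\end{bmatrix},\quad \mathbf K[A](z,y)=\begin{bmatrix}DAD(z,y)&-DA(z,y)\\ \iota(z)DAD(\overline z,y)&-\iota(z)DA(\overline z,y)\end{bmatrix},$$ $$\mathbf K[A](y,z)=-\mathbf K[A](z,y)^{\mathsf T},\quad \mathbf K[A](z,w)=\begin{bmatrix}DAD(z,w)&\iota(w)DAD(z,\overline w)\\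 \iota(z)DAD(\overline z,w)&\iota(z)\iota(w)DAD(\overline z,\overline w)\end{bmatrix}.$$ **Theorem.** Let $\xi=\pm1$. 1. If $\lambda>0$, the derivatives $DA_\xi$, $A_\xi D$ and $DA_\xi D$ exist at all points $(u,v)\in\mathbb C\times\mathbb C$, and $DA_\xi D=\varkappa_\xi$. If $\lambda=0$, then $DA_\xi$ exists where $\mathrm{Re}\,u\ne0$, $A_\xi D$ exists where $\mathrm{Re}\,v\neq0$, and $DA_\xi D$ exists and equals $\varkappa_\xi$ where both hold. 2. If $\lambda>0$, then $\mathbf K_{N,\xi}\to\mathbf K[A_\xi]$ as $N\to\infty$, uniformly on every compact subset of $\mathbb C\times\mathbb C$ (real/real, real/complex, complex/real and complex/complex arguments together). 3. If $\lambda=0$, let $K\subset\mathbb C\times\mathbb C$ be compact. The $(i,j)$ entry of $\mathbf K_{N,\xi}$ converges to that of $\mathbf K[A_\xi]$ uniformly for $(u,v)\in K$, provided that: either $\mathrm{Re}\,u\ne0$ for all $(u,v)\in K$, or $i=2$ and $u\in\mathbb R$ for all $(u,v)\in K$; and either $\mathrm{Re}\,v\neq0$ for all $(u,v)\in K$, or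 $j=2$ and $v\in\mathbb R$ for all $(u,v)\in K$. In particular all entries converge locally uniformly on $\{(u,v):\mathrm{Re}\,u\ne0,\ \mathrm{Re}\,v\ne0\}$. -/

import Mathlib

open scoped ENNReal Polynomial ComplexConjugate Topology
open Filter MeasureTheory

noncomputable section

namespace RealMahler

/-! ### The finite matrix kernel -/

/-- The weight `max {1, |u|} ^ (-s)`; for `s = ∞` it is the characteristic function of the closed
unit disk. -/
def weight (s : ℝ≥0∞) (u : ℂ) : ℝ :=
  if s = ∞ then (if ‖u‖ ≤ 1 then 1 else 0) else (max 1 ‖u‖) ^ (-s.toReal)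

/-- The skew-symmetric form `⟨f | g⟩_ℝ`. -/
def skewReal (s : ℝ≥0∞) (f g : ℝ[X]) : ℝ :=
  ∫ x : ℝ, ∫ y : ℝ,
    weight s (x : ℂ) * weight s (y : ℂ) * f.eval x * g.eval y * Real.sign (y - x)

/-- The skew-symmetric form `⟨f | g⟩_ℂ`, an integral over the plane. -/
def skewComplex (s : ℝ≥0∞) (f g : ℝ[X]) : ℂ :=
  -2 * Complex.I * ∫ z : ℂ,
    (((weight s z) ^ 2 : ℝ) : ℂ) * conj (Polynomial.aeval z f) * Polynomial.aeval z g
      * ((Real.sign z.im : ℝ) : ℂ)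

/-- `⟨f | g⟩ = ⟨f | g⟩_ℝ + ⟨f | g⟩_ℂ`. -/
def skew (s : ℝ≥0∞) (f g : ℝ[X]) : ℂ := (skewReal s f g : ℂ) + skewComplex s f g

/-- The weighted polynomial `p(u) max {1, |u|} ^ (-s)`. -/
def weighted (s : ℝ≥0∞) (p : ℝ[X]) (u : ℂ) : ℂ := (weight s u : ℂ) * Polynomial.aeval u p

/-- The integral over the real line of a weighted polynomial. -/
def lineIntegral (s : ℝ≥0∞) (p : ℝ[X]) : ℂ := ∫ x : ℝ, weighted s p (x : ℂ)

/-- The polynomials `π 0, …, π (N - 1)` have real coefficients, `π n` has degree `n`, they are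
skew-orthonormal for `⟨· | ·⟩`, and the weighted polynomials of odd index have integral `0` over
the real line (which removes the freedom of adding a multiple of `π (2 n)` to `π (2 n + 1)`). -/
structure IsSkewOrthonormal (s : ℝ≥0∞) (N : ℕ) (π : ℕ → ℝ[X]) : Prop where
  degree_eq : ∀ n, n < N → (π n).degree = n
  even_even : ∀ m n, 2 * m < N → 2 * n < N → skew s (π (2 * m)) (π (2 * n)) = 0
  odd_odd : ∀ m n, 2 * m + 1 < N → 2 * n + 1 < N →
    skew s (π (2 * m + 1)) (π (2 * n + 1)) = 0
  even_odd : ∀ m n, 2 * n < N → 2 * m + 1 < N →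
    skew s (π (2 * n)) (π (2 * m + 1)) = if m = n then 1 else 0
  odd_even : ∀ m n, 2 * n < N → 2 * m + 1 < N →
    skew s (π (2 * m + 1)) (π (2 * n)) = if m = n then -1 else 0
  odd_integral : ∀ n, 2 * n + 1 < N → lineIntegral s (π (2 * n + 1)) = 0

/-- `ι(z) = i sgn (Im z)`. -/
def iota (z : ℂ) : ℂ := Complex.I * ((Real.sign z.im : ℝ) : ℂ)

/-- The operator `ε`. -/
def eps (f : ℂ → ℂ) (u : ℂ) : ℂ :=
  if u.im = 0 then (1 / 2) * ∫ t : ℝ, f (t : ℂ) * ((Real.sign (t - u.re) : ℝ) : ℂ)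
  else iota u * f (conj u)

/-- The characteristic function of the real line. -/
def chiReal (u : ℂ) : ℂ := if u.im = 0 then 1 else 0

/-- `sgn (u - v)` for real `u, v`, and `0` if one of them is not real. -/
def sgnDiff (u v : ℂ) : ℂ :=
  if u.im = 0 ∧ v.im = 0 then ((Real.sign (u.re - v.re) : ℝ) : ℂ) else 0

/-- Common form of the entries of the kernel. Here `f n` and `g n` are the values of `π̃ n` or
`ε π̃ n` at the first and at the second argument, `a` (resp. `b`) is the value of the characteristic
function of `ℝ` at the first (resp. second) argument if `ε` acts on that argument and `0` otherwise,
and `σ k` is the integral of `π̃ k` over `ℝ`. The second and third line enter for odd `N` only. -/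
def kernelEntry (N : ℕ) (σ f g : ℕ → ℂ) (a b : ℂ) : ℂ :=
  2 * ∑ j ∈ Finset.range (N / 2), (f (2 * j) * g (2 * j + 1) - g (2 * j) * f (2 * j + 1))
  + if Odd N then
      -2 * ∑ j ∈ Finset.range (N / 2), σ (2 * j) / σ (2 * (N / 2)) *
          (f (2 * (N / 2)) * g (2 * j + 1) - g (2 * (N / 2)) * f (2 * j + 1))
        + (f (2 * (N / 2)) * b - g (2 * (N / 2)) * a) / σ (2 * (N / 2))
    else 0

/-- The matrix kernel `𝐊_N(u, v)`, built from the polynomials `π`. -/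
def kernel (s : ℝ≥0∞) (N : ℕ) (π : ℕ → ℝ[X]) (u v : ℂ) : Matrix (Fin 2) (Fin 2) ℂ :=
  let σ : ℕ → ℂ := fun n => lineIntegral s (π n)
  let p : ℂ → ℕ → ℂ := fun w n => weighted s (π n) w
  let e : ℂ → ℕ → ℂ := fun w n => eps (weighted s (π n)) w
  !![kernelEntry N σ (p u) (p v) 0 0, kernelEntry N σ (p u) (e v) 0 (chiReal v);
     kernelEntry N σ (e u) (p v) (chiReal u) 0,
     kernelEntry N σ (e u) (e v) (chiReal u) (chiReal v) + (1 / 2) * sgnDiff u v]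

/-- The scaling block `diag (1/N, 1)` for a real variable, `diag (1/N, 1/N)` for a non-real one. -/
def scaleBlock (N : ℕ) (u : ℂ) : Matrix (Fin 2) (Fin 2) ℂ :=
  !![1 / (N : ℂ), 0; 0, if u.im = 0 then 1 else 1 / (N : ℂ)]

/-- The matrix kernel scaled near `ξ`. -/
def scaledKernel (s : ℝ≥0∞) (N : ℕ) (π : ℕ → ℝ[X]) (ξ : ℝ) (u v : ℂ) :
    Matrix (Fin 2) (Fin 2) ℂ :=
  scaleBlock N u * kernel s N π ((ξ : ℂ) + u / (N : ℂ)) ((ξ : ℂ) + v / (N : ℂ))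
    * (scaleBlock N v).transpose

/-! ### The limiting kernel -/

/-- `ω(τ) = min {1, exp (-Re τ / λ)}`, and for `λ = 0` the characteristic function of the closed
left half-plane. -/
def omega (lam : ℝ) (τ : ℂ) : ℝ :=
  if lam = 0 then (if τ.re ≤ 0 then 1 else 0) else min 1 (Real.exp (-τ.re / lam))

/-- The confluent hypergeometric function `M = ₁F₁(3/2, 1; ·)`. -/
def kummerM (z : ℂ) : ℂ :=
  1 / (Real.Gamma (3 / 2) : ℂ) *
    ∑' n : ℕ, (Real.Gamma (n + 3 / 2) : ℂ) / (Real.Gamma (n + 1) : ℂ) *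
      (z ^ n / (n.factorial : ℂ))

/-- The scalar kernel `ϰ_ξ(u, v)`. -/
def kappa (lam ξ : ℝ) (u v : ℂ) : ℂ :=
  (omega lam (u * ξ) : ℂ) * (omega lam (v * ξ) : ℂ) * ((ξ : ℂ) / 4) *
    ∫ τ in (0 : ℝ)..1, (τ : ℂ) * (1 - (lam : ℂ) * τ) *
      (deriv kummerM (u * ξ * τ) * kummerM (v * ξ * τ)
        - kummerM (u * ξ * τ) * deriv kummerM (v * ξ * τ))

/-- The integral `∫_0^a f(u) du` along the line segment from `0` to `a`. -/
def segInt (f : ℂ → ℂ) (a : ℂ) : ℂ := a * ∫ t in (0 : ℝ)..1, f ((t : ℂ) * a)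

/-- The integrand `(ω(v ξ) / 4) ∫_0^1 (1 - λ u) M(v ξ u) du` of the correction terms. -/
def corrFun (lam ξ : ℝ) (v : ℂ) : ℂ :=
  (omega lam (v * ξ) : ℂ) / 4 *
    ∫ u in (0 : ℝ)..1, (1 - (lam : ℂ) * u) * kummerM (v * ξ * u)

/-- The function `A_ξ(a, b)`. -/
def Afun (lam ξ : ℝ) (a b : ℂ) : ℂ :=
  segInt (fun u => segInt (fun v => kappa lam ξ u v) b) a
    + (segInt (corrFun lam ξ) b - segInt (corrFun lam ξ) a)

/-! ### The differentiation `D` and the kernel matrix `𝐊[A]`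

`A_ξ` is not holomorphic; `D` is the derivative with respect to the end point of the path of
integration: along the real line at a real point, along the ray from `0` through `z` at a non-real
point `z`. -/

/-- The direction of differentiation. -/
def dir (z : ℂ) : ℂ := if z.im = 0 then 1 else z

/-- `f` has a derivative at `z` along the line (or ray) of `dir z`. -/
def DiffAlong (f : ℂ → ℂ) (z : ℂ) : Prop :=
  DifferentiableAt ℝ (fun t : ℝ => f (z + (t : ℂ) * dir z)) 0

/-- The derivative of `f` at `z` along the line (or ray) of `dir z`. At a real `z` it is the usual
derivative of the restriction of `f` to the real line. -/
def derivAlong (f : ℂ → ℂ) (z : ℂ) : ℂ :=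
  deriv (fun t : ℝ => f (z + (t : ℂ) * dir z)) 0 / dir z

/-- `DA`: differentiation with respect to the first variable. -/
def DL (A : ℂ → ℂ → ℂ) (u v : ℂ) : ℂ := derivAlong (fun a => A a v) u

/-- `AD`: differentiation with respect to the second variable. -/
def DR (A : ℂ → ℂ → ℂ) (u v : ℂ) : ℂ := derivAlong (fun b => A u b) v

/-- `DAD`. -/
def DLR (A : ℂ → ℂ → ℂ) (u v : ℂ) : ℂ := DL (DR A) u v

/-- `𝐊[A](x, y)` for real `x, y`. -/
def KRR (A : ℂ → ℂ → ℂ) (x y : ℂ) : Matrix (Fin 2) (Fin 2) ℂ :=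
  !![DLR A x y, -DL A x y; -DR A x y, A x y + (1 / 2) * sgnDiff x y]

/-- `𝐊[A](z, y)` for `z` not real and `y` real. -/
def KCR (A : ℂ → ℂ → ℂ) (z y : ℂ) : Matrix (Fin 2) (Fin 2) ℂ :=
  !![DLR A z y, -DL A z y;
     iota z * DLR A (conj z) y, -iota z * DL A (conj z) y]

/-- `𝐊[A](z, w)` for `z, w` not real. -/
def KCC (A : ℂ → ℂ → ℂ) (z w : ℂ) : Matrix (Fin 2) (Fin 2) ℂ :=
  !![DLR A z w, iota w * DLR A z (conj w);
     iota z * DLR A (conj z) w, iota z * iota w * DLR A (conj z) (conj w)]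

/-- The kernel matrix `𝐊[A](u, v)`; `𝐊[A](y, z) = -𝐊[A](z, y)ᵀ` for `y` real and `z` not real. -/
def kernelOf (A : ℂ → ℂ → ℂ) (u v : ℂ) : Matrix (Fin 2) (Fin 2) ℂ :=
  if u.im = 0 then
    if v.im = 0 then KRR A u v else -(KCR A v u).transpose
  else
    if v.im = 0 then KCR A u v else KCC A u v

end RealMahler

end

noncomputable section

namespace RealMahler

/-! ### Coefficients of binomial series and the polynomials -/

/-! Write `t = 1 / s`. The skew moments are explicit. Moments of equal parity vanish, and in `⟨X ^
(2k) | X ^ (2l+1)⟩` the integral over the real line and the integral over the plane combine to `2 /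
((2k+1) (1 - (2l+2) t) (l + 1/2 - k))` (`skew_monomial_identity`, `skew_X_pow_even_odd`). This is a
Cauchy matrix between two diagonal ones, so partial fractions (`sum_risingCoeff_div`) yield
skew-orthogonal polynomials `P_n = evenPoly (1/2) n` and `Q_n = oddPoly t n` with `⟨P_n | Q_n⟩ = 4`.
Nondegeneracy of the form and the normalization of the line integrals force `π (2n) = c P_n` and `π
(2n+1) = Q_n / (4c)`, and the constants `c` drop out of the kernel. For odd `N` the correction sums
are weighted by the line integrals of the `P_j`; these satisfy a one-step recurrence
(`lineMass_succ`), which makes the sums telescope.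

The operator `ε` at a real point is, up to sign, a primitive, so its value at `ξ + x / N` is its
value at `ξ` minus an integral starting at `ξ`. The values `ε P_n (ξ) = -ξ` and `ε Q_n (ξ) = t` do
not depend on `n`. Hence every entry of the scaled matrix is obtained by one recipe, `modelEntry`,
from three functions: the scaled weight, the scaled polynomial kernel and an edge function of one
variable (`scaledKernel_apply`). By Fubini, antisymmetry and the fundamental theorem of calculus,
the matrix of `A_ξ` arises by the same recipe from the three limits (`kernelOf_Afun_apply`). It
remains to let three scalar functions converge.

For this the even polynomials are re-expanded in powers of `z ^ 2 - 1`, where for `b = 1/2` and `b =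
-1/2` the coefficients are binomial coefficients times `(3/2)_m / m!`. At `z = ξ + u / N` one has `z
^ 2 - 1 ≈ 2 ξ u / N`, and dominated convergence of the sum gives `M` and `2τ (M' - M)` at `u ξ τ`
when the degree is about `τ N` (`tendsto_binomial_sum`). The sums over `j` are Riemann sums in `τ`
(`tendsto_riemann_sum`). The odd-`N` corrections tend to zero, by antisymmetry in the polynomial
kernel and by `ξ ^ 2 = 1` in the edge function. The weight is governed by `N log |ξ + u / N| → ξ Re
u`.

Uniformity comes from proving these limits along a general filter with arguments that move, i.e. as
continuous convergence. The entries themselves jump at the real axis, so the difference of the two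
model entries is shown to vanish, after splitting the filter according to which arguments are real
(`ModelConv.tendsto_modelEntry_sub`). For `lam = 0` the limiting weight jumps on the imaginary axis.
A segment from `0` to a nonzero real point meets that axis only at `0`, which explains why a real
variable on which `ε` acts is exempt from the restriction. -/

/-- The coefficient `(a)_n / n!` of `z ^ n` in `(1 - z) ^ (-a)`. -/
def risingCoeff (a : ℝ) (n : ℕ) : ℝ := ∏ i ∈ Finset.range n, (a + i) / (i + 1)

@[simp] lemma risingCoeff_zero (a : ℝ) : risingCoeff a 0 = 1 := by simp [risingCoeff]

lemma risingCoeff_succ (a : ℝ) (n : ℕ) :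
    risingCoeff a (n + 1) = risingCoeff a n * ((a + n) / (n + 1)) := by
  rw [risingCoeff, Finset.prod_range_succ, risingCoeff]

lemma succ_mul_risingCoeff_succ (a : ℝ) (n : ℕ) :
    ((n : ℝ) + 1) * risingCoeff a (n + 1) = (a + n) * risingCoeff a n := by
  rw [risingCoeff_succ]
  have : (n : ℝ) + 1 ≠ 0 := by positivity
  field_simp

lemma risingCoeff_pos {a : ℝ} (ha : 0 < a) (n : ℕ) : 0 < risingCoeff a n :=
  Finset.prod_pos fun i _ => by positivity

lemma risingCoeff_one (n : ℕ) : risingCoeff 1 n = 1 := by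
  refine Finset.prod_eq_one fun i _ => ?_
  have : (i : ℝ) + 1 ≠ 0 := by positivity
  rw [add_comm, div_self this]

/-- The Chu–Vandermonde convolution. -/
lemma sum_antidiagonal_risingCoeff (a b : ℝ) (n : ℕ) :
    ∑ p ∈ Finset.HasAntidiagonal.antidiagonal n, risingCoeff a p.1 * risingCoeff b p.2 = risingCoeff (a + b) n := by
  induction n with
  | zero => simp
  | succ n ih =>
    have hn : (n : ℝ) + 1 ≠ 0 := by positivity
    apply mul_left_cancel₀ hn
    rw [succ_mul_risingCoeff_succ, ← ih, Finset.mul_sum, Finset.mul_sum]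
    -- The factor `n + 1` is split as `p.1 + p.2`. Each half lowers one index by the recurrence of
    -- the coefficients, and the resulting factors `a + p.1` and `b + p.2` add up to `a + b + n`.
    have h1 : ∑ p ∈ Finset.HasAntidiagonal.antidiagonal (n + 1),
        ((n : ℝ) + 1) * (risingCoeff a p.1 * risingCoeff b p.2)
        = ∑ p ∈ Finset.HasAntidiagonal.antidiagonal (n + 1), ((p.1 : ℝ) * risingCoeff a p.1) * risingCoeff b p.2
          + ∑ p ∈ Finset.HasAntidiagonal.antidiagonal (n + 1), risingCoeff a p.1 * ((p.2 : ℝ) * risingCoeff b p.2) := by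
      rw [← Finset.sum_add_distrib]
      refine Finset.sum_congr rfl fun p hp => ?_
      have : (p.1 : ℝ) + p.2 = n + 1 := by exact_mod_cast Finset.HasAntidiagonal.mem_antidiagonal.1 hp
      rw [← this]; ring
    rw [h1, Finset.Nat.sum_antidiagonal_succ, Finset.Nat.sum_antidiagonal_succ']
    simp only [Nat.cast_zero, zero_mul, mul_zero, zero_add]
    rw [← Finset.sum_add_distrib]
    refine Finset.sum_congr rfl fun p hp => ?_
    have : (p.1 : ℝ) + p.2 = n := by exact_mod_cast Finset.HasAntidiagonal.mem_antidiagonal.1 hp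
    push_cast
    rw [succ_mul_risingCoeff_succ, succ_mul_risingCoeff_succ, ← this]; ring

/-- This is `(a)_{m+i} = (a)_m (a+m)_i` divided by factorials; it turns the binomial factors of a
re-expansion into a Vandermonde sum. -/
lemma risingCoeff_add (a : ℝ) (m i : ℕ) :
    risingCoeff a (m + i) * ((m + i).choose m : ℝ) = risingCoeff a m * risingCoeff (a + m) i := by
  induction i with
  | zero => simp
  | succ i ih =>
    have h : ((m + (i + 1)).choose m : ℝ) * (i + 1) = ((m + i).choose m : ℝ) * (m + i + 1) := by
      have h2 := Nat.add_one_mul_choose_eq (m + i) i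
      rw [← Nat.choose_symm_of_eq_add (show m + i = i + m by ring)]
      rw [← Nat.choose_symm_of_eq_add (show m + (i + 1) = (i + 1) + m by ring)]
      rw [← add_assoc, mul_comm ((m + i).choose i : ℝ)]
      exact_mod_cast h2.symm
    have hi : (i : ℝ) + 1 ≠ 0 := by positivity
    have hmi : (m : ℝ) + i + 1 ≠ 0 := by positivity
    rw [← add_assoc, risingCoeff_succ, risingCoeff_succ, ← mul_assoc, ← ih]
    have h' : ((m + i + 1).choose m : ℝ) = ((m + i).choose m : ℝ) * (m + i + 1) / (i + 1) := by
      rw [eq_div_iff hi]; exact h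
    rw [h']
    push_cast
    field_simp
    ring

lemma risingCoeff_natCast_succ (m i : ℕ) : risingCoeff (m + 1) i = ((m + i).choose m : ℝ) := by
  have := risingCoeff_add 1 m i
  rw [risingCoeff_one, risingCoeff_one, one_mul, one_mul, add_comm (1 : ℝ)] at this
  exact this.symm

/-- The partial fraction decomposition of `∏ (x - l - a) / ∏ (x - k)`. -/
lemma sum_risingCoeff_div (a x : ℝ) (n : ℕ) (hx : ∀ k ≤ n, x ≠ k) :
    ∑ k ∈ Finset.range (n + 1), risingCoeff (1 - a) k * risingCoeff a (n - k) / (x - k)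
      = (∏ l ∈ Finset.range n, (x - l - a)) / ∏ k ∈ Finset.range (n + 1), (x - k) := by
  induction n generalizing x with
  | zero => simp
  | succ n ih =>
    have ih1 := ih x fun k hk => hx k (hk.trans n.le_succ)
    have ih2 := ih ((n + 1 : ℕ) : ℝ) fun k hk => by
      have : n + 1 ≠ k := by omega
      exact_mod_cast this
    have hn : x - ((n + 1 : ℕ) : ℝ) ≠ 0 := sub_ne_zero.2 (hx (n + 1) le_rfl)
    -- The residue at the new pole `n + 1` is obtained from the inductive identity evaluated at `x =
    -- n + 1`.
    have hlast : (1 - a) * ∑ k ∈ Finset.range (n + 1),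
        risingCoeff (1 - a) k * risingCoeff a (n - k) / (((n + 1 : ℕ) : ℝ) - k)
        = risingCoeff (1 - a) (n + 1) := by
      rw [ih2, risingCoeff, Finset.prod_div_distrib, ← mul_div_assoc]
      congr 1
      · rw [Finset.prod_range_succ', mul_comm, Nat.cast_zero, add_zero]
        congr 1
        rw [← Finset.prod_range_reflect]
        refine Finset.prod_congr rfl fun j hj => ?_
        have hj' := Finset.mem_range.1 hj
        have : ((n - 1 - j : ℕ) : ℝ) = n - 1 - j := by
          rw [Nat.cast_sub (by omega), Nat.cast_sub (by omega)]; simp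
        rw [this]; push_cast; ring
      · rw [← Finset.prod_range_reflect]
        refine Finset.prod_congr rfl fun j hj => ?_
        have hj' := Finset.mem_range.1 hj
        have : ((n + 1 - 1 - j : ℕ) : ℝ) = n - j := by
          rw [Nat.cast_sub (by omega)]; simp
        rw [this]; push_cast; ring
    rw [Finset.sum_range_succ, Nat.sub_self, risingCoeff_zero, mul_one, ← hlast,
      Finset.mul_sum, Finset.sum_div, ← Finset.sum_add_distrib]
    -- The contribution of the new pole has been distributed over the old terms; each old term then
    -- acquires the same factor, which is the ratio of consecutive right-hand sides.
    have key : ∀ k ∈ Finset.range (n + 1),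
        risingCoeff (1 - a) k * risingCoeff a (n + 1 - k) / (x - k)
          + (1 - a) * (risingCoeff (1 - a) k * risingCoeff a (n - k) / (((n + 1 : ℕ) : ℝ) - k))
            / (x - ((n + 1 : ℕ) : ℝ))
        = (x - n - a) / (x - ((n + 1 : ℕ) : ℝ)) *
          (risingCoeff (1 - a) k * risingCoeff a (n - k) / (x - k)) := by
      intro k hk
      have hk' := Finset.mem_range.1 hk
      have e : n + 1 - k = (n - k) + 1 := by omega
      have hnk : ((n : ℝ) + 1 - k) ≠ 0 := by
        have : (k : ℝ) ≤ n := by exact_mod_cast (by omega : k ≤ n)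
        intro h; linarith
      have hxk : x - k ≠ 0 := sub_ne_zero.2 (hx k (by omega))
      rw [e, risingCoeff_succ, Nat.cast_sub (by omega)]
      push_cast at hn ⊢
      have h2 : ((n : ℝ) - k + 1) ≠ 0 := by convert hnk using 1; ring
      field_simp
      ring
    rw [Finset.sum_congr rfl key, ← Finset.mul_sum, ih1,
      Finset.prod_range_succ (fun l : ℕ => x - l - a) n,
      Finset.prod_range_succ (fun l : ℕ => x - (l : ℝ)) (n + 1)]
    rw [div_mul_div_comm]
    congr 1 <;> ring

/-- `∑ (3/2)_k / k! (b)_{n - k} / (n - k)! X ^ (2 k)`. -/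
def evenPoly (b : ℝ) (n : ℕ) : ℝ[X] :=
  ∑ k ∈ Finset.range (n + 1),
    Polynomial.C (risingCoeff (3 / 2) k * risingCoeff b (n - k)) * Polynomial.X ^ (2 * k)

/-- The skew-orthogonal polynomials of odd degree, for the weight with exponent `1 / t`. -/
def oddPoly (t : ℝ) (n : ℕ) : ℝ[X] :=
  ∑ k ∈ Finset.range (n + 1),
    Polynomial.C (risingCoeff (3 / 2) k * risingCoeff (-(1 / 2)) (n - k) * (1 - (2 * k + 2) * t))
      * Polynomial.X ^ (2 * k + 1)

lemma aeval_evenPoly (b : ℝ) (n : ℕ) (z : ℂ) :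
    Polynomial.aeval z (evenPoly b n) = ∑ k ∈ Finset.range (n + 1),
      ((risingCoeff (3 / 2) k * risingCoeff b (n - k) : ℝ) : ℂ) * z ^ (2 * k) := by
  simp [evenPoly]

lemma aeval_oddPoly (t : ℝ) (n : ℕ) (z : ℂ) :
    Polynomial.aeval z (oddPoly t n) = ∑ k ∈ Finset.range (n + 1),
      ((risingCoeff (3 / 2) k * risingCoeff (-(1 / 2)) (n - k) * (1 - (2 * k + 2) * t) : ℝ) : ℂ)
        * z ^ (2 * k + 1) := by
  simp [oddPoly]

/-- Expanding `z ^ (2k) = ((z ^ 2 - 1) + 1) ^ k` and collecting `(z ^ 2 - 1) ^ m`, the coefficient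
with `k = m + i` becomes a Vandermonde convolution in `i`. When `b = 1/2` or `b = -1/2` the
parameter `3/2 + m + b` is an integer, so that binomial coefficients appear. -/
lemma aeval_evenPoly_eq (b : ℝ) (n : ℕ) (z : ℂ) :
    Polynomial.aeval z (evenPoly b n) = ∑ m ∈ Finset.range (n + 1),
      ((risingCoeff (3 / 2) m * risingCoeff (3 / 2 + m + b) (n - m) : ℝ) : ℂ)
        * (z ^ 2 - 1) ^ m := by
  have h : ∀ k ∈ Finset.range (n + 1),
      ((risingCoeff (3 / 2) k * risingCoeff b (n - k) : ℝ) : ℂ) * z ^ (2 * k)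
      = ∑ m ∈ Finset.range (n + 1), ((risingCoeff (3 / 2) k * risingCoeff b (n - k) : ℝ) : ℂ)
          * ((z ^ 2 - 1) ^ m * (k.choose m : ℂ)) := by
    intro k hk
    rw [← Finset.mul_sum]
    congr 1
    have : z ^ (2 * k) = ((z ^ 2 - 1) + 1) ^ k := by rw [pow_mul]; ring
    rw [this, add_pow]
    simp only [one_pow, mul_one]
    refine Finset.sum_subset ?_ ?_
    · intro m hm
      have := Finset.mem_range.1 hk
      have := Finset.mem_range.1 hm
      exact Finset.mem_range.2 (by omega)
    · intro m _ hm
      have : k < m := by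
        by_contra hh
        exact hm (Finset.mem_range.2 (by omega))
      simp [Nat.choose_eq_zero_of_lt this]
  rw [aeval_evenPoly, Finset.sum_congr rfl h, Finset.sum_comm]
  refine Finset.sum_congr rfl fun m hm => ?_
  have hm' := Finset.mem_range.1 hm
  rw [← sum_antidiagonal_risingCoeff, Finset.Nat.sum_antidiagonal_eq_sum_range_succ_mk,
    Finset.mul_sum]
  push_cast
  rw [Finset.sum_mul]
  have e : n + 1 = m + (n - m + 1) := by omega
  rw [e, Finset.sum_range_add]
  have z0 : ∑ k ∈ Finset.range m, (risingCoeff (3 / 2) k : ℂ) * (risingCoeff b (n - k) : ℂ)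
      * ((z ^ 2 - 1) ^ m * (k.choose m : ℂ)) = 0 := by
    refine Finset.sum_eq_zero fun k hk => ?_
    simp [Nat.choose_eq_zero_of_lt (Finset.mem_range.1 hk)]
  rw [z0, zero_add]
  refine Finset.sum_congr rfl fun i hi => ?_
  have := risingCoeff_add (3 / 2) m i
  have h1 : n - (m + i) = n - m - i := by omega
  rw [h1]
  have h2 : (risingCoeff (3 / 2) (m + i) : ℂ) * ((m + i).choose m : ℂ)
    = (risingCoeff (3 / 2) m : ℂ) * (risingCoeff (3 / 2 + m) i : ℂ) := by exact_mod_cast this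
  linear_combination (risingCoeff b (n - m - i) : ℂ) * (z ^ 2 - 1) ^ m * h2

/-- The values of the polynomials of even index as a combination of powers of `z ^ 2 - 1`. -/
lemma aeval_evenPoly_half (n : ℕ) (z : ℂ) :
    Polynomial.aeval z (evenPoly (1 / 2) n) = ∑ m ∈ Finset.range (n + 1),
      (risingCoeff (3 / 2) m : ℂ) * ((n + 1).choose (m + 1) : ℂ) * (z ^ 2 - 1) ^ m := by
  rw [aeval_evenPoly_eq]
  refine Finset.sum_congr rfl fun m hm => ?_
  have hm' := Finset.mem_range.1 hm
  have : risingCoeff (3 / 2 + m + 1 / 2) (n - m) = ((n + 1).choose (m + 1) : ℝ) := by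
    have := risingCoeff_natCast_succ (m + 1) (n - m)
    rw [show m + 1 + (n - m) = n + 1 by omega] at this
    rw [← this]; congr 1; push_cast; ring
  rw [this]; push_cast; ring

lemma aeval_evenPoly_neg_half (n : ℕ) (z : ℂ) :
    Polynomial.aeval z (evenPoly (-(1 / 2)) n) = ∑ m ∈ Finset.range (n + 1),
      (risingCoeff (3 / 2) m : ℂ) * (n.choose m : ℂ) * (z ^ 2 - 1) ^ m := by
  rw [aeval_evenPoly_eq]
  refine Finset.sum_congr rfl fun m hm => ?_
  have hm' := Finset.mem_range.1 hm
  have : risingCoeff (3 / 2 + m + -(1 / 2)) (n - m) = (n.choose m : ℝ) := by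
    have := risingCoeff_natCast_succ m (n - m)
    rw [show m + (n - m) = n by omega] at this
    rw [← this]; congr 1; ring
  rw [this]; push_cast; ring

lemma evenPoly_zero (b : ℝ) : evenPoly b 0 = 1 := by simp [evenPoly]

/-- Pascal's rule in the expansion in powers of `z ^ 2 - 1`. The polynomials with `b = -1/2` are
thus increments of those with `b = 1/2`, which drives the telescoping for odd `N`. -/
lemma aeval_evenPoly_succ (n : ℕ) (z : ℂ) :
    Polynomial.aeval z (evenPoly (1 / 2) (n + 1)) = Polynomial.aeval z (evenPoly (1 / 2) n)
      + Polynomial.aeval z (evenPoly (-(1 / 2)) (n + 1)) := by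
  rw [aeval_evenPoly_half, aeval_evenPoly_half, aeval_evenPoly_neg_half]
  have : ∑ m ∈ Finset.range (n + 1),
      (risingCoeff (3 / 2) m : ℂ) * ((n + 1).choose (m + 1) : ℂ) * (z ^ 2 - 1) ^ m
      = ∑ m ∈ Finset.range (n + 1 + 1),
      (risingCoeff (3 / 2) m : ℂ) * ((n + 1).choose (m + 1) : ℂ) * (z ^ 2 - 1) ^ m := by
    rw [Finset.sum_range_succ _ (n + 1)]
    simp
  rw [this, ← Finset.sum_add_distrib]
  refine Finset.sum_congr rfl fun m _ => ?_
  rw [Nat.choose_succ_succ (n + 1) m]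
  push_cast; ring

lemma risingCoeff_half (m : ℕ) :
    risingCoeff (1 / 2) m = (1 - 2 * m) * risingCoeff (-(1 / 2)) m := by
  induction m with
  | zero => simp
  | succ m ih =>
    rw [risingCoeff_succ, risingCoeff_succ, ih]
    have : (m : ℝ) + 1 ≠ 0 := by positivity
    push_cast
    field_simp
    ring

lemma risingCoeff_three_halves (m : ℕ) :
    risingCoeff (3 / 2) m = (2 * m + 1) * risingCoeff (1 / 2) m := by
  induction m with
  | zero => simp
  | succ m ih =>
    rw [risingCoeff_succ, risingCoeff_succ, ih]
    have : (m : ℝ) + 1 ≠ 0 := by positivity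
    push_cast
    field_simp
    ring

/-- Passing from `b = -1/2` to `b = 1/2` multiplies the coefficient by `1 - 2 (n - k)`, so the
`k`-dependent factor `1 - (2k+2) t` is a combination of the two families with coefficients free of
`k`. All asymptotics thereby reduce to even polynomials. -/
lemma aeval_oddPoly_eq (t : ℝ) (n : ℕ) (z : ℂ) :
    Polynomial.aeval z (oddPoly t n) = z * ((1 - (2 * n + 1) * t) *
      Polynomial.aeval z (evenPoly (-(1 / 2)) n) - t * Polynomial.aeval z (evenPoly (1 / 2) n)) := by
  rw [aeval_oddPoly, aeval_evenPoly, aeval_evenPoly, Finset.mul_sum, Finset.mul_sum,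
    ← Finset.sum_sub_distrib, Finset.mul_sum]
  refine Finset.sum_congr rfl fun k hk => ?_
  have hk' := Finset.mem_range.1 hk
  have h := risingCoeff_half (n - k)
  rw [Nat.cast_sub (by omega)] at h
  rw [h]
  push_cast
  ring

/-! ### The weight on the real line -/

/-- The reciprocal exponent `1 / s` of the weight, equal to `0` for `s = ∞`. -/
def invExp (s : ℝ≥0∞) : ℝ := (s⁻¹).toReal

lemma invExp_nonneg (s : ℝ≥0∞) : 0 ≤ invExp s := ENNReal.toReal_nonneg

@[simp] lemma invExp_top : invExp ∞ = 0 := by simp [invExp]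

lemma invExp_eq (s : ℝ≥0∞) : invExp s = s.toReal⁻¹ := by simp [invExp, ENNReal.toReal_inv]

lemma natCast_mul_invExp_lt_one {s : ℝ≥0∞} {N : ℕ} (h : (N : ℝ≥0∞) < s) :
    (N : ℝ) * invExp s < 1 := by
  by_cases hs : s = ∞
  · simp [hs]
  have h1 : (N : ℝ) < s.toReal := by
    have := (ENNReal.toReal_lt_toReal (ENNReal.natCast_ne_top N) hs).2 h
    simpa using this
  have h0 : 0 < s.toReal := (Nat.cast_nonneg N).trans_lt h1
  rw [invExp_eq, ← div_eq_mul_inv, div_lt_one h0]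
  exact h1

lemma weight_nonneg (s : ℝ≥0∞) (u : ℂ) : 0 ≤ weight s u := by
  unfold weight; split_ifs <;> positivity

lemma weight_le_one (s : ℝ≥0∞) (u : ℂ) : weight s u ≤ 1 := by
  unfold weight
  split_ifs
  · exact le_rfl
  · exact zero_le_one
  · exact Real.rpow_le_one_of_one_le_of_nonpos (le_max_left _ _) (by simp)

lemma weight_of_norm_le_one (s : ℝ≥0∞) {u : ℂ} (hu : ‖u‖ ≤ 1) : weight s u = 1 := by
  unfold weight
  split_ifs <;> simp [max_eq_left hu]

lemma weight_of_one_lt_norm (s : ℝ≥0∞) {u : ℂ} (hu : 1 < ‖u‖) :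
    weight s u = if s = ∞ then 0 else ‖u‖ ^ (-s.toReal) := by
  unfold weight
  rw [if_neg (not_le.2 hu), max_eq_right hu.le]

lemma weight_congr (s : ℝ≥0∞) {u v : ℂ} (h : ‖u‖ = ‖v‖) : weight s u = weight s v := by
  simp [weight, h]

@[simp] lemma weight_neg (s : ℝ≥0∞) (u : ℂ) : weight s (-u) = weight s u :=
  weight_congr s (norm_neg u)

lemma measurable_weight (s : ℝ≥0∞) : Measurable (weight s) := by
  unfold weight
  split_ifs
  · exact Measurable.ite (measurableSet_le measurable_norm measurable_const) measurable_const
      measurable_const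
  · fun_prop

/-- The restriction of a weighted polynomial to the real line. -/
def realWeighted (s : ℝ≥0∞) (p : ℝ[X]) (x : ℝ) : ℝ := weight s (x : ℂ) * p.eval x

lemma weighted_ofReal (s : ℝ≥0∞) (p : ℝ[X]) (x : ℝ) :
    weighted s p (x : ℂ) = (realWeighted s p x : ℂ) := by
  have : Polynomial.aeval (x : ℂ) p = ((p.eval x : ℝ) : ℂ) := by
    rw [← Polynomial.coe_aeval_eq_eval]
    exact Polynomial.aeval_algebraMap_apply ℂ x p
  rw [weighted, realWeighted, this, Complex.ofReal_mul]

lemma realWeighted_sum {ι : Type*} (s : ℝ≥0∞) (I : Finset ι) (c : ι → ℝ) (p : ι → ℝ[X]) (x : ℝ) :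
    realWeighted s (∑ i ∈ I, Polynomial.C (c i) * p i) x
      = ∑ i ∈ I, c i * realWeighted s (p i) x := by
  simp only [realWeighted, Polynomial.eval_finsetSum, Finset.mul_sum, Polynomial.eval_mul,
    Polynomial.eval_C]
  exact Finset.sum_congr rfl fun i _ => by ring

/-- Powers of the weight times monomials on a half line. -/
lemma integral_weight_pow_mul_pow {s : ℝ≥0∞} (hs : s ≠ 0) {k m : ℕ}
    (h : ((m : ℝ) + 1) * invExp s < k) {x : ℝ} (hx : 1 ≤ x) :
    IntegrableOn (fun y : ℝ => weight s (y : ℂ) ^ k * y ^ m) (Set.Ioi x) ∧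
    ∫ y in Set.Ioi x, weight s (y : ℂ) ^ k * y ^ m
      = invExp s / (k - (m + 1) * invExp s) * (x ^ (m + 1) * weight s (x : ℂ) ^ k) := by
  have hk : k ≠ 0 := by
    rintro rfl
    have := mul_nonneg (by positivity : (0 : ℝ) ≤ (m : ℝ) + 1) (invExp_nonneg s)
    simp at h
    linarith
  have hx0 : 0 < x := by linarith
  by_cases hs' : s = ∞
  · have h0 : Set.EqOn (fun y : ℝ => weight s (y : ℂ) ^ k * y ^ m) (fun _ => 0) (Set.Ioi x) := by
      intro y hy
      have hy' : x < y := hy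
      have : 1 < ‖(y : ℂ)‖ := by
        rw [Complex.norm_real, Real.norm_of_nonneg (by linarith)]; linarith
      simp only
      rw [weight_of_one_lt_norm s this, if_pos hs', zero_pow hk, zero_mul]
    refine ⟨(integrableOn_congr_fun h0 measurableSet_Ioi).2 integrableOn_zero, ?_⟩
    rw [setIntegral_congr_fun measurableSet_Ioi h0, hs']
    simp
  · have hS : 0 < s.toReal := ENNReal.toReal_pos hs hs'
    set S := s.toReal with hSdef
    have ht : invExp s = S⁻¹ := invExp_eq s
    -- The hypothesis `h` is exactly integrability of `y ^ (m - k S)` at infinity.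
    have hmS : (m : ℝ) - k * S < -1 := by
      rw [ht, ← div_eq_mul_inv, div_lt_iff₀ hS] at h
      linarith
    have hw : ∀ y : ℝ, 1 ≤ y → weight s (y : ℂ) ^ k = y ^ (-(k * S)) := by
      intro y hy
      have hy0 : (0 : ℝ) ≤ y := by linarith
      rw [weight, if_neg hs', Complex.norm_real, Real.norm_of_nonneg hy0, max_eq_right hy,
        ← Real.rpow_natCast, ← Real.rpow_mul hy0]
      congr 1; ring
    have h0 : Set.EqOn (fun y : ℝ => weight s (y : ℂ) ^ k * y ^ m)
        (fun y => y ^ ((m : ℝ) - k * S)) (Set.Ioi x) := by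
      intro y hy
      have hy' : x < y := hy
      simp only
      rw [hw y (by linarith), ← Real.rpow_natCast, ← Real.rpow_add (by linarith)]
      congr 1; ring
    refine ⟨(integrableOn_congr_fun h0 measurableSet_Ioi).2
      (integrableOn_Ioi_rpow_of_lt hmS hx0), ?_⟩
    rw [setIntegral_congr_fun measurableSet_Ioi h0, integral_Ioi_rpow_of_lt hmS hx0, hw x hx, ht,
      ← Real.rpow_natCast, ← Real.rpow_add hx0]
    have e : ((m : ℝ) - k * S + 1) = ((m + 1 : ℕ) : ℝ) + -(k * S) := by push_cast; ring
    rw [e]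
    have h1 : ((m + 1 : ℕ) : ℝ) + -(k * S) ≠ 0 := by push_cast; linarith
    have h2 : (k : ℝ) - (m + 1) * S⁻¹ ≠ 0 := by
      rw [← ht]; linarith
    have h3 : (k : ℝ) * S - (m + 1) ≠ 0 := by linarith
    push_cast at h1 ⊢
    have h4 : S⁻¹ / ((k : ℝ) - (m + 1) * S⁻¹) = 1 / (k * S - (m + 1)) := by
      field_simp
    rw [h4]
    have h5 : (m : ℝ) + 1 + -(k * S) = -(k * S - (m + 1)) := by ring
    rw [h5]
    field_simp

lemma integrable_of_integrableOn_Ioi {f : ℝ → ℝ} (h : IntegrableOn f (Set.Ioi 0))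
    (h' : IntegrableOn (fun x => f (-x)) (Set.Ioi 0)) : Integrable f := by
  have h1 : IntegrableOn f (Set.Iio 0) := by
    have := (Measure.measurePreserving_neg (volume : Measure ℝ)).integrableOn_comp_preimage
      (Homeomorph.neg ℝ).measurableEmbedding (f := f) (s := Set.Iio 0)
    rw [← this]
    simpa [Function.comp_def] using h'
  rw [← integrableOn_univ, ← Set.Iic_union_Ioi (a := (0 : ℝ)), integrableOn_union]
  exact ⟨(integrableOn_Iic_iff_integrableOn_Iio).2 h1, h⟩

/-- The integral of an even function. -/
lemma integral_eq_two_mul_of_even {f : ℝ → ℝ} (hf : ∀ x, f (-x) = f x) :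
    ∫ x, f x = 2 * ∫ x in Set.Ioi 0, f x := by
  rw [← integral_comp_abs]
  congr 1
  ext x
  rcases abs_choice x with h | h <;> rw [h]
  exact (hf x).symm

lemma integral_eq_zero_of_odd {f : ℝ → ℝ} (hf : ∀ x, f (-x) = -f x) : ∫ x, f x = 0 := by
  have h : ∫ x, f (-x) = ∫ x, f x := integral_neg_eq_self f volume
  simp only [hf, integral_neg] at h
  linarith

lemma realWeighted_X_pow_neg (s : ℝ≥0∞) (m : ℕ) (x : ℝ) :
    realWeighted s (Polynomial.X ^ m) (-x) = (-1) ^ m * realWeighted s (Polynomial.X ^ m) x := by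
  simp only [realWeighted, Polynomial.eval_pow, Polynomial.eval_X, Complex.ofReal_neg, weight_neg]
  rw [neg_pow]; ring

lemma realWeighted_X_pow_of_le (s : ℝ≥0∞) (m : ℕ) {x : ℝ} (hx : |x| ≤ 1) :
    realWeighted s (Polynomial.X ^ m) x = x ^ m := by
  rw [realWeighted, weight_of_norm_le_one s (by simpa using hx)]
  simp

lemma integrableOn_realWeighted_X_pow {s : ℝ≥0∞} (hs : s ≠ 0) {m : ℕ}
    (h : ((m : ℝ) + 1) * invExp s < 1) :
    IntegrableOn (realWeighted s (Polynomial.X ^ m)) (Set.Ioi 0) := by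
  rw [← Set.Ioc_union_Ioi_eq_Ioi (zero_le_one' ℝ), integrableOn_union]
  constructor
  · have : Set.EqOn (realWeighted s (Polynomial.X ^ m)) (fun x => x ^ m) (Set.Ioc 0 1) := by
      intro x hx
      exact realWeighted_X_pow_of_le s m (abs_le.2 ⟨by linarith [hx.1], hx.2⟩)
    rw [integrableOn_congr_fun this measurableSet_Ioc]
    exact ((continuous_id.pow m).integrableOn_Icc).mono_set Set.Ioc_subset_Icc_self
  · have := (integral_weight_pow_mul_pow hs (k := 1) (m := m) (by simpa using h) le_rfl).1
    unfold realWeighted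
    simpa using this

lemma integrable_realWeighted_X_pow {s : ℝ≥0∞} (hs : s ≠ 0) {m : ℕ}
    (h : ((m : ℝ) + 1) * invExp s < 1) : Integrable (realWeighted s (Polynomial.X ^ m)) := by
  refine integrable_of_integrableOn_Ioi (integrableOn_realWeighted_X_pow hs h) ?_
  simp only [realWeighted_X_pow_neg]
  exact (integrableOn_realWeighted_X_pow hs h).const_mul _

lemma ne_zero_of_natCast_lt {s : ℝ≥0∞} {N : ℕ} (h : (N : ℝ≥0∞) < s) : s ≠ 0 :=
  (bot_le.trans_lt h).ne'

lemma succ_mul_invExp_lt_one {s : ℝ≥0∞} {N m : ℕ} (h : (N : ℝ≥0∞) < s) (hm : m < N) :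
    ((m : ℝ) + 1) * invExp s < 1 :=
  lt_of_le_of_lt (mul_le_mul_of_nonneg_right (by exact_mod_cast hm) (invExp_nonneg s))
    (natCast_mul_invExp_lt_one h)

lemma eq_sum_C_coeff_mul_X_pow {N : ℕ} {p : ℝ[X]} (hp : p.degree < N) :
    p = ∑ m ∈ Finset.range N, Polynomial.C (p.coeff m) * Polynomial.X ^ m := by
  ext k
  simp only [Polynomial.finsetSum_coeff, Polynomial.coeff_C_mul_X_pow, Finset.sum_ite_eq,
    Finset.mem_range]
  split_ifs with hk
  · rfl
  · exact Polynomial.coeff_eq_zero_of_degree_lt (hp.trans_le (by exact_mod_cast not_lt.1 hk))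

lemma realWeighted_eq_sum (s : ℝ≥0∞) {N : ℕ} {p : ℝ[X]} (hp : p.degree < N) (x : ℝ) :
    realWeighted s p x
      = ∑ m ∈ Finset.range N, p.coeff m * realWeighted s (Polynomial.X ^ m) x := by
  rw [← realWeighted_sum]
  congr 1
  exact eq_sum_C_coeff_mul_X_pow hp

lemma integrable_realWeighted {s : ℝ≥0∞} {N : ℕ} (h : (N : ℝ≥0∞) < s) {p : ℝ[X]}
    (hp : p.degree < N) : Integrable (realWeighted s p) := by
  have : realWeighted s p
      = fun x => ∑ m ∈ Finset.range N, p.coeff m * realWeighted s (Polynomial.X ^ m) x :=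
    funext fun x => realWeighted_eq_sum s hp x
  rw [this]
  exact integrable_finsetSum _ fun m hm =>
    (integrable_realWeighted_X_pow (ne_zero_of_natCast_lt h)
      (succ_mul_invExp_lt_one h (Finset.mem_range.1 hm))).const_mul _

/-! ### The integral against a sign function -/

/-- The integral of `f(y) sgn(y - x)` over the real line. -/
def signInt (f : ℝ → ℝ) (x : ℝ) : ℝ := ∫ y, f y * Real.sign (y - x)

lemma measurable_sign : Measurable Real.sign := by
  unfold Real.sign
  exact Measurable.ite measurableSet_Iio measurable_const
    (Measurable.ite measurableSet_Ioi measurable_const measurable_const)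

lemma signInt_eq {f : ℝ → ℝ} (hf : Integrable f) (x : ℝ) :
    signInt f x = (∫ y in Set.Ioi x, f y) - ∫ y in Set.Iic x, f y := by
  have h : ∀ y, f y * Real.sign (y - x)
      = (Set.Ioi x).indicator f y - (Set.Iio x).indicator f y := by
    intro y
    rcases lt_trichotomy y x with h | h | h
    · simp [Real.sign_of_neg (sub_neg.2 h), h, h.le]
    · simp [h]
    · simp [Real.sign_of_pos (sub_pos.2 h), h, h.le]
  simp only [signInt, h]
  rw [integral_sub (hf.indicator measurableSet_Ioi) (hf.indicator measurableSet_Iio),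
    integral_indicator measurableSet_Ioi, integral_indicator measurableSet_Iio,
    integral_Iic_eq_integral_Iio]

lemma signInt_eq_two_mul_sub {f : ℝ → ℝ} (hf : Integrable f) (x : ℝ) :
    signInt f x = 2 * (∫ y in Set.Ioi x, f y) - ∫ y, f y := by
  rw [signInt_eq hf, ← intervalIntegral.integral_Iic_add_Ioi (b := x) hf.integrableOn hf.integrableOn]
  ring

lemma signInt_sub {f : ℝ → ℝ} (hf : Integrable f) (a b : ℝ) :
    signInt f b - signInt f a = -2 * ∫ y in a..b, f y := by
  rw [signInt_eq_two_mul_sub hf, signInt_eq_two_mul_sub hf,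
    ← intervalIntegral.integral_Ioi_sub_Ioi' (a := a) (b := b) hf.integrableOn hf.integrableOn]
  ring

lemma abs_signInt_le {f : ℝ → ℝ} (hf : Integrable f) (x : ℝ) : |signInt f x| ≤ ∫ y, |f y| := by
  refine (norm_integral_le_integral_norm (fun y => f y * Real.sign (y - x))).trans ?_
  refine integral_mono_of_nonneg (ae_of_all _ fun y => norm_nonneg _) hf.abs (ae_of_all _ fun y => ?_)
  simp only [norm_mul, Real.norm_eq_abs]
  have : |Real.sign (y - x)| ≤ 1 := by
    rcases Real.sign_apply_eq (y - x) with h | h | h <;> simp [h]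
  nlinarith [abs_nonneg (f y)]

lemma continuous_signInt {f : ℝ → ℝ} (hf : Integrable f) : Continuous (signInt f) := by
  have : signInt f = fun x => signInt f 0 + -2 * ∫ y in (0 : ℝ)..x, f y := by
    ext x; rw [← signInt_sub hf 0 x]; ring
  rw [this]
  exact continuous_const.add (continuous_const.mul (intervalIntegral.continuous_primitive
    (fun a b => hf.intervalIntegrable) 0))

lemma integrable_mul_signInt {f g : ℝ → ℝ} (hf : Integrable f) (hg : Integrable g) :
    Integrable fun x => f x * signInt g x :=
  hf.mul_bdd (c := ∫ y, |g y|) (continuous_signInt hg).aestronglyMeasurable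
    (ae_of_all _ fun x => abs_signInt_le hg x)

lemma signInt_neg (f : ℝ → ℝ) (c : ℝ) (hf : ∀ x, f (-x) = c * f x) (x : ℝ) :
    signInt f (-x) = -c * signInt f x := by
  rw [signInt, ← integral_neg_eq_self, signInt, ← integral_const_mul]
  congr 1
  ext y
  rw [hf, show -y - -x = -(y - x) by ring, Real.sign_neg]; ring

lemma signInt_sum {ι : Type*} (I : Finset ι) (c : ι → ℝ) (f : ι → ℝ → ℝ)
    (hf : ∀ i ∈ I, Integrable (f i)) (x : ℝ) :
    signInt (fun y => ∑ i ∈ I, c i * f i y) x = ∑ i ∈ I, c i * signInt (f i) x := by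
  have hm : AEStronglyMeasurable (fun y => Real.sign (y - x)) (volume : Measure ℝ) :=
    (measurable_sign.comp (measurable_id.sub_const x)).aestronglyMeasurable
  simp only [signInt, Finset.sum_mul]
  rw [integral_finsetSum]
  · refine Finset.sum_congr rfl fun i _ => ?_
    rw [← integral_const_mul]
    congr 1; ext y; ring
  · intro i hi
    refine ((hf i hi).const_mul (c i)).mul_bdd (c := 1) hm (ae_of_all _ fun y => ?_)
    rcases Real.sign_apply_eq (y - x) with h | h | h <;> simp [h]

lemma skewReal_eq (s : ℝ≥0∞) (f g : ℝ[X]) :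
    skewReal s f g = ∫ x, realWeighted s f x * signInt (realWeighted s g) x := by
  rw [skewReal]
  congr 1
  ext x
  rw [signInt, ← integral_const_mul]
  congr 1
  ext y
  simp only [realWeighted]
  ring

/-- The tail integrals of odd weighted monomials. -/
lemma signInt_realWeighted_X_pow_odd {s : ℝ≥0∞} (hs : s ≠ 0) {l : ℕ}
    (h : (2 * (l : ℝ) + 2) * invExp s < 1) :
    (∀ x, 1 ≤ x → signInt (realWeighted s (Polynomial.X ^ (2 * l + 1))) x
      = 2 * (invExp s / (1 - (2 * l + 2) * invExp s) * (x ^ (2 * l + 2) * weight s (x : ℂ)))) ∧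
    (∀ x, 0 ≤ x → x ≤ 1 → signInt (realWeighted s (Polynomial.X ^ (2 * l + 1))) x
      = 2 * (invExp s / (1 - (2 * l + 2) * invExp s) + (1 - x ^ (2 * l + 2)) / (2 * l + 2))) := by
  have h' : (((2 * l + 1 : ℕ) : ℝ) + 1) * invExp s < 1 := by
    push_cast
    convert h using 2; ring
  have hi := integrable_realWeighted_X_pow hs h'
  have h0 : ∫ y, realWeighted s (Polynomial.X ^ (2 * l + 1)) y = 0 :=
    integral_eq_zero_of_odd fun x => by
      rw [realWeighted_X_pow_neg, Odd.neg_one_pow ⟨l, rfl⟩]; ring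
  have h1 : ∀ x, 1 ≤ x → signInt (realWeighted s (Polynomial.X ^ (2 * l + 1))) x
      = 2 * (invExp s / (1 - (2 * l + 2) * invExp s) * (x ^ (2 * l + 2) * weight s (x : ℂ))) := by
    intro x hx
    have := (integral_weight_pow_mul_pow hs (k := 1) (m := 2 * l + 1) (by simpa using h') hx).2
    rw [signInt_eq_two_mul_sub hi, h0, sub_zero]
    simp only [pow_one] at this
    simp only [realWeighted, Polynomial.eval_pow, Polynomial.eval_X]
    rw [this]
    push_cast
    ring_nf
  refine ⟨h1, fun x hx0 hx1 => ?_⟩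
  have h2 := signInt_sub hi x 1
  rw [h1 1 le_rfl] at h2
  have h3 : ∫ y in x..1, realWeighted s (Polynomial.X ^ (2 * l + 1)) y
      = ∫ y in x..1, y ^ (2 * l + 1) := by
    refine intervalIntegral.integral_congr fun y hy => ?_
    rw [Set.uIcc_of_le hx1] at hy
    exact realWeighted_X_pow_of_le s _ (abs_le.2 ⟨by linarith [hy.1], hy.2⟩)
  rw [h3, integral_pow, weight_of_norm_le_one s (by simp)] at h2
  push_cast at h2
  have h4 : (2 * (l : ℝ) + 1 + 1) = 2 * l + 2 := by ring
  rw [h4] at h2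
  simp only [one_pow, mul_one] at h2
  linarith

/-! ### Skew products of monomials -/

lemma skewReal_X_pow_even_even (s : ℝ≥0∞) (k l : ℕ) :
    skewReal s (Polynomial.X ^ (2 * k)) (Polynomial.X ^ (2 * l)) = 0 := by
  rw [skewReal_eq]
  refine integral_eq_zero_of_odd fun x => ?_
  have h : ∀ (n : ℕ) (x : ℝ), realWeighted s (Polynomial.X ^ (2 * n)) (-x)
      = 1 * realWeighted s (Polynomial.X ^ (2 * n)) x := fun n x => by
    rw [realWeighted_X_pow_neg, Even.neg_one_pow (even_two_mul n)]
  rw [signInt_neg _ 1 (h l), h]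
  ring

lemma skewReal_X_pow_odd_odd (s : ℝ≥0∞) (k l : ℕ) :
    skewReal s (Polynomial.X ^ (2 * k + 1)) (Polynomial.X ^ (2 * l + 1)) = 0 := by
  rw [skewReal_eq]
  refine integral_eq_zero_of_odd fun x => ?_
  have h : ∀ (n : ℕ) (x : ℝ), realWeighted s (Polynomial.X ^ (2 * n + 1)) (-x)
      = (-1) * realWeighted s (Polynomial.X ^ (2 * n + 1)) x := fun n x => by
    rw [realWeighted_X_pow_neg, Odd.neg_one_pow ⟨n, rfl⟩]
  rw [signInt_neg _ (-1) (h l), h]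
  ring

/-- The integrand is even, so the half line suffices. On `(0, 1]` it is a polynomial; beyond `1` the
inner integral is again a weighted monomial, so the weight occurs squared and the tail formula is
used with exponent `2`. -/
lemma skewReal_X_pow_even_odd {s : ℝ≥0∞} (hs : s ≠ 0) {k l : ℕ}
    (hk : (2 * (k : ℝ) + 1) * invExp s < 1) (hl : (2 * (l : ℝ) + 2) * invExp s < 1) :
    skewReal s (Polynomial.X ^ (2 * k)) (Polynomial.X ^ (2 * l + 1))
      = 4 * ((invExp s / (1 - (2 * l + 2) * invExp s) + 1 / (2 * l + 2)) / (2 * k + 1)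
        - 1 / ((2 * l + 2) * (2 * k + 2 * l + 3))
        + invExp s / (1 - (2 * l + 2) * invExp s) *
          (invExp s / (2 - (2 * k + 2 * l + 3) * invExp s))) := by
  have hl' : (((2 * l + 1 : ℕ) : ℝ) + 1) * invExp s < 1 := by
    push_cast
    convert hl using 2; ring
  have hk' : (((2 * k : ℕ) : ℝ) + 1) * invExp s < 1 := by
    push_cast
    exact hk
  obtain ⟨h1, h2⟩ := signInt_realWeighted_X_pow_odd hs hl
  have hint := integrable_mul_signInt (integrable_realWeighted_X_pow hs hk')
    (integrable_realWeighted_X_pow hs hl')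
  rw [skewReal_eq, integral_eq_two_mul_of_even, ← Set.Ioc_union_Ioi_eq_Ioi (zero_le_one' ℝ),
    setIntegral_union (Set.Ioc_disjoint_Ioi le_rfl) measurableSet_Ioi hint.integrableOn
      hint.integrableOn]
  · set t := invExp s with ht
    have hA : ∫ x in Set.Ioc (0 : ℝ) 1, realWeighted s (Polynomial.X ^ (2 * k)) x *
        signInt (realWeighted s (Polynomial.X ^ (2 * l + 1))) x
        = 2 * ((t / (1 - (2 * l + 2) * t) + 1 / (2 * l + 2)) / (2 * k + 1)
          - 1 / ((2 * l + 2) * (2 * k + 2 * l + 3))) := by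
      have e : Set.EqOn (fun x => realWeighted s (Polynomial.X ^ (2 * k)) x *
          signInt (realWeighted s (Polynomial.X ^ (2 * l + 1))) x)
          (fun x => 2 * (t / (1 - (2 * l + 2) * t) + 1 / (2 * l + 2)) * x ^ (2 * k)
            - 2 / (2 * l + 2) * x ^ (2 * k + 2 * l + 2)) (Set.Ioc 0 1) := by
        intro x hx
        simp only
        rw [h2 x hx.1.le hx.2,
          realWeighted_X_pow_of_le s _ (abs_le.2 ⟨by linarith [hx.1], hx.2⟩)]
        ring
      rw [setIntegral_congr_fun measurableSet_Ioc e, ← intervalIntegral.integral_of_le zero_le_one,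
        intervalIntegral.integral_sub, intervalIntegral.integral_const_mul,
        intervalIntegral.integral_const_mul, integral_pow, integral_pow]
      · push_cast
        simp only [one_pow, ne_eq, Nat.add_eq_zero_iff, one_ne_zero, and_false, not_false_eq_true,
          zero_pow, sub_zero]
        have : (2 * (k : ℝ) + 2 * l + 2 + 1) = 2 * k + 2 * l + 3 := by ring
        rw [this]
        field_simp
      all_goals exact Continuous.intervalIntegrable (by fun_prop) _ _
    have hB : ∫ x in Set.Ioi (1 : ℝ), realWeighted s (Polynomial.X ^ (2 * k)) x *
        signInt (realWeighted s (Polynomial.X ^ (2 * l + 1))) x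
        = 2 * (t / (1 - (2 * l + 2) * t) * (t / (2 - (2 * k + 2 * l + 3) * t))) := by
      have e : Set.EqOn (fun x => realWeighted s (Polynomial.X ^ (2 * k)) x *
          signInt (realWeighted s (Polynomial.X ^ (2 * l + 1))) x)
          (fun x => 2 * (t / (1 - (2 * l + 2) * t)) *
            (weight s (x : ℂ) ^ 2 * x ^ (2 * k + 2 * l + 2))) (Set.Ioi 1) := by
        intro x hx
        simp only
        rw [h1 x (le_of_lt hx), realWeighted]
        simp only [Polynomial.eval_pow, Polynomial.eval_X]
        ring
      have h3 := (integral_weight_pow_mul_pow hs (k := 2) (m := 2 * k + 2 * l + 2)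
        (by push_cast; linarith) (le_refl (1 : ℝ))).2
      rw [setIntegral_congr_fun measurableSet_Ioi e, integral_const_mul, h3,
        weight_of_norm_le_one s (by simp)]
      push_cast
      simp only [one_pow, mul_one]
      have : (2 * (k : ℝ) + 2 * l + 2 + 1) = 2 * k + 2 * l + 3 := by ring
      rw [this]
      ring
    rw [hA, hB]
    ring
  · intro x
    rw [signInt_neg _ (-1), realWeighted_X_pow_neg, Even.neg_one_pow (even_two_mul k)]
    · ring
    · intro y
      rw [realWeighted_X_pow_neg, Odd.neg_one_pow ⟨l, rfl⟩]

/-- The angular integral of a character against the sign of the imaginary part. -/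
lemma integral_exp_mul_sign_sin (q : ℤ) :
    ∫ θ in Set.Ioo (-Real.pi) Real.pi,
      Complex.exp (Complex.I * q * θ) * ((Real.sign (Real.sin θ) : ℝ) : ℂ)
      = if Even q then 0 else 4 * Complex.I / q := by
  have hpi := Real.pi_pos
  rw [← integral_Ioc_eq_integral_Ioo, ← intervalIntegral.integral_of_le (by linarith)]
  have hmeas : Measurable fun θ : ℝ => ((Real.sign (Real.sin θ) : ℝ) : ℂ) :=
    Complex.measurable_ofReal.comp (measurable_sign.comp Real.measurable_sin)
  have hint : ∀ a b : ℝ, IntervalIntegrable (fun θ : ℝ =>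
      Complex.exp (Complex.I * q * θ) * ((Real.sign (Real.sin θ) : ℝ) : ℂ)) volume a b := by
    intro a b
    have h1 : IntervalIntegrable (fun θ : ℝ => Complex.exp (Complex.I * q * θ)) volume a b :=
      Continuous.intervalIntegrable (by fun_prop) _ _
    rw [intervalIntegrable_iff] at h1 ⊢
    refine h1.mul_bdd (c := 1) hmeas.aestronglyMeasurable (ae_of_all _ fun θ => ?_)
    rcases Real.sign_apply_eq (Real.sin θ) with h | h | h <;> simp [h]
  rw [← intervalIntegral.integral_add_adjacent_intervals (hint (-Real.pi) 0) (hint 0 Real.pi)]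
  have e1 : ∫ θ in (-Real.pi)..0,
      Complex.exp (Complex.I * q * θ) * ((Real.sign (Real.sin θ) : ℝ) : ℂ)
      = ∫ θ in (0 : ℝ)..Real.pi, -Complex.exp (-(Complex.I * q) * θ) := by
    have : ∫ θ in (-Real.pi)..(-0),
      Complex.exp (Complex.I * q * θ) * ((Real.sign (Real.sin θ) : ℝ) : ℂ)
      = ∫ θ in (0 : ℝ)..Real.pi, Complex.exp (Complex.I * q * ((-θ : ℝ) : ℂ)) *
        ((Real.sign (Real.sin (-θ)) : ℝ) : ℂ) :=
      (intervalIntegral.integral_comp_neg (fun θ : ℝ =>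
        Complex.exp (Complex.I * q * θ) * ((Real.sign (Real.sin θ) : ℝ) : ℂ))).symm
    rw [neg_zero] at this
    rw [this, intervalIntegral.integral_of_le hpi.le, intervalIntegral.integral_of_le hpi.le,
      integral_Ioc_eq_integral_Ioo, integral_Ioc_eq_integral_Ioo]
    refine setIntegral_congr_fun measurableSet_Ioo fun θ hθ => ?_
    rw [Real.sin_neg, Real.sign_of_neg (neg_lt_zero.2 (Real.sin_pos_of_mem_Ioo hθ))]
    push_cast
    ring_nf
  have e2 : ∫ θ in (0 : ℝ)..Real.pi,
      Complex.exp (Complex.I * q * θ) * ((Real.sign (Real.sin θ) : ℝ) : ℂ)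
      = ∫ θ in (0 : ℝ)..Real.pi, Complex.exp (Complex.I * q * θ) := by
    rw [intervalIntegral.integral_of_le hpi.le, intervalIntegral.integral_of_le hpi.le,
      integral_Ioc_eq_integral_Ioo, integral_Ioc_eq_integral_Ioo]
    refine setIntegral_congr_fun measurableSet_Ioo fun θ hθ => ?_
    rw [Real.sign_of_pos (Real.sin_pos_of_mem_Ioo hθ)]
    simp
  rw [e1, e2, intervalIntegral.integral_neg]
  by_cases hq : q = 0
  · simp [hq]
  have hq' : (q : ℂ) ≠ 0 := by exact_mod_cast hq
  have hc : Complex.I * q ≠ 0 := mul_ne_zero Complex.I_ne_zero hq'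
  rw [integral_exp_mul_complex hc, integral_exp_mul_complex (neg_ne_zero.2 hc)]
  have h3 : Complex.exp (Complex.I * q * Real.pi) = (-1) ^ q := by
    rw [← Complex.exp_pi_mul_I, ← Complex.exp_int_mul]; congr 1; ring
  have h4 : Complex.exp (-(Complex.I * q) * Real.pi) = (-1) ^ (-q) := by
    rw [← Complex.exp_pi_mul_I, ← Complex.exp_int_mul]; congr 1; push_cast; ring
  rw [h3, h4]
  split_ifs with hev
  · rw [hev.neg_one_zpow, hev.neg.neg_one_zpow]; simp
  · have hod := Int.not_even_iff_odd.1 hev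
    rw [hod.neg_one_zpow, hod.neg.neg_one_zpow]
    simp only [Complex.ofReal_zero, mul_zero, Complex.exp_zero]
    field_simp
    rw [Complex.I_sq]
    ring

/-- In polar coordinates the integrand separates into a radial power with squared weight and the
character `n - m` times `sgn (sin θ)`, whose angular integral vanishes for even `n - m`. -/
lemma skewComplex_X_pow {s : ℝ≥0∞} (hs : s ≠ 0) {m n : ℕ}
    (h : ((m : ℝ) + n + 2) * invExp s < 2) :
    skewComplex s (Polynomial.X ^ m) (Polynomial.X ^ n)
      = if Even ((n : ℤ) - m) then 0 else
        ((8 / ((n : ℝ) - m) * (1 / (m + n + 2) + invExp s / (2 - (m + n + 2) * invExp s)) : ℝ) : ℂ)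
      := by
  have hrad : ∫ r in Set.Ioi (0 : ℝ), weight s (r : ℂ) ^ 2 * r ^ (m + n + 1)
      = 1 / (m + n + 2) + invExp s / (2 - (m + n + 2) * invExp s) := by
    obtain ⟨h1, h2⟩ := integral_weight_pow_mul_pow hs (k := 2) (m := m + n + 1)
        (by push_cast; linarith) (le_refl (1 : ℝ))
    have e : Set.EqOn (fun r : ℝ => weight s (r : ℂ) ^ 2 * r ^ (m + n + 1))
        (fun r => r ^ (m + n + 1)) (Set.Ioc 0 1) := by
      intro r hr
      simp only
      rw [weight_of_norm_le_one s
        (by rw [Complex.norm_real]; exact abs_le.2 ⟨by linarith [hr.1], hr.2⟩)]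
      ring
    have h0 : IntegrableOn (fun r : ℝ => weight s (r : ℂ) ^ 2 * r ^ (m + n + 1)) (Set.Ioc 0 1) := by
      rw [integrableOn_congr_fun e measurableSet_Ioc]
      exact ((continuous_id.pow _).integrableOn_Icc).mono_set Set.Ioc_subset_Icc_self
    rw [← Set.Ioc_union_Ioi_eq_Ioi (zero_le_one' ℝ),
      setIntegral_union (Set.Ioc_disjoint_Ioi le_rfl) measurableSet_Ioi h0 h1, h2,
      setIntegral_congr_fun measurableSet_Ioc e, ← intervalIntegral.integral_of_le zero_le_one,
      integral_pow, weight_of_norm_le_one s (by simp)]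
    have : ((m : ℝ) + n + 1 + 1) = m + n + 2 := by ring
    push_cast
    rw [this]
    simp
  rw [skewComplex, ← Complex.integral_comp_polarCoord_symm]
  have e : ∀ p ∈ polarCoord.target, p.1 • (fun z : ℂ => (((weight s z) ^ 2 : ℝ) : ℂ) *
        conj (Polynomial.aeval z (Polynomial.X ^ m : ℝ[X])) *
        Polynomial.aeval z (Polynomial.X ^ n : ℝ[X]) * ((Real.sign z.im : ℝ) : ℂ))
        (Complex.polarCoord.symm p)
      = (fun r : ℝ => ((weight s (r : ℂ) ^ 2 * r ^ (m + n + 1) : ℝ) : ℂ)) p.1 *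
        (fun θ : ℝ => Complex.exp (Complex.I * ((n : ℤ) - m : ℤ) * θ) *
          ((Real.sign (Real.sin θ) : ℝ) : ℂ)) p.2 := by
    rintro ⟨r, θ⟩ hp
    rw [polarCoord_target] at hp
    have hr : 0 < r := hp.1
    have hz : Complex.polarCoord.symm (r, θ) = r * Complex.exp (Complex.I * θ) := by
      rw [Complex.polarCoord_symm_apply, mul_comm Complex.I, Complex.exp_mul_I]
      simp
    have hw : weight s (r * Complex.exp (Complex.I * θ)) = weight s (r : ℂ) := by
      refine weight_congr s ?_
      rw [norm_mul, mul_comm Complex.I, Complex.norm_exp_ofReal_mul_I, mul_one]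
    have him : (r * Complex.exp (Complex.I * θ)).im = r * Real.sin θ := by
      rw [Complex.im_ofReal_mul, mul_comm Complex.I,
        Complex.exp_ofReal_mul_I_im]
    have hsign : Real.sign (r * Real.sin θ) = Real.sign (Real.sin θ) := by
      rcases lt_trichotomy (Real.sin θ) 0 with h | h | h
      · rw [Real.sign_of_neg h, Real.sign_of_neg (mul_neg_of_pos_of_neg hr h)]
      · simp [h]
      · rw [Real.sign_of_pos h, Real.sign_of_pos (mul_pos hr h)]
    simp only [hz, hw, him, hsign, map_pow, Polynomial.aeval_X, Complex.real_smul, map_mul,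
      Complex.conj_ofReal]
    rw [← Complex.exp_conj, mul_pow, mul_pow, ← Complex.exp_nat_mul, ← Complex.exp_nat_mul]
    have : Complex.exp (Complex.I * ((n : ℤ) - m : ℤ) * θ)
        = Complex.exp (m * conj (Complex.I * θ)) * Complex.exp (n * (Complex.I * θ)) := by
      rw [← Complex.exp_add]
      congr 1
      simp only [map_mul, Complex.conj_I, Complex.conj_ofReal]
      push_cast
      ring
    rw [this]
    push_cast
    ring
  rw [setIntegral_congr_fun polarCoord.open_target.measurableSet e, polarCoord_target,
    Measure.volume_eq_prod,
    setIntegral_prod_mul (fun r : ℝ => ((weight s (r : ℂ) ^ 2 * r ^ (m + n + 1) : ℝ) : ℂ))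
      (fun θ : ℝ => Complex.exp (Complex.I * ((n : ℤ) - m : ℤ) * θ) *
        ((Real.sign (Real.sin θ) : ℝ) : ℂ)), integral_exp_mul_sign_sin, integral_complex_ofReal, hrad]
  split_ifs with hev
  · simp
  · push_cast
    have : (n : ℂ) - m ≠ 0 := by
      intro h0
      apply hev
      have : (n : ℤ) - m = 0 := by exact_mod_cast h0
      rw [this]; exact Even.zero
    field_simp
    rw [Complex.I_sq]
    ring

lemma skew_X_pow_even_even {s : ℝ≥0∞} (hs : s ≠ 0) {k l : ℕ}
    (h : (2 * (k : ℝ) + 2 * l + 2) * invExp s < 2) :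
    skew s (Polynomial.X ^ (2 * k)) (Polynomial.X ^ (2 * l)) = 0 := by
  rw [skew, skewReal_X_pow_even_even, skewComplex_X_pow hs (by push_cast; exact h),
    if_pos ⟨l - k, by push_cast; ring⟩]
  simp

lemma skew_X_pow_odd_odd {s : ℝ≥0∞} (hs : s ≠ 0) {k l : ℕ}
    (h : (2 * (k : ℝ) + 2 * l + 4) * invExp s < 2) :
    skew s (Polynomial.X ^ (2 * k + 1)) (Polynomial.X ^ (2 * l + 1)) = 0 := by
  rw [skew, skewReal_X_pow_odd_odd, skewComplex_X_pow hs
    (by push_cast; convert h using 2; ring), if_pos ⟨l - k, by push_cast; ring⟩]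
  simp

/-- Used with `a = 2k + 1` and `b = 2l + 2`. The point is the disappearance of the mixed
denominators `a + b` and `2 - (a + b) t` once the real and the planar contributions are added; only
the Cauchy factor `b - a` couples the two degrees. -/
lemma skew_monomial_identity {a b t : ℝ} (ha : a ≠ 0) (hb : b ≠ 0) (h1 : 1 - b * t ≠ 0)
    (h2 : 2 - (a + b) * t ≠ 0) (h3 : a + b ≠ 0) (h4 : b - a ≠ 0) :
    4 * ((t / (1 - b * t) + 1 / b) / a - 1 / (b * (a + b)) + t / (1 - b * t) * (t / (2 - (a + b) * t)))
      + 8 / (b - a) * (1 / (a + b) + t / (2 - (a + b) * t))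
      = 4 / (a * (1 - b * t) * (b - a)) := by
  obtain ⟨d, hd⟩ : ∃ d, d = 1 - b * t := ⟨_, rfl⟩
  obtain ⟨e, he⟩ : ∃ e, e = 2 - (a + b) * t := ⟨_, rfl⟩
  rw [← hd] at h1 ⊢
  rw [← he] at h2 ⊢
  field_simp
  rw [hd, he]
  ring

lemma skew_X_pow_even_odd {s : ℝ≥0∞} (hs : s ≠ 0) {k l : ℕ}
    (hk : (2 * (k : ℝ) + 1) * invExp s < 1) (hl : (2 * (l : ℝ) + 2) * invExp s < 1) :
    skew s (Polynomial.X ^ (2 * k)) (Polynomial.X ^ (2 * l + 1))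
      = ((2 / ((2 * k + 1) * (1 - (2 * l + 2) * invExp s) * (l + 1 / 2 - k)) : ℝ) : ℂ) := by
  rw [skew, skewReal_X_pow_even_odd hs hk hl, skewComplex_X_pow hs (by push_cast; linarith), if_neg]
  · rw [← Complex.ofReal_add]
    congr 1
    set t := invExp s
    have h1 : 1 - (2 * (l : ℝ) + 2) * t ≠ 0 := by linarith
    have h2 : 2 - (2 * (k : ℝ) + 2 * l + 3) * t ≠ 0 := by linarith
    have h3 : 2 * (l : ℝ) + 1 - 2 * k ≠ 0 := by
      have : 2 * (l : ℤ) + 1 - 2 * k ≠ 0 := by omega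
      exact_mod_cast this
    have h4 : (l : ℝ) + 1 / 2 - k ≠ 0 := by
      intro h; apply h3; linarith
    have := skew_monomial_identity (a := 2 * (k : ℝ) + 1) (b := 2 * l + 2) (t := t) (by positivity)
      (by positivity) h1 (by convert h2 using 3; ring) (by positivity)
      (by convert h3 using 1; ring)
    have e : (l : ℝ) + 1 / 2 - k = (2 * (l : ℝ) + 2 - (2 * k + 1)) / 2 := by ring
    have e2 : 2 * (k : ℝ) + 2 * l + 3 = 2 * k + 1 + (2 * l + 2) := by ring
    have e3 : 2 * (k : ℝ) + (2 * l + 1) + 2 = 2 * k + 1 + (2 * l + 2) := by ring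
    have e4 : 2 * (l : ℝ) + 1 - 2 * k = 2 * l + 2 - (2 * k + 1) := by ring
    push_cast
    rw [e, e2, e3, e4, this, mul_div_assoc', div_div_eq_mul_div]
    norm_num
  · rw [Int.not_even_iff_odd]
    exact ⟨l - k, by push_cast; ring⟩

/-! ### Bilinearity of the skew product -/

lemma norm_aeval_le {N : ℕ} {p : ℝ[X]} (hp : p.degree < N) (z : ℂ) :
    ‖Polynomial.aeval z p‖
      ≤ (∑ m ∈ Finset.range N, |p.coeff m|) * (max 1 ‖z‖) ^ (N - 1) := by
  conv_lhs => rw [eq_sum_C_coeff_mul_X_pow hp]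
  simp only [map_sum, map_mul, map_pow, Polynomial.aeval_C, Polynomial.aeval_X]
  refine (norm_sum_le _ _).trans ?_
  rw [Finset.sum_mul]
  refine Finset.sum_le_sum fun m hm => ?_
  have hm' := Finset.mem_range.1 hm
  rw [norm_mul, norm_pow]
  have h1 : ‖(algebraMap ℝ ℂ) (p.coeff m)‖ = |p.coeff m| := by simp
  rw [h1]
  refine mul_le_mul_of_nonneg_left ?_ (abs_nonneg _)
  calc ‖z‖ ^ m ≤ (max 1 ‖z‖) ^ m := pow_le_pow_left₀ (norm_nonneg _) (le_max_right _ _) _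
    _ ≤ (max 1 ‖z‖) ^ (N - 1) := pow_le_pow_right₀ (le_max_left _ _) (by omega)

/-- For finite `s` the hypothesis says `2 s - 2 m > 2`, so the decay exponent exceeds the real
dimension of the plane. For `s = ∞` the support is compact and any exponent above `2` serves. -/
lemma integrable_weight_sq_mul_max_pow {s : ℝ≥0∞} (hs : s ≠ 0) {m : ℕ}
    (h : ((m : ℝ) + 1) * invExp s < 1) :
    Integrable fun z : ℂ => weight s z ^ 2 * (max 1 ‖z‖) ^ (2 * m) := by
  have hmeas : AEStronglyMeasurable (fun z : ℂ => weight s z ^ 2 * (max 1 ‖z‖) ^ (2 * m)) volume :=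
    (((measurable_weight s).pow_const 2).mul
      ((measurable_const.max measurable_norm).pow_const _)).aestronglyMeasurable
  obtain ⟨r, hr2, hr⟩ : ∃ r : ℝ, 2 < r ∧ ∀ z : ℂ,
      weight s z ^ 2 * (max 1 ‖z‖) ^ (2 * m) ≤ (max 1 ‖z‖) ^ (-r) := by
    by_cases hs' : s = ∞
    · refine ⟨3, by norm_num, fun z => ?_⟩
      by_cases hz : ‖z‖ ≤ 1
      · rw [weight_of_norm_le_one s hz, max_eq_left hz]; simp
      · rw [weight_of_one_lt_norm s (not_le.1 hz), if_pos hs']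
        have : (0 : ℝ) < max 1 ‖z‖ := by positivity
        rw [zero_pow two_ne_zero, zero_mul]
        positivity
    · have hS : 0 < s.toReal := ENNReal.toReal_pos hs hs'
      refine ⟨2 * s.toReal - 2 * m, ?_, fun z => le_of_eq ?_⟩
      · rw [invExp_eq, ← div_eq_mul_inv, div_lt_one hS] at h
        linarith
      · have hM : (0 : ℝ) < max 1 ‖z‖ := by positivity
        rw [weight, if_neg hs', ← Real.rpow_natCast (max 1 ‖z‖) (2 * m), ← Real.rpow_natCast,
          ← Real.rpow_mul hM.le, ← Real.rpow_add hM]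
        congr 1
        push_cast
        ring
  have hint : Integrable fun z : ℂ => (2 : ℝ) ^ r * (1 + ‖z‖) ^ (-r) :=
    (integrable_one_add_norm (by rw [Complex.finrank_real_complex]; exact_mod_cast hr2)).const_mul _
  refine hint.mono' hmeas (ae_of_all _ fun z => ?_)
  have hM : (0 : ℝ) < max 1 ‖z‖ := by positivity
  rw [Real.norm_of_nonneg (by positivity)]
  refine (hr z).trans ?_
  have h1 : (1 + ‖z‖) / 2 ≤ max 1 ‖z‖ := by
    rcases le_total ‖z‖ 1 with h | h
    · rw [max_eq_left h]; linarith
    · rw [max_eq_right h]; linarith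
  calc (max 1 ‖z‖) ^ (-r) ≤ ((1 + ‖z‖) / 2) ^ (-r) :=
        Real.rpow_le_rpow_of_nonpos (by positivity) h1 (by linarith)
    _ = (2 : ℝ) ^ r * (1 + ‖z‖) ^ (-r) := by
        rw [Real.div_rpow (by positivity) (by norm_num), Real.rpow_neg (by norm_num : (0 : ℝ) ≤ 2)]
        field_simp

lemma integrable_skewComplex {s : ℝ≥0∞} {N : ℕ} (hN : (N : ℝ≥0∞) < s) {f g : ℝ[X]}
    (hf : f.degree < N) (hg : g.degree < N) :
    Integrable fun z : ℂ => (((weight s z) ^ 2 : ℝ) : ℂ) * conj (Polynomial.aeval z f) *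
      Polynomial.aeval z g * ((Real.sign z.im : ℝ) : ℂ) := by
  -- For `N = 0` the growth bound with the truncated exponent `N - 1 = 0` would require `1 / s < 1`,
  -- which is not available; but then `f = 0`.
  rcases Nat.eq_zero_or_pos N with rfl | hpos
  · have : f = 0 := by
      rw [← Polynomial.degree_eq_bot]
      by_contra h0
      rw [Polynomial.degree_eq_natDegree (by simpa using h0)] at hf
      exact absurd hf (by simp)
    simp [this]
  have h1 := integrable_weight_sq_mul_max_pow (ne_zero_of_natCast_lt hN)
    (succ_mul_invExp_lt_one hN (Nat.sub_lt hpos one_pos))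
  have hc : ∀ p : ℝ[X], Continuous fun z : ℂ => Polynomial.aeval z p := fun p =>
    p.continuous_aeval
  have hmeas : AEStronglyMeasurable (fun z : ℂ => (((weight s z) ^ 2 : ℝ) : ℂ) *
      conj (Polynomial.aeval z f) * Polynomial.aeval z g * ((Real.sign z.im : ℝ) : ℂ)) volume := by
    refine Measurable.aestronglyMeasurable ?_
    refine ((?_ : Measurable _).mul ?_ |>.mul (hc g).measurable).mul ?_
    · exact Complex.measurable_ofReal.comp ((measurable_weight s).pow_const 2)
    · exact (Complex.continuous_conj.comp (hc f)).measurable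
    · exact Complex.measurable_ofReal.comp (measurable_sign.comp Complex.measurable_im)
  refine (h1.const_mul ((∑ m ∈ Finset.range N, |f.coeff m|) *
    (∑ m ∈ Finset.range N, |g.coeff m|))).mono' hmeas (ae_of_all _ fun z => ?_)
  have hs : ‖((Real.sign z.im : ℝ) : ℂ)‖ ≤ 1 := by
    rcases Real.sign_apply_eq z.im with h | h | h <;> simp [h]
  have h2 := norm_aeval_le hf z
  have h3 := norm_aeval_le hg z
  rw [norm_mul, norm_mul, norm_mul, Complex.norm_conj, Complex.norm_real,
    Real.norm_of_nonneg (by positivity)]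
  have hw : 0 ≤ weight s z ^ 2 := by positivity
  calc _ ≤ weight s z ^ 2 * ‖Polynomial.aeval z f‖ * ‖Polynomial.aeval z g‖ * 1 := by gcongr
    _ ≤ weight s z ^ 2 * ((∑ m ∈ Finset.range N, |f.coeff m|) * (max 1 ‖z‖) ^ (N - 1)) *
        ((∑ m ∈ Finset.range N, |g.coeff m|) * (max 1 ‖z‖) ^ (N - 1)) * 1 := by gcongr
    _ = _ := by rw [two_mul, pow_add]; ring

lemma skew_sum_right {ι : Type*} {s : ℝ≥0∞} {N : ℕ} (hN : (N : ℝ≥0∞) < s) {f : ℝ[X]}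
    (hf : f.degree < N) (I : Finset ι) (c : ι → ℝ) {g : ι → ℝ[X]}
    (hg : ∀ i ∈ I, (g i).degree < N) :
    skew s f (∑ i ∈ I, Polynomial.C (c i) * g i) = ∑ i ∈ I, (c i : ℂ) * skew s f (g i) := by
  have h1 : skewReal s f (∑ i ∈ I, Polynomial.C (c i) * g i)
      = ∑ i ∈ I, c i * skewReal s f (g i) := by
    have e : realWeighted s (∑ i ∈ I, Polynomial.C (c i) * g i)
        = fun x => ∑ i ∈ I, c i * realWeighted s (g i) x :=
      funext fun x => realWeighted_sum s I c g x
    simp only [skewReal_eq, e]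
    simp only [signInt_sum I c (fun i => realWeighted s (g i))
      (fun i hi => integrable_realWeighted hN (hg i hi)), Finset.mul_sum]
    rw [integral_finsetSum]
    · refine Finset.sum_congr rfl fun i _ => ?_
      rw [← integral_const_mul]; congr 1; ext x; ring
    · intro i hi
      refine ((integrable_mul_signInt (integrable_realWeighted hN hf)
        (integrable_realWeighted hN (hg i hi))).const_mul (c i)).congr (ae_of_all _ fun x => ?_)
      simp only; ring
  have h2 : skewComplex s f (∑ i ∈ I, Polynomial.C (c i) * g i)
      = ∑ i ∈ I, (c i : ℂ) * skewComplex s f (g i) := by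
    simp only [skewComplex, map_sum, map_mul, Polynomial.aeval_C, Finset.mul_sum, Finset.sum_mul]
    rw [integral_finsetSum, Finset.mul_sum]
    · refine Finset.sum_congr rfl fun i _ => ?_
      rw [← mul_assoc, mul_comm (c i : ℂ), mul_assoc (-2 * Complex.I), ← integral_const_mul (c i : ℂ)]
      congr 1
      refine integral_congr_ae (ae_of_all _ fun x => ?_)
      simp only
      rw [Complex.coe_algebraMap]; ring
    · intro i hi
      refine ((integrable_skewComplex hN hf (hg i hi)).const_mul (c i : ℂ)).congr
        (ae_of_all _ fun x => ?_)
      simp only [Complex.coe_algebraMap]; ring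
  simp only [skew, h1, h2, mul_add, Finset.sum_add_distrib]
  push_cast
  rfl

lemma skew_sum_left {ι : Type*} {s : ℝ≥0∞} {N : ℕ} (hN : (N : ℝ≥0∞) < s) {g : ℝ[X]}
    (hg : g.degree < N) (I : Finset ι) (c : ι → ℝ) {f : ι → ℝ[X]}
    (hf : ∀ i ∈ I, (f i).degree < N) :
    skew s (∑ i ∈ I, Polynomial.C (c i) * f i) g = ∑ i ∈ I, (c i : ℂ) * skew s (f i) g := by
  have h1 : skewReal s (∑ i ∈ I, Polynomial.C (c i) * f i) g
      = ∑ i ∈ I, c i * skewReal s (f i) g := by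
    simp only [skewReal_eq, realWeighted_sum, Finset.sum_mul]
    rw [integral_finsetSum]
    · refine Finset.sum_congr rfl fun i _ => ?_
      rw [← integral_const_mul]; congr 1; ext x; ring
    · intro i hi
      refine ((integrable_mul_signInt (integrable_realWeighted hN (hf i hi))
        (integrable_realWeighted hN hg)).const_mul (c i)).congr (ae_of_all _ fun x => ?_)
      simp only; ring
  have h2 : skewComplex s (∑ i ∈ I, Polynomial.C (c i) * f i) g
      = ∑ i ∈ I, (c i : ℂ) * skewComplex s (f i) g := by
    simp only [skewComplex, map_sum, map_mul, Polynomial.aeval_C, Finset.mul_sum, Finset.sum_mul]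
    rw [integral_finsetSum, Finset.mul_sum]
    · refine Finset.sum_congr rfl fun i _ => ?_
      rw [← mul_assoc, mul_comm (c i : ℂ), mul_assoc (-2 * Complex.I), ← integral_const_mul (c i : ℂ)]
      congr 1
      refine integral_congr_ae (ae_of_all _ fun x => ?_)
      simp only
      rw [Complex.coe_algebraMap, Complex.conj_ofReal]; ring
    · intro i hi
      refine ((integrable_skewComplex hN (hf i hi) hg).const_mul (c i : ℂ)).congr
        (ae_of_all _ fun x => ?_)
      simp only [Complex.coe_algebraMap, Complex.conj_ofReal]; ring
  simp only [skew, h1, h2, mul_add, Finset.sum_add_distrib]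
  push_cast
  rfl

lemma skew_add_right {s : ℝ≥0∞} {N : ℕ} (hN : (N : ℝ≥0∞) < s) {f g h : ℝ[X]}
    (hf : f.degree < N) (hg : g.degree < N) (hh : h.degree < N) (a b : ℝ) :
    skew s f (Polynomial.C a * g + Polynomial.C b * h) = a * skew s f g + b * skew s f h := by
  have := skew_sum_right hN hf Finset.univ ![a, b] (g := ![g, h]) (by
    intro i _; fin_cases i <;> simpa)
  simpa [Fin.sum_univ_two] using this

lemma skew_add_left {s : ℝ≥0∞} {N : ℕ} (hN : (N : ℝ≥0∞) < s) {f g h : ℝ[X]}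
    (hf : f.degree < N) (hg : g.degree < N) (hh : h.degree < N) (a b : ℝ) :
    skew s (Polynomial.C a * f + Polynomial.C b * g) h = a * skew s f h + b * skew s g h := by
  have := skew_sum_left hN hh Finset.univ ![a, b] (f := ![f, g]) (by
    intro i _; fin_cases i <;> simpa)
  simpa [Fin.sum_univ_two] using this

/-! ### Skew-orthogonality of the explicit polynomials -/

lemma degree_evenPoly_lt (b : ℝ) (n : ℕ) : (evenPoly b n).degree < ((2 * n + 1 : ℕ) : WithBot ℕ) := by
  rw [Polynomial.degree_lt_iff_coeff_zero]
  intro m hm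
  simp only [evenPoly, Polynomial.finsetSum_coeff, Polynomial.coeff_C_mul_X_pow]
  refine Finset.sum_eq_zero fun k hk => if_neg ?_
  have := Finset.mem_range.1 hk
  omega

lemma degree_oddPoly_lt (t : ℝ) (n : ℕ) : (oddPoly t n).degree < ((2 * n + 2 : ℕ) : WithBot ℕ) := by
  rw [Polynomial.degree_lt_iff_coeff_zero]
  intro m hm
  simp only [oddPoly, Polynomial.finsetSum_coeff, Polynomial.coeff_C_mul_X_pow]
  refine Finset.sum_eq_zero fun k hk => if_neg ?_
  have := Finset.mem_range.1 hk
  omega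

lemma coeff_evenPoly (b : ℝ) (n : ℕ) : (evenPoly b n).coeff (2 * n) = risingCoeff (3 / 2) n := by
  simp only [evenPoly, Polynomial.finsetSum_coeff, Polynomial.coeff_C_mul_X_pow]
  rw [Finset.sum_eq_single n]
  · simp
  · intro k _ hk
    exact if_neg (by omega)
  · simp

lemma coeff_oddPoly (t : ℝ) (n : ℕ) :
    (oddPoly t n).coeff (2 * n + 1) = risingCoeff (3 / 2) n * (1 - (2 * n + 2) * t) := by
  simp only [oddPoly, Polynomial.finsetSum_coeff, Polynomial.coeff_C_mul_X_pow]
  rw [Finset.sum_eq_single n]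
  · simp
  · intro k _ hk
    exact if_neg (by omega)
  · simp

lemma degree_X_pow_lt {m N : ℕ} (h : m < N) : (Polynomial.X ^ m : ℝ[X]).degree < N := by
  rw [Polynomial.degree_X_pow]; exact_mod_cast h

/-- The factor `1 / (2k+1)` of the moment turns `(3/2)_k` into `(1/2)_k`. What remains is the
partial fraction sum with `a = 1/2` at `x = l + 1/2`, whose numerator has the zeros `l = 0, …, n -
1`. -/
lemma skew_evenPoly_X_pow_odd {s : ℝ≥0∞} {N : ℕ} (hN : (N : ℝ≥0∞) < s) {n l : ℕ}
    (hn : 2 * n < N) (hl : 2 * l + 1 < N) :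
    skew s (evenPoly (1 / 2) n) (Polynomial.X ^ (2 * l + 1))
      = ((2 / (1 - (2 * l + 2) * invExp s) * ((∏ i ∈ Finset.range n, ((l : ℝ) - i)) /
          ∏ k ∈ Finset.range (n + 1), ((l : ℝ) + 1 / 2 - k)) : ℝ) : ℂ) := by
  have hs := ne_zero_of_natCast_lt hN
  have hl' : (2 * (l : ℝ) + 2) * invExp s < 1 := by
    have := succ_mul_invExp_lt_one hN hl
    push_cast at this; convert this using 2; ring
  have hpf := sum_risingCoeff_div (1 / 2) ((l : ℝ) + 1 / 2) n (fun k _ h => by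
    have h' : 2 * (l : ℝ) + 1 = 2 * k := by linarith
    have : 2 * l + 1 = 2 * k := by exact_mod_cast h'
    omega)
  rw [evenPoly, skew_sum_left hN (degree_X_pow_lt hl)]
  · have e : ∏ i ∈ Finset.range n, ((l : ℝ) - i) = ∏ i ∈ Finset.range n, ((l : ℝ) + 1 / 2 - i - 1 / 2) :=
      Finset.prod_congr rfl fun i _ => by ring
    rw [e, ← hpf, Finset.mul_sum]
    push_cast
    refine Finset.sum_congr rfl fun k hk => ?_
    have hk' : (2 * (k : ℝ) + 1) * invExp s < 1 := by
      have hkn := Finset.mem_range.1 hk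
      have := succ_mul_invExp_lt_one hN (m := 2 * k) (by omega)
      push_cast at this; exact this
    rw [skew_X_pow_even_odd hs hk' hl', risingCoeff_three_halves]
    norm_num
    have : (2 * (k : ℂ) + 1) ≠ 0 := by exact_mod_cast (by omega : 2 * k + 1 ≠ 0)
    field_simp
  · intro k hk
    have hkn := Finset.mem_range.1 hk
    exact degree_X_pow_lt (by omega)

lemma skew_evenPoly_X_pow {s : ℝ≥0∞} {N : ℕ} (hN : (N : ℝ≥0∞) < s) {n m : ℕ}
    (hn : 2 * n < N) (hm : m < 2 * n) :
    skew s (evenPoly (1 / 2) n) (Polynomial.X ^ m) = 0 := by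
  have hs := ne_zero_of_natCast_lt hN
  obtain ⟨l, rfl | rfl⟩ := Nat.even_or_odd' m
  · rw [evenPoly, skew_sum_left hN (degree_X_pow_lt (by omega))]
    · refine Finset.sum_eq_zero fun k hk => ?_
      have hkn := Finset.mem_range.1 hk
      rw [skew_X_pow_even_even hs, mul_zero]
      have h1 := succ_mul_invExp_lt_one hN (m := 2 * k) (by omega)
      have h2 := succ_mul_invExp_lt_one hN (m := 2 * l) (by omega)
      push_cast at h1 h2
      linarith
    · intro k hk
      have hkn := Finset.mem_range.1 hk
      exact degree_X_pow_lt (by omega)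
  · rw [skew_evenPoly_X_pow_odd hN hn (by omega),
      Finset.prod_eq_zero (Finset.mem_range.2 (by omega : l < n)) (sub_self _)]
    simp

/-- The factor `1 - (2k+2) t` built into the odd polynomial cancels the denominator of the moment.
This leaves the partial fraction sum with `a = -1/2` at `x = l - 1/2`, whose numerator vanishes for
`l < n`. -/
lemma skew_X_pow_oddPoly {s : ℝ≥0∞} {N : ℕ} (hN : (N : ℝ≥0∞) < s) {n m : ℕ}
    (hn : 2 * n + 1 < N) (hm : m < 2 * n) :
    skew s (Polynomial.X ^ m) (oddPoly (invExp s) n) = 0 := by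
  have hs := ne_zero_of_natCast_lt hN
  have hdeg : ∀ k ∈ Finset.range (n + 1), (Polynomial.X ^ (2 * k + 1) : ℝ[X]).degree < N := by
    intro k hk
    have hkn := Finset.mem_range.1 hk
    exact degree_X_pow_lt (by omega)
  obtain ⟨l, rfl | rfl⟩ := Nat.even_or_odd' m
  · have hpf := sum_risingCoeff_div (-(1 / 2)) ((l : ℝ) - 1 / 2) n (fun k _ h => by
      have h' : 2 * (l : ℝ) = 2 * k + 1 := by linarith
      have : 2 * l = 2 * k + 1 := by exact_mod_cast h'
      omega)
    have h0 : ∏ i ∈ Finset.range n, ((l : ℝ) - 1 / 2 - i - -(1 / 2)) = 0 :=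
      Finset.prod_eq_zero (Finset.mem_range.2 (by omega : l < n)) (by ring)
    rw [h0, zero_div] at hpf
    rw [oddPoly, skew_sum_right hN (degree_X_pow_lt (by omega)) _ _ hdeg]
    -- The common factor of all terms, its sign coming from `k + 1/2 - l = -(l - 1/2 - k)`.
    have : (0 : ℂ) = (((-2 / (2 * l + 1) : ℝ) * 0 : ℝ) : ℂ) := by simp
    rw [this, ← hpf, Finset.mul_sum]
    push_cast
    refine Finset.sum_congr rfl fun k hk => ?_
    have hkn := Finset.mem_range.1 hk
    have hk' : (2 * (l : ℝ) + 1) * invExp s < 1 := by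
      have := succ_mul_invExp_lt_one hN (m := 2 * l) (by omega)
      push_cast at this; exact this
    have hl' : (2 * (k : ℝ) + 2) * invExp s < 1 := by
      have := succ_mul_invExp_lt_one hN (m := 2 * k + 1) (by omega)
      push_cast at this; convert this using 2; ring
    rw [skew_X_pow_even_odd hs hk' hl']
    have h1 : (2 * (l : ℂ) + 1) ≠ 0 := by exact_mod_cast (by omega : 2 * l + 1 ≠ 0)
    have h2 : 1 - (2 * (k : ℂ) + 2) * (invExp s : ℂ) ≠ 0 := by
      have : 1 - (2 * (k : ℝ) + 2) * invExp s ≠ 0 := by linarith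
      exact_mod_cast this
    have h3 : (l : ℂ) - 1 / 2 - k ≠ 0 := by
      intro h
      have h' : 2 * (l : ℂ) = 2 * k + 1 := by linear_combination 2 * h
      have : 2 * l = 2 * k + 1 := by exact_mod_cast h'
      omega
    have h4 : (k : ℂ) + 1 / 2 - l = -((l : ℂ) - 1 / 2 - k) := by ring
    have h5 : (3 / 2 : ℝ) = 1 - -(1 / 2) := by norm_num
    rw [← h5]
    push_cast
    rw [h4]
    generalize (l : ℂ) - 1 / 2 - k = x at *
    generalize 1 - (2 * (k : ℂ) + 2) * (invExp s : ℂ) = y at *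
    field_simp
  · rw [oddPoly, skew_sum_right hN (degree_X_pow_lt (by omega)) _ _ hdeg]
    refine Finset.sum_eq_zero fun k hk => ?_
    have hkn := Finset.mem_range.1 hk
    rw [skew_X_pow_odd_odd hs, mul_zero]
    have h1 := succ_mul_invExp_lt_one hN (m := 2 * k + 1) (by omega)
    have h2 := succ_mul_invExp_lt_one hN (m := 2 * l + 1) (by omega)
    push_cast at h1 h2
    linarith

lemma prod_half_sub (n : ℕ) :
    ∏ k ∈ Finset.range (n + 1), ((n : ℝ) + 1 / 2 - k)
      = (∏ k ∈ Finset.range n, ((n : ℝ) - k)) * risingCoeff (3 / 2) n / 2 := by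
  have h1 : ∏ k ∈ Finset.range (n + 1), ((n : ℝ) + 1 / 2 - k)
      = ∏ k ∈ Finset.range (n + 1), ((k : ℝ) + 1 / 2) := by
    rw [← Finset.prod_range_reflect]
    refine Finset.prod_congr rfl fun j hj => ?_
    have hj' := Finset.mem_range.1 hj
    rw [show n + 1 - 1 - j = n - j by omega, Nat.cast_sub (by omega)]; ring
  have h2 : ∏ k ∈ Finset.range n, ((n : ℝ) - k) = ∏ k ∈ Finset.range n, ((k : ℝ) + 1) := by
    rw [← Finset.prod_range_reflect]
    refine Finset.prod_congr rfl fun j hj => ?_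
    have hj' := Finset.mem_range.1 hj
    have : n - 1 - j + (j + 1) = n := by omega
    have : ((n - 1 - j : ℕ) : ℝ) + (j + 1) = n := by exact_mod_cast this
    linarith
  rw [h1, h2, risingCoeff, Finset.prod_div_distrib, Finset.prod_range_succ']
  have : ∏ k ∈ Finset.range n, ((k : ℝ) + 1) ≠ 0 :=
    Finset.prod_ne_zero_iff.2 fun k _ => by positivity
  field_simp
  simp only [Nat.cast_add, Nat.cast_one, Nat.cast_zero, mul_zero, zero_add, mul_one]
  exact Finset.prod_congr rfl fun k _ => by ring

lemma skew_evenPoly_of_degree_lt {s : ℝ≥0∞} {N : ℕ} (hN : (N : ℝ≥0∞) < s) {n : ℕ}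
    (hn : 2 * n < N) {g : ℝ[X]} (hg : g.degree < ((2 * n : ℕ) : WithBot ℕ)) :
    skew s (evenPoly (1 / 2) n) g = 0 := by
  conv_lhs => rw [eq_sum_C_coeff_mul_X_pow hg]
  have h1 : (evenPoly (1 / 2) n).degree < (N : WithBot ℕ) :=
    (degree_evenPoly_lt _ n).trans_le (by exact_mod_cast hn)
  rw [skew_sum_right hN h1 _ _ (fun m hm => degree_X_pow_lt
    (by have := Finset.mem_range.1 hm; omega))]
  refine Finset.sum_eq_zero fun m hm => ?_
  rw [skew_evenPoly_X_pow hN hn (Finset.mem_range.1 hm), mul_zero]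

lemma skew_oddPoly_of_degree_lt {s : ℝ≥0∞} {N : ℕ} (hN : (N : ℝ≥0∞) < s) {n : ℕ}
    (hn : 2 * n + 1 < N) {g : ℝ[X]} (hg : g.degree < ((2 * n : ℕ) : WithBot ℕ)) :
    skew s g (oddPoly (invExp s) n) = 0 := by
  conv_lhs => rw [eq_sum_C_coeff_mul_X_pow hg]
  have h1 : (oddPoly (invExp s) n).degree < (N : WithBot ℕ) :=
    (degree_oddPoly_lt _ n).trans_le (by exact_mod_cast hn)
  rw [skew_sum_left hN h1 _ _ (fun m hm => degree_X_pow_lt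
    (by have := Finset.mem_range.1 hm; omega))]
  refine Finset.sum_eq_zero fun m hm => ?_
  rw [skew_X_pow_oddPoly hN hn (Finset.mem_range.1 hm), mul_zero]

/-- By orthogonality only the leading monomial of the odd polynomial contributes, and
`prod_half_sub` evaluates the products at `l = n`. -/
lemma skew_evenPoly_oddPoly {s : ℝ≥0∞} {N : ℕ} (hN : (N : ℝ≥0∞) < s) {n : ℕ}
    (hn : 2 * n + 1 < N) : skew s (evenPoly (1 / 2) n) (oddPoly (invExp s) n) = 4 := by
  have hdeg : ∀ k ∈ Finset.range (n + 1), (Polynomial.X ^ (2 * k + 1) : ℝ[X]).degree < N := by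
    intro k hk
    have hkn := Finset.mem_range.1 hk
    exact degree_X_pow_lt (by omega)
  have h1 : (evenPoly (1 / 2) n).degree < (N : WithBot ℕ) :=
    (degree_evenPoly_lt _ n).trans_le (by exact_mod_cast hn.le)
  rw [oddPoly, skew_sum_right hN h1 _ _ hdeg, Finset.sum_range_succ, Finset.sum_eq_zero, zero_add,
    skew_evenPoly_X_pow_odd hN (by omega) hn, prod_half_sub]
  · rw [← Complex.ofReal_mul]
    have h2 : 1 - (2 * (n : ℝ) + 2) * invExp s ≠ 0 := by
      have := succ_mul_invExp_lt_one hN hn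
      push_cast at this
      have e : 2 * (n : ℝ) + 1 + 1 = 2 * n + 2 := by ring
      rw [e] at this
      linarith
    have h3 : risingCoeff (3 / 2) n ≠ 0 := (risingCoeff_pos (by norm_num) n).ne'
    have h4 : ∏ i ∈ Finset.range n, ((n : ℝ) - i) ≠ 0 := by
      refine Finset.prod_ne_zero_iff.2 fun k hk => sub_ne_zero.2 ?_
      have := Finset.mem_range.1 hk
      exact_mod_cast this.ne'
    rw [Nat.sub_self, risingCoeff_zero]
    have : (4 : ℂ) = ((4 : ℝ) : ℂ) := by norm_num
    rw [this]
    congr 1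
    generalize 1 - (2 * (n : ℝ) + 2) * invExp s = y at *
    field_simp
    norm_num
  · intro k hk
    rw [skew_evenPoly_X_pow hN (by omega) (by have := Finset.mem_range.1 hk; omega), mul_zero]

/-! ### Uniqueness of the skew-orthonormal polynomials -/

/-- A sequence of polynomials with `degree (π n) = n` spans the polynomials of bounded degree. -/
lemma exists_eq_sum_of_degree {N : ℕ} {π : ℕ → ℝ[X]} (hπ : ∀ n, n < N → (π n).degree = n) :
    ∀ m ≤ N, ∀ g : ℝ[X], g.degree < (m : WithBot ℕ) →
      ∃ α : ℕ → ℝ, g = ∑ i ∈ Finset.range m, Polynomial.C (α i) * π i := by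
  intro m
  induction m with
  | zero =>
    intro _ g hg
    refine ⟨0, ?_⟩
    have : g = 0 := by
      have := eq_sum_C_coeff_mul_X_pow hg
      simpa using this
    simp [this]
  | succ m ih =>
    intro hm g hg
    have hd := hπ m (by omega)
    have hlc : (π m).coeff m ≠ 0 := Polynomial.coeff_ne_zero_of_eq_degree hd
    set a := g.coeff m / (π m).coeff m with ha
    have hg' : (g - Polynomial.C a * π m).degree < (m : WithBot ℕ) := by
      rw [Polynomial.degree_lt_iff_coeff_zero]
      intro k hk
      rw [Polynomial.coeff_sub, Polynomial.coeff_C_mul]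
      rcases hk.eq_or_lt with rfl | hk
      · rw [ha, div_mul_cancel₀ _ hlc, sub_self]
      · rw [Polynomial.coeff_eq_zero_of_degree_lt (hg.trans_le (by exact_mod_cast hk)),
          Polynomial.coeff_eq_zero_of_degree_lt (by rw [hd]; exact_mod_cast hk)]
        simp
    obtain ⟨α, hα⟩ := ih (by omega) _ hg'
    refine ⟨Function.update α m a, ?_⟩
    rw [Finset.sum_range_succ, Function.update_self]
    have : ∑ i ∈ Finset.range m, Polynomial.C (Function.update α m a i) * π i
        = ∑ i ∈ Finset.range m, Polynomial.C (α i) * π i :=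
      Finset.sum_congr rfl fun i hi => by
        rw [Function.update_of_ne (Finset.mem_range.1 hi).ne]
    rw [this, ← hα]
    ring

namespace IsSkewOrthonormal

variable {s : ℝ≥0∞} {N : ℕ} {π : ℕ → ℝ[X]}

lemma degree_lt (h : IsSkewOrthonormal s N π) {n : ℕ} (hn : n < N) :
    (π n).degree < (N : WithBot ℕ) := by
  rw [h.degree_eq n hn]; exact_mod_cast hn

/-- The first `2 n` polynomials form a symplectic basis, so the form is nondegenerate on their span:
pairing with the partner of `π i` isolates the coefficient of `π i`. The even bound `2 n` ensures
that every index has its partner. -/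
lemma eq_zero_of_skew_left (h : IsSkewOrthonormal s N π) (hN : (N : ℝ≥0∞) < s) {n : ℕ}
    (hn : 2 * n ≤ N) {g : ℝ[X]} (hg : g.degree < ((2 * n : ℕ) : WithBot ℕ))
    (h0 : ∀ j < 2 * n, skew s g (π j) = 0) : g = 0 := by
  obtain ⟨α, rfl⟩ := exists_eq_sum_of_degree h.degree_eq (2 * n) hn g hg
  refine Finset.sum_eq_zero fun i hi => ?_
  have hi' := Finset.mem_range.1 hi
  have hdeg : ∀ i ∈ Finset.range (2 * n), (π i).degree < (N : WithBot ℕ) := fun i hi =>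
    h.degree_lt ((Finset.mem_range.1 hi).trans_le hn)
  have hα : (α i : ℂ) = 0 := by
    obtain ⟨m, rfl | rfl⟩ := Nat.even_or_odd' i
    · have h1 := h0 (2 * m + 1) (by omega)
      rw [skew_sum_left hN (h.degree_lt (by omega)) _ _ hdeg,
        Finset.sum_eq_single_of_mem (2 * m) hi, h.even_odd m m (by omega) (by omega)] at h1
      · simpa using h1
      · intro b hb hbm
        have hb' := Finset.mem_range.1 hb
        obtain ⟨k, rfl | rfl⟩ := Nat.even_or_odd' b
        · rw [h.even_odd m k (by omega) (by omega), if_neg (by omega), mul_zero]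
        · rw [h.odd_odd k m (by omega) (by omega), mul_zero]
    · have h1 := h0 (2 * m) (by omega)
      rw [skew_sum_left hN (h.degree_lt (by omega)) _ _ hdeg,
        Finset.sum_eq_single_of_mem (2 * m + 1) hi, h.odd_even m m (by omega) (by omega)] at h1
      · simpa using h1
      · intro b hb hbm
        have hb' := Finset.mem_range.1 hb
        obtain ⟨k, rfl | rfl⟩ := Nat.even_or_odd' b
        · rw [h.even_even k m (by omega) (by omega), mul_zero]
        · rw [h.odd_even k m (by omega) (by omega), if_neg (by omega), mul_zero]
  rw [Complex.ofReal_eq_zero.1 hα]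
  simp

lemma eq_zero_of_skew_right (h : IsSkewOrthonormal s N π) (hN : (N : ℝ≥0∞) < s) {n : ℕ}
    (hn : 2 * n ≤ N) {g : ℝ[X]} (hg : g.degree < ((2 * n : ℕ) : WithBot ℕ))
    (h0 : ∀ j < 2 * n, skew s (π j) g = 0) : g = 0 := by
  obtain ⟨α, rfl⟩ := exists_eq_sum_of_degree h.degree_eq (2 * n) hn g hg
  refine Finset.sum_eq_zero fun i hi => ?_
  have hi' := Finset.mem_range.1 hi
  have hdeg : ∀ i ∈ Finset.range (2 * n), (π i).degree < (N : WithBot ℕ) := fun i hi =>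
    h.degree_lt ((Finset.mem_range.1 hi).trans_le hn)
  have hα : (α i : ℂ) = 0 := by
    obtain ⟨m, rfl | rfl⟩ := Nat.even_or_odd' i
    · have h1 := h0 (2 * m + 1) (by omega)
      rw [skew_sum_right hN (h.degree_lt (by omega)) _ _ hdeg,
        Finset.sum_eq_single_of_mem (2 * m) hi, h.odd_even m m (by omega) (by omega)] at h1
      · simpa using h1
      · intro b hb hbm
        have hb' := Finset.mem_range.1 hb
        obtain ⟨k, rfl | rfl⟩ := Nat.even_or_odd' b
        · rw [h.odd_even m k (by omega) (by omega), if_neg (by omega), mul_zero]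
        · rw [h.odd_odd m k (by omega) (by omega), mul_zero]
    · have h1 := h0 (2 * m) (by omega)
      rw [skew_sum_right hN (h.degree_lt (by omega)) _ _ hdeg,
        Finset.sum_eq_single_of_mem (2 * m + 1) hi, h.even_odd m m (by omega) (by omega)] at h1
      · simpa using h1
      · intro b hb hbm
        have hb' := Finset.mem_range.1 hb
        obtain ⟨k, rfl | rfl⟩ := Nat.even_or_odd' b
        · rw [h.even_even m k (by omega) (by omega), mul_zero]
        · rw [h.even_odd k m (by omega) (by omega), if_neg (by omega), mul_zero]
  rw [Complex.ofReal_eq_zero.1 hα]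
  simp

/-- With matched leading coefficients the difference has degree below `2 n`, and both polynomials
are skew-orthogonal to everything of degree below `2 n`; nondegeneracy there makes the difference
zero. -/
lemma exists_even_eq (h : IsSkewOrthonormal s N π) (hN : (N : ℝ≥0∞) < s) {n : ℕ}
    (hn : 2 * n < N) : ∃ c : ℝ, c ≠ 0 ∧ π (2 * n) = Polynomial.C c * evenPoly (1 / 2) n := by
  have hd := h.degree_eq (2 * n) hn
  have hlc : (π (2 * n)).coeff (2 * n) ≠ 0 := Polynomial.coeff_ne_zero_of_eq_degree hd
  have hr : risingCoeff (3 / 2) n ≠ 0 := (risingCoeff_pos (by norm_num) n).ne'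
  set c := (π (2 * n)).coeff (2 * n) / risingCoeff (3 / 2) n with hc
  refine ⟨c, div_ne_zero hlc hr, ?_⟩
  have hP : (evenPoly (1 / 2) n).degree < (N : WithBot ℕ) :=
    (degree_evenPoly_lt _ n).trans_le (by exact_mod_cast hn)
  have e : π (2 * n) - Polynomial.C c * evenPoly (1 / 2) n
      = Polynomial.C 1 * π (2 * n) + Polynomial.C (-c) * evenPoly (1 / 2) n := by
    simp [sub_eq_add_neg]
  have h0 : π (2 * n) - Polynomial.C c * evenPoly (1 / 2) n = 0 := by
    refine h.eq_zero_of_skew_left hN hn.le ?_ fun j hj => ?_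
    · rw [Polynomial.degree_lt_iff_coeff_zero]
      intro k hk
      rw [Polynomial.coeff_sub, Polynomial.coeff_C_mul]
      rcases hk.eq_or_lt with rfl | hk
      · rw [coeff_evenPoly, hc, div_mul_cancel₀ _ hr, sub_self]
      · rw [Polynomial.coeff_eq_zero_of_degree_lt (by rw [hd]; exact_mod_cast hk),
          Polynomial.coeff_eq_zero_of_degree_lt
            ((degree_evenPoly_lt _ n).trans_le (by exact_mod_cast hk))]
        simp
    · rw [e, skew_add_left hN (h.degree_lt hn) hP (h.degree_lt (by omega)),
        skew_evenPoly_of_degree_lt hN hn (by rw [h.degree_eq j (by omega)]; exact_mod_cast hj)]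
      obtain ⟨k, rfl | rfl⟩ := Nat.even_or_odd' j
      · rw [h.even_even n k hn (by omega)]; simp
      · rw [h.even_odd k n hn (by omega), if_neg (by omega)]; simp
  exact sub_eq_zero.1 h0

end IsSkewOrthonormal

/-! ### Integrals over the real line -/

lemma lineIntegral_eq (s : ℝ≥0∞) (p : ℝ[X]) :
    lineIntegral s p = ((∫ x, realWeighted s p x : ℝ) : ℂ) := by
  simp only [lineIntegral, weighted_ofReal]
  exact integral_ofReal

/-- The integral of the weighted polynomial of even index over the real line. -/
def lineMass (t : ℝ) (n : ℕ) : ℝ :=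
  2 * ∑ k ∈ Finset.range (n + 1),
    risingCoeff (1 / 2) k * risingCoeff (1 / 2) (n - k) / (1 - (2 * k + 1) * t)

lemma integral_realWeighted_X_pow_even {s : ℝ≥0∞} (hs : s ≠ 0) {k : ℕ}
    (h : (2 * (k : ℝ) + 1) * invExp s < 1) :
    ∫ x, realWeighted s (Polynomial.X ^ (2 * k)) x
      = 2 / ((2 * k + 1) * (1 - (2 * k + 1) * invExp s)) := by
  have h' : (((2 * k : ℕ) : ℝ) + 1) * invExp s < 1 := by push_cast; exact h
  have hi := integrableOn_realWeighted_X_pow hs h'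
  rw [integral_eq_two_mul_of_even fun x => by
      rw [realWeighted_X_pow_neg, Even.neg_one_pow (even_two_mul k), one_mul],
    ← Set.Ioc_union_Ioi_eq_Ioi (zero_le_one' ℝ),
    setIntegral_union (Set.Ioc_disjoint_Ioi le_rfl) measurableSet_Ioi
      (hi.mono_set Set.Ioc_subset_Ioi_self) (hi.mono_set (Set.Ioi_subset_Ioi zero_le_one))]
  have e : Set.EqOn (realWeighted s (Polynomial.X ^ (2 * k))) (fun x => x ^ (2 * k))
      (Set.Ioc 0 1) := fun x hx =>
    realWeighted_X_pow_of_le s _ (abs_le.2 ⟨by linarith [hx.1], hx.2⟩)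
  have h2 := (integral_weight_pow_mul_pow hs (k := 1) (m := 2 * k) (by simpa using h')
    (le_refl (1 : ℝ))).2
  have e2 : ∀ x, realWeighted s (Polynomial.X ^ (2 * k)) x = weight s (x : ℂ) ^ 1 * x ^ (2 * k) := by
    intro x; simp [realWeighted]
  rw [setIntegral_congr_fun measurableSet_Ioc e, ← intervalIntegral.integral_of_le zero_le_one,
    integral_pow]
  simp only [e2]
  rw [h2, weight_of_norm_le_one s (by simp)]
  have h3 : 1 - (2 * (k : ℝ) + 1) * invExp s ≠ 0 := by linarith
  push_cast
  simp only [one_pow, mul_one, ne_eq, Nat.add_eq_zero_iff, one_ne_zero, and_false,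
    not_false_eq_true, zero_pow, sub_zero]
  obtain ⟨y, hy⟩ : ∃ y, y = 1 - (2 * (k : ℝ) + 1) * invExp s := ⟨_, rfl⟩
  rw [← hy] at h3 ⊢
  field_simp
  rw [hy]
  ring

lemma lineIntegral_evenPoly {s : ℝ≥0∞} {N : ℕ} (hN : (N : ℝ≥0∞) < s) {n : ℕ} (hn : 2 * n < N) :
    lineIntegral s (evenPoly (1 / 2) n) = (lineMass (invExp s) n : ℂ) := by
  have hs := ne_zero_of_natCast_lt hN
  rw [lineIntegral_eq, evenPoly]
  congr 1
  simp only [realWeighted_sum]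
  have hk' : ∀ k ∈ Finset.range (n + 1), (2 * (k : ℝ) + 1) * invExp s < 1 := by
    intro k hk
    have hkn := Finset.mem_range.1 hk
    have := succ_mul_invExp_lt_one hN (m := 2 * k) (by omega)
    push_cast at this; exact this
  rw [integral_finsetSum, lineMass, Finset.mul_sum]
  · refine Finset.sum_congr rfl fun k hk => ?_
    rw [integral_const_mul, integral_realWeighted_X_pow_even hs (hk' k hk),
      risingCoeff_three_halves]
    have h3 : 1 - (2 * (k : ℝ) + 1) * invExp s ≠ 0 := by linarith [hk' k hk]
    generalize 1 - (2 * (k : ℝ) + 1) * invExp s = y at *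
    field_simp
  · intro k hk
    exact (integrable_realWeighted_X_pow hs (by push_cast; exact hk' k hk)).const_mul _

lemma lineIntegral_oddPoly (s : ℝ≥0∞) (t : ℝ) (n : ℕ) : lineIntegral s (oddPoly t n) = 0 := by
  rw [lineIntegral_eq, integral_eq_zero_of_odd, Complex.ofReal_zero]
  intro x
  rw [oddPoly, realWeighted_sum, realWeighted_sum, ← Finset.sum_neg_distrib]
  refine Finset.sum_congr rfl fun k _ => ?_
  rw [realWeighted_X_pow_neg, Odd.neg_one_pow ⟨k, rfl⟩]
  ring

lemma lineMass_pos {t : ℝ} {n : ℕ} (h : (2 * (n : ℝ) + 1) * t < 1) :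
    0 < lineMass t n := by
  refine mul_pos two_pos (Finset.sum_pos (fun k hk => ?_) ⟨0, by simp⟩)
  have hkn : (k : ℝ) ≤ n := by
    exact_mod_cast Nat.lt_succ_iff.1 (Finset.mem_range.1 hk)
  have : 0 < 1 - (2 * (k : ℝ) + 1) * t := by nlinarith
  have h1 := risingCoeff_pos (a := 1 / 2) (by norm_num) k
  have h2 := risingCoeff_pos (a := 1 / 2) (by norm_num) (n - k)
  positivity

lemma sum_risingCoeff_half (n : ℕ) :
    ∑ k ∈ Finset.range (n + 1), risingCoeff (1 / 2) k * risingCoeff (1 / 2) (n - k) = 1 := by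
  have := sum_antidiagonal_risingCoeff (1 / 2) (1 / 2) n
  rw [Finset.Nat.sum_antidiagonal_eq_sum_range_succ_mk] at this
  rw [this]
  norm_num [risingCoeff_one]

lemma lineMass_zero {t : ℝ} (h : t < 1) : lineMass t 0 * (1 - t) = 2 := by
  have : 1 - t ≠ 0 := by linarith
  simp [lineMass]
  field_simp

/-- For `t > 0` the substitution `x = (1/t - 1) / 2` gives `1 - (2k+1) t = 2 t (x - k)`, so the mass
is a partial fraction sum with `a = 1/2` and has a product formula, from which the ratio is read
off. For `t = 0` every mass equals `2` by Vandermonde. -/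
lemma lineMass_succ {t : ℝ} (ht : 0 ≤ t) {n : ℕ} (h : (2 * (n : ℝ) + 3) * t < 1) :
    lineMass t (n + 1) * (1 - (2 * n + 3) * t) = lineMass t n * (1 - (2 * n + 2) * t) := by
  rcases ht.eq_or_lt with rfl | ht
  · simp only [lineMass, mul_zero, sub_zero, div_one, mul_one]
    rw [sum_risingCoeff_half, sum_risingCoeff_half]
  set x := (1 / t - 1) / 2 with hx
  have hxt : t * (2 * x + 1) = 1 := by
    rw [hx]; field_simp; ring
  have hxn : ∀ k : ℕ, k ≤ n + 1 → 0 < x - k := by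
    intro k hk
    have hk' : (k : ℝ) ≤ n + 1 := by exact_mod_cast hk
    by_contra hneg
    have h1 : 2 * x + 1 ≤ 2 * n + 3 := by linarith
    have h2 := mul_le_mul_of_nonneg_left h1 ht.le
    linarith
  have key : ∀ m : ℕ, m ≤ n + 1 → lineMass t m = 1 / t * ((∏ l ∈ Finset.range m, (x - l - 1 / 2)) /
      ∏ k ∈ Finset.range (m + 1), (x - k)) := by
    intro m hm
    rw [← sum_risingCoeff_div (1 / 2) x m
      (fun k hk => (sub_pos.1 (hxn k (hk.trans hm))).ne'), lineMass, Finset.mul_sum, Finset.mul_sum]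
    refine Finset.sum_congr rfl fun k hk => ?_
    have hkn := Finset.mem_range.1 hk
    have h1 := (hxn k (by omega)).ne'
    have h2 : 1 - (2 * (k : ℝ) + 1) * t = 2 * t * (x - k) := by linear_combination -hxt
    rw [h2]
    norm_num
    field_simp
  rw [key n (by omega), key (n + 1) le_rfl, Finset.prod_range_succ _ n,
    Finset.prod_range_succ _ (n + 1)]
  have h1 : 1 - (2 * (n : ℝ) + 3) * t = 2 * t * (x - (n + 1 : ℕ)) := by
    push_cast; linear_combination -hxt
  have h2 : 1 - (2 * (n : ℝ) + 2) * t = 2 * t * (x - n - 1 / 2) := by linear_combination -hxt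
  have h3 := (hxn (n + 1) le_rfl).ne'
  have h4 : ∏ k ∈ Finset.range (n + 1), (x - (k : ℝ)) ≠ 0 :=
    Finset.prod_ne_zero_iff.2 fun k hk => (hxn k (Finset.mem_range.1 hk).le).ne'
  rw [h1, h2]
  generalize x - ((n + 1 : ℕ) : ℝ) = y at *
  generalize ∏ k ∈ Finset.range (n + 1), (x - (k : ℝ)) = z at *
  generalize ∏ l ∈ Finset.range n, (x - (l : ℝ) - 1 / 2) = p at *
  field_simp

/-- After subtracting the multiple of `oddPoly` with the same leading coefficient, the remainder has
degree at most `2 n` and is skew-orthogonal to all lower degrees, hence is a multiple of `π (2 *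
n)`. The normalization of the line integral removes this multiple, and `c * d * 4 = 1` fixes the
constant. -/
lemma IsSkewOrthonormal.exists_odd_eq {s : ℝ≥0∞} {N : ℕ} {π : ℕ → ℝ[X]}
    (h : IsSkewOrthonormal s N π) (hN : (N : ℝ≥0∞) < s) {n : ℕ} (hn : 2 * n + 1 < N) {c : ℝ}
    (hc0 : c ≠ 0) (hc : π (2 * n) = Polynomial.C c * evenPoly (1 / 2) n) :
    π (2 * n + 1) = Polynomial.C (1 / (4 * c)) * oddPoly (invExp s) n := by
  set t := invExp s with ht
  have hnt := succ_mul_invExp_lt_one hN hn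
  push_cast at hnt
  have hd := h.degree_eq (2 * n + 1) hn
  have hlc : (π (2 * n + 1)).coeff (2 * n + 1) ≠ 0 := Polynomial.coeff_ne_zero_of_eq_degree hd
  have hr : risingCoeff (3 / 2) n * (1 - (2 * n + 2) * t) ≠ 0 :=
    mul_ne_zero (risingCoeff_pos (by norm_num) n).ne' (by linarith)
  set d := (π (2 * n + 1)).coeff (2 * n + 1) / (risingCoeff (3 / 2) n * (1 - (2 * n + 2) * t)) with hddef
  have hQ : (oddPoly t n).degree < (N : WithBot ℕ) :=
    (degree_oddPoly_lt _ n).trans_le (by exact_mod_cast hn)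
  have hP : (evenPoly (1 / 2) n).degree < (N : WithBot ℕ) :=
    (degree_evenPoly_lt _ n).trans_le (by exact_mod_cast hn.le)
  set g := Polynomial.C 1 * π (2 * n + 1) + Polynomial.C (-d) * oddPoly t n with hg
  have hgdeg : g.degree < ((2 * n + 1 : ℕ) : WithBot ℕ) := by
    rw [Polynomial.degree_lt_iff_coeff_zero]
    intro k hk
    rw [hg, Polynomial.coeff_add, Polynomial.coeff_C_mul, Polynomial.coeff_C_mul]
    rcases hk.eq_or_lt with rfl | hk
    · rw [coeff_oddPoly, hddef, neg_mul, div_mul_cancel₀ _ hr]; ring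
    · rw [Polynomial.coeff_eq_zero_of_degree_lt (by rw [hd]; exact_mod_cast hk),
        Polynomial.coeff_eq_zero_of_degree_lt
          ((degree_oddPoly_lt _ n).trans_le (by exact_mod_cast hk))]
      simp
  have hskew : ∀ j < 2 * n, skew s (π j) g = 0 := by
    intro j hj
    rw [hg, skew_add_right hN (h.degree_lt (by omega)) (h.degree_lt hn) hQ,
      skew_oddPoly_of_degree_lt hN hn (by rw [h.degree_eq j (by omega)]; exact_mod_cast hj)]
    obtain ⟨k, rfl | rfl⟩ := Nat.even_or_odd' j
    · rw [h.even_odd n k (by omega) hn, if_neg (by omega)]; simp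
    · rw [h.odd_odd k n (by omega) hn]; simp
  obtain ⟨α, hα⟩ := exists_eq_sum_of_degree h.degree_eq (2 * n + 1) hn.le g hgdeg
  rw [Finset.sum_range_succ] at hα
  set r := ∑ i ∈ Finset.range (2 * n), Polynomial.C (α i) * π i with hrdef
  have hrdeg : r.degree < ((2 * n : ℕ) : WithBot ℕ) := by
    rw [hrdef, Polynomial.degree_lt_iff_coeff_zero]
    intro k hk
    rw [Polynomial.finsetSum_coeff]
    refine Finset.sum_eq_zero fun i hi => ?_
    have hi' := Finset.mem_range.1 hi
    rw [Polynomial.coeff_C_mul, Polynomial.coeff_eq_zero_of_degree_lt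
      (by rw [h.degree_eq i (by omega)]; exact_mod_cast hi'.trans_le hk), mul_zero]
  have hrN : r.degree < (N : WithBot ℕ) :=
    hrdeg.trans_le (by exact_mod_cast (by omega : 2 * n ≤ N))
  have hr0 : r = 0 := by
    refine h.eq_zero_of_skew_right hN (by omega) hrdeg fun j hj => ?_
    have h1 := hskew j hj
    have e : g = Polynomial.C 1 * r + Polynomial.C (α (2 * n)) * π (2 * n) := by
      rw [hα]; simp
    rw [e, skew_add_right hN (h.degree_lt (by omega)) hrN (h.degree_lt (by omega))] at h1
    have h2 : skew s (π j) (π (2 * n)) = 0 := by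
      obtain ⟨k, rfl | rfl⟩ := Nat.even_or_odd' j
      · exact h.even_even k n (by omega) (by omega)
      · rw [h.odd_even k n (by omega) (by omega), if_neg (by omega)]
    rw [h2] at h1
    simpa using h1
  rw [hr0, zero_add] at hα
  -- The odd polynomials integrate to zero, whereas the even one has positive mass; so the
  -- coefficient of the even one must vanish.
  have hα0 : α (2 * n) = 0 := by
    have h1 := h.odd_integral n hn
    have h2 := lineIntegral_oddPoly s t n
    have h3 := lineIntegral_evenPoly hN (n := n) (by omega)
    have h4 := lineMass_pos (n := n) (by
      have := succ_mul_invExp_lt_one hN (m := 2 * n) (by omega)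
      push_cast at this; exact this)
    rw [lineIntegral_eq, Complex.ofReal_eq_zero] at h1 h2
    rw [lineIntegral_eq, Complex.ofReal_inj] at h3
    have e : realWeighted s (π (2 * n + 1)) = fun x => d * realWeighted s (oddPoly t n) x
        + α (2 * n) * c * realWeighted s (evenPoly (1 / 2) n) x := by
      ext x
      have : π (2 * n + 1) = Polynomial.C d * oddPoly t n
          + Polynomial.C (α (2 * n) * c) * evenPoly (1 / 2) n := by
        rw [hg, hc] at hα
        simp only [map_one, one_mul, map_neg, map_mul] at hα ⊢
        linear_combination hα
      rw [this]
      simp [realWeighted]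
      ring
    rw [e, integral_add ((integrable_realWeighted hN hQ).const_mul _)
      ((integrable_realWeighted hN hP).const_mul _), integral_const_mul, integral_const_mul, h2, h3,
      mul_zero, zero_add] at h1
    rcases mul_eq_zero.1 h1 with h5 | h5
    · exact (mul_eq_zero.1 h5).resolve_right hc0
    · exact absurd h5 h4.ne'
  have hfin : π (2 * n + 1) = Polynomial.C d * oddPoly t n := by
    rw [hα0, hg] at hα
    simp only [map_one, one_mul, map_neg, map_zero, zero_mul] at hα
    linear_combination hα
  have h1 := h.even_odd n n (by omega) hn
  rw [if_pos rfl, hfin, hc] at h1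
  have e1 : Polynomial.C c * evenPoly (1 / 2) n
      = Polynomial.C c * evenPoly (1 / 2) n + Polynomial.C 0 * evenPoly (1 / 2) n := by simp
  have e2 : Polynomial.C d * oddPoly t n
      = Polynomial.C d * oddPoly t n + Polynomial.C 0 * oddPoly t n := by simp
  have hdQ : (Polynomial.C d * oddPoly t n).degree < (N : WithBot ℕ) := by
    rw [← hfin]; exact h.degree_lt hn
  rw [e1, skew_add_left hN hP hP hdQ, e2, skew_add_right hN hP hQ hQ,
    skew_evenPoly_oddPoly hN hn] at h1
  have h2 : c * (d * 4) = 1 := by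
    have : ((c * (d * 4) : ℝ) : ℂ) = ((1 : ℝ) : ℂ) := by
      push_cast
      simpa using h1
    exact_mod_cast this
  rw [hfin]
  congr 2
  rw [eq_div_iff (mul_ne_zero four_ne_zero hc0)]
  linarith

/-! ### Algebra of the kernel entries -/

lemma kernelEntry_neg_swap (N : ℕ) (σ f g : ℕ → ℂ) (a b : ℂ) :
    kernelEntry N σ f g a b = -kernelEntry N σ g f b a := by
  have h1 : ∀ (I : Finset ℕ) (w : ℕ → ℂ) (F G F' G' : ℕ → ℂ),
      ∑ j ∈ I, w j * (F j * G' j - G j * F' j) = -∑ j ∈ I, w j * (G j * F' j - F j * G' j) := by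
    intro I w F G F' G'
    rw [← Finset.sum_neg_distrib]
    exact Finset.sum_congr rfl fun j _ => by ring
  have h2 := h1 (Finset.range (N / 2)) (fun _ => 1) (fun j => f (2 * j)) (fun j => g (2 * j))
    (fun j => f (2 * j + 1)) (fun j => g (2 * j + 1))
  have h3 := h1 (Finset.range (N / 2)) (fun j => σ (2 * j) / σ (2 * (N / 2)))
    (fun _ => f (2 * (N / 2))) (fun _ => g (2 * (N / 2)))
    (fun j => f (2 * j + 1)) (fun j => g (2 * j + 1))
  simp only [one_mul] at h2
  unfold kernelEntry
  rw [h2, h3]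
  split_ifs <;> ring

lemma kernelEntry_congr {N : ℕ} (σ : ℕ → ℂ) {f f' g g' : ℕ → ℂ} (a b : ℂ)
    (hf : ∀ n < N, f n = f' n) (hg : ∀ n < N, g n = g' n) :
    kernelEntry N σ f g a b = kernelEntry N σ f' g' a b := by
  have hJ : Odd N → 2 * (N / 2) < N := fun h => by
    obtain ⟨k, rfl⟩ := h; omega
  unfold kernelEntry
  congr 1
  · congr 1
    refine Finset.sum_congr rfl fun j hj => ?_
    have := Finset.mem_range.1 hj
    rw [hf (2 * j) (by omega), hf (2 * j + 1) (by omega), hg (2 * j) (by omega),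
      hg (2 * j + 1) (by omega)]
  · split_ifs with h
    · rw [hf _ (hJ h), hg _ (hJ h)]
      congr 2
      refine Finset.sum_congr rfl fun j hj => ?_
      have := Finset.mem_range.1 hj
      rw [hf (2 * j + 1) (by omega), hg (2 * j + 1) (by omega)]
    · rfl

/-- The kernel entries are affine in the second argument. -/
lemma exists_kernelEntry_eq_sum (N : ℕ) (σ f : ℕ → ℂ) (a : ℂ) :
    ∃ (L₀ L₁ : ℕ → ℂ) (L₂ L₃ : ℂ), ∀ (g : ℕ → ℂ) (b : ℂ), kernelEntry N σ f g a b
      = ∑ j ∈ Finset.range (N / 2), (L₀ j * g (2 * j + 1) - L₁ j * g (2 * j))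
        + L₂ * g (2 * (N / 2)) + L₃ * b := by
  by_cases hN : Odd N
  · refine ⟨fun j => 2 * f (2 * j) - 2 * (σ (2 * j) / σ (2 * (N / 2))) * f (2 * (N / 2)),
      fun j => 2 * f (2 * j + 1),
      2 * (∑ j ∈ Finset.range (N / 2), σ (2 * j) / σ (2 * (N / 2)) * f (2 * j + 1))
        - a / σ (2 * (N / 2)), f (2 * (N / 2)) / σ (2 * (N / 2)), fun g b => ?_⟩
    unfold kernelEntry
    rw [if_pos hN]
    simp only [mul_sub, sub_mul, Finset.sum_sub_distrib]
    simp only [Finset.mul_sum, Finset.sum_mul]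
    have e : ∑ j ∈ Finset.range (N / 2),
        -2 * (σ (2 * j) / σ (2 * (N / 2)) * (g (2 * (N / 2)) * f (2 * j + 1)))
        = - ∑ j ∈ Finset.range (N / 2),
        2 * (σ (2 * j) / σ (2 * (N / 2)) * f (2 * j + 1)) * g (2 * (N / 2)) := by
      rw [← Finset.sum_neg_distrib]
      exact Finset.sum_congr rfl fun j _ => by ring
    have e2 : ∑ j ∈ Finset.range (N / 2),
        -2 * (σ (2 * j) / σ (2 * (N / 2)) * (f (2 * (N / 2)) * g (2 * j + 1)))
        = - ∑ j ∈ Finset.range (N / 2),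
        2 * (σ (2 * j) / σ (2 * (N / 2))) * f (2 * (N / 2)) * g (2 * j + 1) := by
      rw [← Finset.sum_neg_distrib]
      exact Finset.sum_congr rfl fun j _ => by ring
    have e3 : ∑ j ∈ Finset.range (N / 2), 2 * (g (2 * j) * f (2 * j + 1))
        = ∑ j ∈ Finset.range (N / 2), 2 * f (2 * j + 1) * g (2 * j) :=
      Finset.sum_congr rfl fun j _ => by ring
    have e4 : ∑ j ∈ Finset.range (N / 2), 2 * (f (2 * j) * g (2 * j + 1))
        = ∑ j ∈ Finset.range (N / 2), 2 * f (2 * j) * g (2 * j + 1) :=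
      Finset.sum_congr rfl fun j _ => by ring
    rw [e, e2, e3, e4]
    ring
  · refine ⟨fun j => 2 * f (2 * j), fun j => 2 * f (2 * j + 1), 0, 0, fun g b => ?_⟩
    unfold kernelEntry
    rw [if_neg hN, Finset.mul_sum]
    simp only [zero_mul, add_zero]
    exact Finset.sum_congr rfl fun j _ => by ring

lemma kernelEntry_smul_right (N : ℕ) (σ f g : ℕ → ℂ) (a c : ℂ) :
    kernelEntry N σ f (fun n => c * g n) a 0 = c * kernelEntry N σ f g a 0 := by
  obtain ⟨L₀, L₁, L₂, L₃, h⟩ := exists_kernelEntry_eq_sum N σ f a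
  rw [h, h]
  simp only [mul_zero, add_zero, mul_add, Finset.mul_sum]
  congr 1
  · exact Finset.sum_congr rfl fun j _ => by ring
  · ring

lemma kernelEntry_smul_left (N : ℕ) (σ f g : ℕ → ℂ) (b c : ℂ) :
    kernelEntry N σ (fun n => c * f n) g 0 b = c * kernelEntry N σ f g 0 b := by
  rw [kernelEntry_neg_swap, kernelEntry_smul_right, kernelEntry_neg_swap N σ f]
  ring

/-- An affine function commutes with integration once its constant part is kept outside; this is why
`b` stays with `g` while the integrand carries `0`. -/
lemma kernelEntry_sub_integral (N : ℕ) (σ f g : ℕ → ℂ) (a b : ℂ) {G : ℝ → ℕ → ℂ} {x y : ℝ}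
    (hG : ∀ n, IntervalIntegrable (fun r => G r n) volume x y) :
    kernelEntry N σ f (fun n => g n - ∫ r in x..y, G r n) a b
      = kernelEntry N σ f g a b - ∫ r in x..y, kernelEntry N σ f (G r) a 0 := by
  obtain ⟨L₀, L₁, L₂, L₃, h⟩ := exists_kernelEntry_eq_sum N σ f a
  simp only [h, mul_zero, add_zero]
  have h1 : ∀ j ∈ Finset.range (N / 2), IntervalIntegrable
      (fun r => L₀ j * G r (2 * j + 1) - L₁ j * G r (2 * j)) volume x y := fun j _ =>
    ((hG _).const_mul _).sub ((hG _).const_mul _)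
  have h1' : IntervalIntegrable (fun r => ∑ j ∈ Finset.range (N / 2),
      (L₀ j * G r (2 * j + 1) - L₁ j * G r (2 * j))) volume x y := by
    have := IntervalIntegrable.sum (Finset.range (N / 2)) h1
    simpa [Finset.sum_fn] using this
  rw [intervalIntegral.integral_add h1' ((hG _).const_mul _),
    intervalIntegral.integral_finsetSum h1]
  have h2 : ∀ j ∈ Finset.range (N / 2), ∫ r in x..y, (L₀ j * G r (2 * j + 1) - L₁ j * G r (2 * j))
      = L₀ j * (∫ r in x..y, G r (2 * j + 1)) - L₁ j * ∫ r in x..y, G r (2 * j) := fun j _ => by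
    rw [intervalIntegral.integral_sub ((hG _).const_mul _) ((hG _).const_mul _),
      intervalIntegral.integral_const_mul, intervalIntegral.integral_const_mul]
  rw [Finset.sum_congr rfl h2, intervalIntegral.integral_const_mul]
  have h3 : ∑ j ∈ Finset.range (N / 2), (L₀ j * (g (2 * j + 1) - ∫ r in x..y, G r (2 * j + 1))
      - L₁ j * (g (2 * j) - ∫ r in x..y, G r (2 * j)))
      = ∑ j ∈ Finset.range (N / 2), (L₀ j * g (2 * j + 1) - L₁ j * g (2 * j))
        - ∑ j ∈ Finset.range (N / 2), (L₀ j * (∫ r in x..y, G r (2 * j + 1))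
          - L₁ j * ∫ r in x..y, G r (2 * j)) := by
    rw [← Finset.sum_sub_distrib]
    exact Finset.sum_congr rfl fun j _ => by ring
  rw [h3]
  ring

/-- The kernel entries in terms of rescaled sequences. -/
lemma kernelEntry_eq_of_scaled {N : ℕ} {σ f g c d F F' G G' S : ℕ → ℂ} (a b : ℂ)
    (hc : ∀ j, 2 * j < N → c j ≠ 0) (hS : ∀ j, 2 * j < N → S j ≠ 0)
    (hcd : ∀ j, 2 * j + 1 < N → 4 * (c j * d j) = 1)
    (hσ : ∀ j, 2 * j < N → σ (2 * j) = c j * S j)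
    (hf : ∀ j, 2 * j < N → f (2 * j) = c j * F j)
    (hf' : ∀ j, 2 * j + 1 < N → f (2 * j + 1) = d j * F' j)
    (hg : ∀ j, 2 * j < N → g (2 * j) = c j * G j)
    (hg' : ∀ j, 2 * j + 1 < N → g (2 * j + 1) = d j * G' j) :
    kernelEntry N σ f g a b
      = 1 / 2 * ∑ j ∈ Finset.range (N / 2), (F j * G' j - G j * F' j)
        + if Odd N then
            F (N / 2) * ((b - 1 / 2 * ∑ j ∈ Finset.range (N / 2), S j * G' j) / S (N / 2))
            - G (N / 2) * ((a - 1 / 2 * ∑ j ∈ Finset.range (N / 2), S j * F' j) / S (N / 2))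
          else 0 := by
  unfold kernelEntry
  congr 1
  · rw [Finset.mul_sum, Finset.mul_sum]
    refine Finset.sum_congr rfl fun j hj => ?_
    have hj' := Finset.mem_range.1 hj
    rw [hf j (by omega), hf' j (by omega), hg j (by omega), hg' j (by omega)]
    -- The normalization `4 c d = 1` is what turns the prefactor `2` into `1 / 2`.
    linear_combination (F j * G' j - G j * F' j) / 2 * hcd j (by omega)
  · split_ifs with hN
    · have hJ : 2 * (N / 2) < N := by obtain ⟨k, rfl⟩ := hN; omega
      set J := N / 2
      rw [hf J hJ, hg J hJ, hσ J hJ]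
      have hc' := hc J hJ
      have hS' := hS J hJ
      have e : ∑ j ∈ Finset.range J, σ (2 * j) / (c J * S J) *
          (c J * F J * g (2 * j + 1) - c J * G J * f (2 * j + 1))
          = F J / (4 * S J) * ∑ j ∈ Finset.range J, S j * G' j
            - G J / (4 * S J) * ∑ j ∈ Finset.range J, S j * F' j := by
        rw [Finset.mul_sum, Finset.mul_sum, ← Finset.sum_sub_distrib]
        refine Finset.sum_congr rfl fun j hj => ?_
        have hj' := Finset.mem_range.1 hj
        rw [hσ j (by omega), hf' j (by omega), hg' j (by omega)]
        field_simp
        linear_combination S j * (F J * G' j - G J * F' j) * hcd j (by omega)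
      rw [e]
      field_simp
      ring
    · rfl

/-! ### The operator `ε` on weighted polynomials -/

lemma eps_ofReal (s : ℝ≥0∞) (p : ℝ[X]) (x : ℝ) :
    eps (weighted s p) (x : ℂ) = ((1 / 2 * signInt (realWeighted s p) x : ℝ) : ℂ) := by
  rw [eps, if_pos (Complex.ofReal_im x), signInt, Complex.ofReal_re]
  simp only [weighted_ofReal]
  push_cast
  congr 1
  rw [← integral_complex_ofReal]
  congr 1
  ext t
  push_cast
  rfl

lemma weighted_C_mul (s : ℝ≥0∞) (c : ℝ) (p : ℝ[X]) (u : ℂ) :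
    weighted s (Polynomial.C c * p) u = c * weighted s p u := by
  simp only [weighted, map_mul, Polynomial.aeval_C, Complex.coe_algebraMap]
  ring

lemma eps_weighted_C_mul (s : ℝ≥0∞) (c : ℝ) (p : ℝ[X]) (u : ℂ) :
    eps (weighted s (Polynomial.C c * p)) u = c * eps (weighted s p) u := by
  unfold eps
  simp only [weighted_C_mul]
  split_ifs
  · simp only [mul_assoc, integral_const_mul]
    ring
  · ring

lemma lineIntegral_C_mul (s : ℝ≥0∞) (c : ℝ) (p : ℝ[X]) :
    lineIntegral s (Polynomial.C c * p) = c * lineIntegral s p := by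
  simp only [lineIntegral, weighted_C_mul, integral_const_mul]

/-- As a function of the base point this is odd, hence zero at `0`, so its value at `1` only
involves the integral over `[0, 1]`, where the weight is `1`. Integration converts `(3/2)_k` to
`(1/2)_k`, and Vandermonde gives `1` for every `n`. -/
lemma signInt_evenPoly {s : ℝ≥0∞} {N : ℕ} (hN : (N : ℝ≥0∞) < s) {n : ℕ} (hn : 2 * n < N) {ξ : ℝ}
    (hξ : ξ = 1 ∨ ξ = -1) : signInt (realWeighted s (evenPoly (1 / 2) n)) ξ = -2 * ξ := by
  have hP : (evenPoly (1 / 2) n).degree < (N : WithBot ℕ) :=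
    (degree_evenPoly_lt _ n).trans_le (by exact_mod_cast hn)
  have hodd : ∀ x, signInt (realWeighted s (evenPoly (1 / 2) n)) (-x)
      = -1 * signInt (realWeighted s (evenPoly (1 / 2) n)) x := signInt_neg _ 1 fun x => by
    rw [one_mul, evenPoly, realWeighted_sum, realWeighted_sum]
    refine Finset.sum_congr rfl fun k _ => ?_
    rw [realWeighted_X_pow_neg, Even.neg_one_pow (even_two_mul k), one_mul]
  have h0 : signInt (realWeighted s (evenPoly (1 / 2) n)) 0 = 0 := by
    have := hodd 0
    rw [neg_zero] at this
    linarith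
  have h1 : signInt (realWeighted s (evenPoly (1 / 2) n)) 1 = -2 := by
    have h2 := signInt_sub (integrable_realWeighted hN hP) 0 1
    have h3 : ∫ y in (0 : ℝ)..1, realWeighted s (evenPoly (1 / 2) n) y
        = ∫ y in (0 : ℝ)..1, ∑ k ∈ Finset.range (n + 1),
          risingCoeff (3 / 2) k * risingCoeff (1 / 2) (n - k) * y ^ (2 * k) := by
      refine intervalIntegral.integral_congr fun y hy => ?_
      rw [Set.uIcc_of_le zero_le_one] at hy
      simp only [evenPoly]
      rw [realWeighted_sum]
      exact Finset.sum_congr rfl fun k _ => by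
        rw [realWeighted_X_pow_of_le s _ (abs_le.2 ⟨by linarith [hy.1], hy.2⟩)]
    rw [h0, h3, intervalIntegral.integral_finsetSum] at h2
    · have h4 : ∑ k ∈ Finset.range (n + 1), ∫ y in (0 : ℝ)..1,
          risingCoeff (3 / 2) k * risingCoeff (1 / 2) (n - k) * y ^ (2 * k) = 1 := by
        refine Eq.trans ?_ (sum_risingCoeff_half n)
        refine Finset.sum_congr rfl fun k _ => ?_
        rw [intervalIntegral.integral_const_mul, integral_pow, risingCoeff_three_halves]
        push_cast
        simp only [one_pow, ne_eq, Nat.add_eq_zero_iff, one_ne_zero, and_false,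
          not_false_eq_true, zero_pow, sub_zero]
        field_simp
      rw [h4] at h2
      linarith
    · intro k _
      exact Continuous.intervalIntegrable (by fun_prop) _ _
  rcases hξ with rfl | rfl
  · rw [h1]; ring
  · rw [hodd, h1]; ring

/-- At `1` only tail integrals occur. Their denominators `1 - (2k+2) t` are cancelled by the
coefficients, and the Vandermonde sum with `3/2 - 1/2 = 1` equals `1`. -/
lemma signInt_oddPoly {s : ℝ≥0∞} {N : ℕ} (hN : (N : ℝ≥0∞) < s) {n : ℕ} (hn : 2 * n + 1 < N)
    {ξ : ℝ} (hξ : ξ = 1 ∨ ξ = -1) :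
    signInt (realWeighted s (oddPoly (invExp s) n)) ξ = 2 * invExp s := by
  have hs := ne_zero_of_natCast_lt hN
  set t := invExp s with ht
  have heven : ∀ x, signInt (realWeighted s (oddPoly t n)) (-x)
      = -(-1) * signInt (realWeighted s (oddPoly t n)) x := signInt_neg _ (-1) fun x => by
    rw [oddPoly, realWeighted_sum, realWeighted_sum, Finset.mul_sum]
    refine Finset.sum_congr rfl fun k _ => ?_
    rw [realWeighted_X_pow_neg, Odd.neg_one_pow ⟨k, rfl⟩]
    ring
  have hk' : ∀ k ∈ Finset.range (n + 1), (2 * (k : ℝ) + 2) * t < 1 := by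
    intro k hk
    have hkn := Finset.mem_range.1 hk
    have := succ_mul_invExp_lt_one hN (m := 2 * k + 1) (by omega)
    push_cast at this; convert this using 2; ring
  have h1 : signInt (realWeighted s (oddPoly t n)) 1 = 2 * t := by
    have e : realWeighted s (oddPoly t n) = fun x => ∑ k ∈ Finset.range (n + 1),
        (risingCoeff (3 / 2) k * risingCoeff (-(1 / 2)) (n - k) * (1 - (2 * k + 2) * t)) *
          realWeighted s (Polynomial.X ^ (2 * k + 1)) x := by
      ext x; rw [oddPoly, realWeighted_sum]
    rw [e, signInt_sum (Finset.range (n + 1)) _ (fun k => realWeighted s (Polynomial.X ^ (2 * k + 1)))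
      (fun k hk => integrable_realWeighted_X_pow hs (by
        have := hk' k hk
        push_cast; convert this using 2; ring))]
    have hV := sum_antidiagonal_risingCoeff (3 / 2) (-(1 / 2)) n
    rw [Finset.Nat.sum_antidiagonal_eq_sum_range_succ_mk] at hV
    have h3 : (3 / 2 + -(1 / 2) : ℝ) = 1 := by norm_num
    rw [h3, risingCoeff_one] at hV
    refine Eq.trans ?_ ((congrArg (2 * t * ·) hV).trans (mul_one _))
    simp only [Finset.mul_sum]
    refine Finset.sum_congr rfl fun k hk => ?_
    rw [(signInt_realWeighted_X_pow_odd hs (hk' k hk)).1 1 le_rfl, weight_of_norm_le_one s (by simp)]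
    have h4 : 1 - (2 * (k : ℝ) + 2) * t ≠ 0 := by linarith [hk' k hk]
    rw [← ht]
    generalize 1 - (2 * (k : ℝ) + 2) * t = y at *
    simp only [one_pow, mul_one]
    field_simp
  rcases hξ with rfl | rfl
  · exact h1
  · rw [heven, h1]; ring

/-! ### Closed forms of the kernel -/

/-- The first entry of the kernel without the weights. -/
def polyKernel (t : ℝ) (N : ℕ) (z w : ℂ) : ℂ :=
  1 / 2 * ∑ j ∈ Finset.range (N / 2),
      (Polynomial.aeval z (evenPoly (1 / 2) j) * Polynomial.aeval w (oddPoly t j)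
        - Polynomial.aeval w (evenPoly (1 / 2) j) * Polynomial.aeval z (oddPoly t j))
    + if Odd N then
        Polynomial.aeval z (evenPoly (1 / 2) (N / 2)) * (-(1 / 2) * (1 - N * t) * w *
          (Polynomial.aeval w (evenPoly (1 / 2) (N / 2))
            - Polynomial.aeval w (evenPoly (-(1 / 2)) (N / 2))))
        - Polynomial.aeval w (evenPoly (1 / 2) (N / 2)) * (-(1 / 2) * (1 - N * t) * z *
          (Polynomial.aeval z (evenPoly (1 / 2) (N / 2))
            - Polynomial.aeval z (evenPoly (-(1 / 2)) (N / 2))))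
      else 0

/-- The second entry of the kernel with second argument `ξ`, without the weight. -/
def edgeKernel (t : ℝ) (N : ℕ) (ξ : ℝ) (z : ℂ) : ℂ :=
  1 / 2 * ∑ j ∈ Finset.range (N / 2),
      (t * Polynomial.aeval z (evenPoly (1 / 2) j) + ξ * Polynomial.aeval z (oddPoly t j))
    + if Odd N then
        1 / 2 * (1 - N * t) * (Polynomial.aeval z (evenPoly (1 / 2) (N / 2)) - ξ * z *
          (Polynomial.aeval z (evenPoly (1 / 2) (N / 2))
            - Polynomial.aeval z (evenPoly (-(1 / 2)) (N / 2))))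
      else 0

/-- Telescoping: the recurrence of the masses matches the step `evenPoly (1/2) (J+1) - evenPoly
(-(1/2)) (J+1) = evenPoly (1/2) J`. -/
lemma sum_lineMass_mul_oddPoly {t : ℝ} (ht : 0 ≤ t) (z : ℂ) (J : ℕ) (h : (2 * (J : ℝ) + 1) * t < 1) :
    ∑ j ∈ Finset.range J, (lineMass t j : ℂ) * Polynomial.aeval z (oddPoly t j)
      = lineMass t J * (1 - (2 * J + 1) * t) * z *
        (Polynomial.aeval z (evenPoly (1 / 2) J) - Polynomial.aeval z (evenPoly (-(1 / 2)) J)) := by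
  induction J with
  | zero => simp [evenPoly_zero]
  | succ J ih =>
    have h1 : (2 * (J : ℝ) + 3) * t < 1 := by push_cast at h; linarith
    have hs := lineMass_succ ht h1
    have hs' : (lineMass t (J + 1) : ℂ) * (1 - (2 * J + 3) * t) = lineMass t J * (1 - (2 * J + 2) * t) := by
      exact_mod_cast hs
    rw [Finset.sum_range_succ, ih (by linarith), aeval_oddPoly_eq, aeval_evenPoly_succ]
    push_cast
    linear_combination -z * Polynomial.aeval z (evenPoly (1 / 2) J) * hs'

lemma sum_lineMass {t : ℝ} (ht : 0 ≤ t) (J : ℕ) (h : (2 * (J : ℝ) + 1) * t < 1) :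
    ∑ j ∈ Finset.range J, lineMass t j * t = 2 - lineMass t J * (1 - (2 * J + 1) * t) := by
  induction J with
  | zero =>
    have := lineMass_zero (t := t) (by simpa using h)
    simp [this]
  | succ J ih =>
    have h1 : (2 * (J : ℝ) + 3) * t < 1 := by push_cast at h; linarith
    have hs := lineMass_succ ht h1
    rw [Finset.sum_range_succ, ih (by linarith)]
    push_cast
    linear_combination hs

namespace IsSkewOrthonormal

variable {s : ℝ≥0∞} {N : ℕ} {π : ℕ → ℝ[X]}

lemma exists_scaling (h : IsSkewOrthonormal s N π) (hN : (N : ℝ≥0∞) < s) :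
    ∃ c : ℕ → ℝ, (∀ j, 2 * j < N → c j ≠ 0 ∧ π (2 * j) = Polynomial.C (c j) * evenPoly (1 / 2) j) ∧
      ∀ j, 2 * j + 1 < N →
        π (2 * j + 1) = Polynomial.C (1 / (4 * c j)) * oddPoly (invExp s) j := by
  have h1 : ∀ j, 2 * j < N → ∃ c : ℝ, c ≠ 0 ∧ π (2 * j) = Polynomial.C c * evenPoly (1 / 2) j :=
    fun j hj => h.exists_even_eq hN hj
  choose! c hc using h1
  exact ⟨c, hc, fun j hj =>
    h.exists_odd_eq hN hj (hc j (by omega)).1 (hc j (by omega)).2⟩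

lemma lineMass_ne_zero (hN : (N : ℝ≥0∞) < s) {j : ℕ} (hj : 2 * j < N) :
    (lineMass (invExp s) j : ℂ) ≠ 0 := by
  have h1 := succ_mul_invExp_lt_one hN hj
  push_cast at h1
  exact_mod_cast (lineMass_pos h1).ne'

lemma odd_mul_invExp (hodd : Odd N) :
    (2 * ((N / 2 : ℕ) : ℝ) + 1) = N := by
  obtain ⟨k, rfl⟩ := hodd
  rw [show (2 * k + 1) / 2 = k by omega]
  push_cast; ring

/-- The scaling constants cancel because of `4 c d = 1`. For odd `N`, where `2 (N / 2) + 1 = N`, the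
telescoped sum is proportional to the mass of index `N / 2`, by which the correction is divided. -/
lemma kernelEntry_weighted (h : IsSkewOrthonormal s N π) (hN : (N : ℝ≥0∞) < s) (z w : ℂ) :
    kernelEntry N (fun n => lineIntegral s (π n)) (fun n => weighted s (π n) z)
      (fun n => weighted s (π n) w) 0 0
      = weight s z * weight s w * polyKernel (invExp s) N z w := by
  obtain ⟨c, hc, hd⟩ := h.exists_scaling hN
  have hev : ∀ (x : ℂ) j, 2 * j < N → weighted s (π (2 * j)) x
      = (c j : ℂ) * weighted s (evenPoly (1 / 2) j) x := fun x j hj => by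
    rw [(hc j hj).2, weighted_C_mul]
  have hod : ∀ (x : ℂ) j, 2 * j + 1 < N → weighted s (π (2 * j + 1)) x
      = ((1 / (4 * c j) : ℝ) : ℂ) * weighted s (oddPoly (invExp s) j) x := fun x j hj => by
    rw [hd j hj, weighted_C_mul]
  rw [kernelEntry_eq_of_scaled (c := fun j => (c j : ℂ)) (d := fun j => ((1 / (4 * c j) : ℝ) : ℂ))
    (S := fun j => (lineMass (invExp s) j : ℂ)) 0 0
    (fun j hj => by exact_mod_cast (hc j hj).1) (fun j hj => lineMass_ne_zero hN hj)
    (fun j hj => by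
      have : (c j : ℂ) ≠ 0 := by exact_mod_cast (hc j (by omega)).1
      push_cast; field_simp)
    (fun j hj => by rw [(hc j hj).2, lineIntegral_C_mul, lineIntegral_evenPoly hN hj])
    (hev z) (hod z) (hev w) (hod w), polyKernel, mul_add]
  congr 1
  · rw [Finset.mul_sum, Finset.mul_sum, Finset.mul_sum]
    refine Finset.sum_congr rfl fun j _ => ?_
    simp only [weighted]
    ring
  · split_ifs with hodd
    · have hJ : 2 * (N / 2) < N := by obtain ⟨k, rfl⟩ := hodd; omega
      have hm := lineMass_ne_zero hN hJ
      have hcast := odd_mul_invExp hodd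
      have hlt := natCast_mul_invExp_lt_one hN
      have hsum : ∀ x : ℂ, ∑ j ∈ Finset.range (N / 2), (lineMass (invExp s) j : ℂ) *
          weighted s (oddPoly (invExp s) j) x
          = weight s x * (lineMass (invExp s) (N / 2) * (1 - N * invExp s) * x *
        (Polynomial.aeval x (evenPoly (1 / 2) (N / 2))
          - Polynomial.aeval x (evenPoly (-(1 / 2)) (N / 2)))) := by
        intro x
        have h1 := sum_lineMass_mul_oddPoly (invExp_nonneg s) x (N / 2) (by rw [hcast]; exact hlt)
        have h2 : (2 * ((N / 2 : ℕ) : ℂ) + 1) = N := by exact_mod_cast hcast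
        rw [h2] at h1
        rw [← h1, Finset.mul_sum]
        refine Finset.sum_congr rfl fun j _ => ?_
        simp only [weighted]
        ring
      rw [hsum, hsum]
      simp only [weighted]
      field_simp
      ring
    · ring

/-- At the edge point `ε` takes the values `-ξ` and `t` for all indices. For odd `N` the
contribution `1` of the characteristic function cancels the constant in half of `2 - lineMass * (1 -
N t)`; the rest is proportional to the mass in the denominator. -/
lemma kernelEntry_eps_edge (h : IsSkewOrthonormal s N π) (hN : (N : ℝ≥0∞) < s) (z : ℂ) {ξ : ℝ}
    (hξ : ξ = 1 ∨ ξ = -1) :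
    kernelEntry N (fun n => lineIntegral s (π n)) (fun n => weighted s (π n) z)
      (fun n => eps (weighted s (π n)) (ξ : ℂ)) 0 1
      = weight s z * edgeKernel (invExp s) N ξ z := by
  obtain ⟨c, hc, hd⟩ := h.exists_scaling hN
  rw [kernelEntry_eq_of_scaled (c := fun j => (c j : ℂ)) (d := fun j => ((1 / (4 * c j) : ℝ) : ℂ))
    (S := fun j => (lineMass (invExp s) j : ℂ))
    (F := fun j => weighted s (evenPoly (1 / 2) j) z)
    (F' := fun j => weighted s (oddPoly (invExp s) j) z)
    (G := fun _ => -(ξ : ℂ)) (G' := fun _ => (invExp s : ℂ)) 0 1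
    (fun j hj => by exact_mod_cast (hc j hj).1) (fun j hj => lineMass_ne_zero hN hj)
    (fun j hj => by
      have : (c j : ℂ) ≠ 0 := by exact_mod_cast (hc j (by omega)).1
      push_cast; field_simp)
    (fun j hj => by rw [(hc j hj).2, lineIntegral_C_mul, lineIntegral_evenPoly hN hj])
    (fun j hj => by rw [(hc j hj).2, weighted_C_mul])
    (fun j hj => by rw [hd j hj, weighted_C_mul])
    (fun j hj => by
      rw [(hc j hj).2, eps_weighted_C_mul, eps_ofReal, signInt_evenPoly hN hj hξ]
      push_cast; ring)
    (fun j hj => by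
      rw [hd j hj, eps_weighted_C_mul, eps_ofReal, signInt_oddPoly hN hj hξ]
      push_cast; ring), edgeKernel, mul_add]
  congr 1
  · rw [Finset.mul_sum, Finset.mul_sum, Finset.mul_sum]
    refine Finset.sum_congr rfl fun j _ => ?_
    simp only [weighted]
    ring
  · split_ifs with hodd
    · have hJ : 2 * (N / 2) < N := by obtain ⟨k, rfl⟩ := hodd; omega
      have hm := lineMass_ne_zero hN hJ
      have hcast := odd_mul_invExp hodd
      have hlt := natCast_mul_invExp_lt_one hN
      have h2 : (2 * ((N / 2 : ℕ) : ℂ) + 1) = N := by exact_mod_cast hcast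
      have h1 := sum_lineMass_mul_oddPoly (invExp_nonneg s) z (N / 2) (by rw [hcast]; exact hlt)
      rw [h2] at h1
      have hsum : ∑ j ∈ Finset.range (N / 2), (lineMass (invExp s) j : ℂ) *
          weighted s (oddPoly (invExp s) j) z
          = weight s z * (lineMass (invExp s) (N / 2) * (1 - N * invExp s) * z *
        (Polynomial.aeval z (evenPoly (1 / 2) (N / 2))
          - Polynomial.aeval z (evenPoly (-(1 / 2)) (N / 2)))) := by
        rw [← h1, Finset.mul_sum]
        refine Finset.sum_congr rfl fun j _ => ?_
        simp only [weighted]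
        ring
      have h3 := sum_lineMass (invExp_nonneg s) (N / 2) (by rw [hcast]; exact hlt)
      rw [hcast] at h3
      have h4 : ∑ j ∈ Finset.range (N / 2), (lineMass (invExp s) j : ℂ) * (invExp s : ℂ)
          = 2 - lineMass (invExp s) (N / 2) * (1 - N * invExp s) := by exact_mod_cast h3
      rw [hsum, h4]
      simp only [weighted]
      field_simp
      ring
    · ring

end IsSkewOrthonormal

/-! ### A kernel matrix built from a weight, a kernel and an edge function -/

lemma segInt_ofReal (f : ℂ → ℂ) (x : ℝ) : segInt f (x : ℂ) = ∫ y in (0 : ℝ)..x, f (y : ℂ) := by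
  have := intervalIntegral.smul_integral_comp_mul_right (a := 0) (b := 1)
    (fun y : ℝ => f (y : ℂ)) x
  rw [zero_mul, one_mul] at this
  rw [segInt, ← this, Complex.real_smul]
  simp

/-- The entry with `ε` acting on the second argument, which is real. -/
def modelEdge (ω : ℂ → ℝ) (S : ℂ → ℂ → ℂ) (C : ℂ → ℂ) (u x : ℂ) : ℂ :=
  ω u * (C u - segInt (fun y => ω y * S u y) x)

/-- The entry with `ε` acting on both arguments, which are real, without the sign. -/
def modelReal (ω : ℂ → ℝ) (S : ℂ → ℂ → ℂ) (C : ℂ → ℂ) (x y : ℂ) : ℂ :=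
  segInt (fun y' => modelEdge ω S C y' x) y - segInt (fun x' => ω x' * C x') x

/-- The point at which an entry of the matrix evaluates. -/
def reflPoint (i : Fin 2) (u : ℂ) : ℂ := if i = 0 then u else conj u

/-- The factor that accompanies `reflPoint`. -/
def reflFactor (i : Fin 2) (u : ℂ) : ℂ := if i = 0 then 1 else iota u

/-- The entries of the kernel matrix. -/
def modelEntry (ω : ℂ → ℝ) (S : ℂ → ℂ → ℂ) (C : ℂ → ℂ) (i j : Fin 2) (u v : ℂ) : ℂ :=
  if i = 1 ∧ u.im = 0 then
    if j = 1 ∧ v.im = 0 then modelReal ω S C u v + 1 / 2 * sgnDiff u v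
    else -(reflFactor j v * modelEdge ω S C (reflPoint j v) u)
  else
    if j = 1 ∧ v.im = 0 then reflFactor i u * modelEdge ω S C (reflPoint i u) v
    else reflFactor i u * reflFactor j v *
      (ω (reflPoint i u) * ω (reflPoint j v) * S (reflPoint i u) (reflPoint j v))

/-! ### The scaled kernel -/

/-- The weight scaled near `ξ`. -/
def scaledWeight (s : ℝ≥0∞) (N : ℕ) (ξ : ℝ) (u : ℂ) : ℝ := weight s ((ξ : ℂ) + u / N)

/-- The first entry of the scaled kernel without the weights. -/
def scaledPoly (t : ℝ) (N : ℕ) (ξ : ℝ) (u v : ℂ) : ℂ :=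
  polyKernel t N ((ξ : ℂ) + u / N) ((ξ : ℂ) + v / N) / N ^ 2

/-- The second entry of the scaled kernel with second argument `0`, without the weight. -/
def scaledEdge (t : ℝ) (N : ℕ) (ξ : ℝ) (u : ℂ) : ℂ := edgeKernel t N ξ ((ξ : ℂ) + u / N) / N

lemma im_scaled (N : ℕ) (ξ : ℝ) (u : ℂ) : ((ξ : ℂ) + u / N).im = u.im / N := by
  simp

lemma im_scaled_eq_zero {N : ℕ} (hN : 0 < N) (ξ : ℝ) (u : ℂ) :
    ((ξ : ℂ) + u / N).im = 0 ↔ u.im = 0 := by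
  rw [im_scaled, div_eq_zero_iff]
  have : (N : ℝ) ≠ 0 := by positivity
  simp [this]

lemma sign_div_natCast {N : ℕ} (hN : 0 < N) (x : ℝ) : Real.sign (x / N) = Real.sign x := by
  have hN' : (0 : ℝ) < N := by exact_mod_cast hN
  rcases lt_trichotomy x 0 with h | h | h
  · rw [Real.sign_of_neg h, Real.sign_of_neg (div_neg_of_neg_of_pos h hN')]
  · simp [h]
  · rw [Real.sign_of_pos h, Real.sign_of_pos (div_pos h hN')]

lemma iota_scaled {N : ℕ} (hN : 0 < N) (ξ : ℝ) (u : ℂ) : iota ((ξ : ℂ) + u / N) = iota u := by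
  rw [iota, iota, im_scaled, sign_div_natCast hN]

lemma conj_scaled (N : ℕ) (ξ : ℝ) (u : ℂ) : conj ((ξ : ℂ) + u / N) = (ξ : ℂ) + conj u / N := by
  simp

lemma chiReal_scaled {N : ℕ} (hN : 0 < N) (ξ : ℝ) (u : ℂ) :
    chiReal ((ξ : ℂ) + u / N) = chiReal u := by
  simp only [chiReal, im_scaled_eq_zero hN]

lemma sgnDiff_scaled {N : ℕ} (hN : 0 < N) (ξ : ℝ) (u v : ℂ) :
    sgnDiff ((ξ : ℂ) + u / N) ((ξ : ℂ) + v / N) = sgnDiff u v := by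
  simp only [sgnDiff, im_scaled_eq_zero hN]
  have : ((ξ : ℂ) + u / N).re - ((ξ : ℂ) + v / N).re = (u.re - v.re) / N := by
    simp; ring
  rw [this, sign_div_natCast hN]

/-- On the real line `ε f` is a primitive of `-f`, so it is determined by its explicitly known value
at the edge `ξ` and a local integral over the scaled variable. -/
lemma eps_scaled {s : ℝ≥0∞} {N : ℕ} (hN : (N : ℝ≥0∞) < s) (hpos : 0 < N) {p : ℝ[X]}
    (hp : p.degree < N) (ξ x : ℝ) :
    eps (weighted s p) ((ξ : ℂ) + (x : ℂ) / N) = eps (weighted s p) (ξ : ℂ)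
      - ∫ y in (0 : ℝ)..x, 1 / (N : ℂ) * weighted s p ((ξ : ℂ) + (y : ℂ) / N) := by
  have hN0 : (N : ℝ) ≠ 0 := by positivity
  have e : ∀ y : ℝ, (ξ : ℂ) + (y : ℂ) / N = ((ξ + y / N : ℝ) : ℂ) := by intro y; push_cast; ring
  simp only [e, eps_ofReal, weighted_ofReal]
  rw [intervalIntegral.integral_const_mul]
  have h1 := signInt_sub (integrable_realWeighted hN hp) ξ (ξ + x / N)
  have h2 := intervalIntegral.integral_comp_add_div (a := 0) (b := x)
    (fun y => ((realWeighted s p y : ℝ) : ℂ)) hN0 ξ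
  rw [h2, zero_div, add_zero, intervalIntegral.integral_ofReal, Complex.real_smul]
  have h3 : signInt (realWeighted s p) (ξ + x / N) = signInt (realWeighted s p) ξ
    - 2 * ∫ y in ξ..ξ + x / N, realWeighted s p y := by linarith
  rw [h3]
  have hN0' : (N : ℂ) ≠ 0 := by exact_mod_cast hN0
  push_cast
  field_simp

lemma intervalIntegrable_weighted_scaled (s : ℝ≥0∞) (N : ℕ) (p : ℝ[X]) (ξ a b : ℝ) :
    IntervalIntegrable (fun y : ℝ => weighted s p ((ξ : ℂ) + (y : ℂ) / N)) volume a b := by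
  have hc : Continuous fun y : ℝ => Polynomial.aeval ((ξ : ℂ) + (y : ℂ) / N) p :=
    p.continuous_aeval.comp (by fun_prop)
  have hm : Measurable fun y : ℝ => ((weight s ((ξ : ℂ) + (y : ℂ) / N) : ℝ) : ℂ) :=
    Complex.measurable_ofReal.comp ((measurable_weight s).comp
      (by fun_prop : Continuous fun y : ℝ => (ξ : ℂ) + (y : ℂ) / N).measurable)
  have h1 := hc.intervalIntegrable (μ := volume) a b
  rw [intervalIntegrable_iff] at h1 ⊢
  refine h1.bdd_mul (c := 1) hm.aestronglyMeasurable (ae_of_all _ fun y => ?_)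
  rw [Complex.norm_real, Real.norm_of_nonneg (weight_nonneg _ _)]
  exact weight_le_one _ _

section Scaled

variable {s : ℝ≥0∞} {N : ℕ} {π : ℕ → ℝ[X]} {ξ : ℝ}

lemma scaled_weighted (h : IsSkewOrthonormal s N π) (hN : (N : ℝ≥0∞) < s) (hpos : 0 < N)
    (u v : ℂ) :
    kernelEntry N (fun n => lineIntegral s (π n)) (fun n => weighted s (π n) ((ξ : ℂ) + u / N))
      (fun n => weighted s (π n) ((ξ : ℂ) + v / N)) 0 0
      = N ^ 2 * (scaledWeight s N ξ u * scaledWeight s N ξ v * scaledPoly (invExp s) N ξ u v) := by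
  have : (N : ℂ) ≠ 0 := by exact_mod_cast hpos.ne'
  rw [h.kernelEntry_weighted hN, scaledPoly, scaledWeight, scaledWeight]
  field_simp

lemma scaled_eps_right (h : IsSkewOrthonormal s N π) (hN : (N : ℝ≥0∞) < s) (hpos : 0 < N)
    (hξ : ξ = 1 ∨ ξ = -1) (u : ℂ) (x : ℝ) :
    kernelEntry N (fun n => lineIntegral s (π n)) (fun n => weighted s (π n) ((ξ : ℂ) + u / N))
      (fun n => eps (weighted s (π n)) ((ξ : ℂ) + (x : ℂ) / N)) 0 1
      = N * modelEdge (scaledWeight s N ξ) (scaledPoly (invExp s) N ξ)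
        (scaledEdge (invExp s) N ξ) u x := by
  have hN0 : (N : ℂ) ≠ 0 := by exact_mod_cast hpos.ne'
  rw [kernelEntry_congr _ _ _ (fun n _ => rfl)
    (fun n hn => eps_scaled hN hpos (h.degree_lt hn) ξ x),
    kernelEntry_sub_integral _ _ _ _ _ _
      (fun n => (intervalIntegrable_weighted_scaled s N (π n) ξ 0 x).const_mul _),
    h.kernelEntry_eps_edge hN _ hξ]
  simp only [kernelEntry_smul_right, scaled_weighted h hN hpos]
  rw [modelEdge, segInt_ofReal, scaledEdge, ← scaledWeight, mul_sub, mul_sub,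
    ← intervalIntegral.integral_const_mul, ← intervalIntegral.integral_const_mul]
  congr 1
  · field_simp
  · congr 1
    ext y
    field_simp

/-- The second and then the first argument are moved to the edge `ξ`, each move producing one
integral. The constant left at `(ξ, ξ)` vanishes by antisymmetry. -/
lemma scaled_eps_eps (h : IsSkewOrthonormal s N π) (hN : (N : ℝ≥0∞) < s) (hpos : 0 < N)
    (hξ : ξ = 1 ∨ ξ = -1) (x y : ℝ) :
    kernelEntry N (fun n => lineIntegral s (π n))
      (fun n => eps (weighted s (π n)) ((ξ : ℂ) + (x : ℂ) / N))
      (fun n => eps (weighted s (π n)) ((ξ : ℂ) + (y : ℂ) / N)) 1 1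
      = modelReal (scaledWeight s N ξ) (scaledPoly (invExp s) N ξ)
        (scaledEdge (invExp s) N ξ) x y := by
  have hN0 : (N : ℂ) ≠ 0 := by exact_mod_cast hpos.ne'
  set σ : ℕ → ℂ := fun n => lineIntegral s (π n) with hσ
  set e : ℂ → ℕ → ℂ := fun w n => eps (weighted s (π n)) w with he
  have key : ∀ (f : ℕ → ℂ) (y : ℝ), kernelEntry N σ f (e ((ξ : ℂ) + (y : ℂ) / N)) 1 1
      = kernelEntry N σ f (e ξ) 1 1 + ∫ r in (0 : ℝ)..y, 1 / (N : ℂ) *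
        kernelEntry N σ (fun n => weighted s (π n) ((ξ : ℂ) + (r : ℂ) / N)) f 0 1 := by
    intro f y
    rw [kernelEntry_congr _ _ _ (fun n _ => rfl)
      (fun n hn => eps_scaled hN hpos (h.degree_lt hn) ξ y),
      kernelEntry_sub_integral _ _ _ _ _ _
        (fun n => (intervalIntegrable_weighted_scaled s N (π n) ξ 0 y).const_mul _), sub_eq_add_neg,
      ← intervalIntegral.integral_neg]
    congr 2
    ext r
    rw [kernelEntry_smul_right, kernelEntry_neg_swap]
    ring
  have hself : kernelEntry N σ (e ξ) (e ξ) 1 1 = 0 := by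
    have := kernelEntry_neg_swap N σ (e ξ) (e ξ) 1 1
    linear_combination this / 2
  have h1 := key (e ((ξ : ℂ) + (x : ℂ) / N)) y
  rw [kernelEntry_neg_swap N σ _ (e ξ), key (e ξ) x, hself, zero_add] at h1
  change kernelEntry N σ (e ((ξ : ℂ) + (x : ℂ) / N)) (e ((ξ : ℂ) + (y : ℂ) / N)) 1 1 = _
  rw [h1, modelReal, segInt_ofReal, segInt_ofReal, add_comm, ← sub_eq_add_neg]
  congr 1
  · congr 1
    ext r
    rw [scaled_eps_right h hN hpos hξ]
    field_simp
  · congr 1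
    ext r
    rw [h.kernelEntry_eps_edge hN _ hξ, scaledEdge, scaledWeight]
    field_simp

/-- The scaled kernel in terms of its ingredients. -/
lemma scaledKernel_apply (h : IsSkewOrthonormal s N π) (hN : (N : ℝ≥0∞) < s) (hpos : 0 < N)
    (hξ : ξ = 1 ∨ ξ = -1) (u v : ℂ) (i j : Fin 2) :
    scaledKernel s N π ξ u v i j = modelEntry (scaledWeight s N ξ) (scaledPoly (invExp s) N ξ)
      (scaledEdge (invExp s) N ξ) i j u v := by
  have hN0 : (N : ℂ) ≠ 0 := by exact_mod_cast hpos.ne'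
  have hreal : ∀ w : ℂ, w.im = 0 → w = (w.re : ℂ) := fun w hw => Complex.ext rfl (by simp [hw])
  have heps : ∀ w : ℂ, w.im ≠ 0 → (fun n => eps (weighted s (π n)) ((ξ : ℂ) + w / N))
      = fun n => iota w * weighted s (π n) ((ξ : ℂ) + conj w / N) := by
    intro w hw
    ext n
    rw [eps, if_neg (mt (im_scaled_eq_zero hpos ξ w).1 hw), iota_scaled hpos, conj_scaled]
  have hchi : ∀ w : ℂ, w.im ≠ 0 → chiReal w = 0 := fun w hw => if_neg hw
  have hchi' : ∀ w : ℂ, w.im = 0 → chiReal w = 1 := fun w hw => if_pos hw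
  simp only [scaledKernel, kernel, scaleBlock, chiReal_scaled hpos, sgnDiff_scaled hpos]
  rw [Matrix.mul_apply]
  simp only [Fin.sum_univ_two, Matrix.mul_apply]
  have A := fun u v => scaled_weighted (ξ := ξ) h hN hpos u v
  have B := fun u x => scaled_eps_right h hN hpos hξ u x
  have B' : ∀ (v : ℂ) (x : ℝ), kernelEntry N (fun n => lineIntegral s (π n))
      (fun n => eps (weighted s (π n)) ((ξ : ℂ) + (x : ℂ) / N))
      (fun n => weighted s (π n) ((ξ : ℂ) + v / N)) 1 0
      = -(N * modelEdge (scaledWeight s N ξ) (scaledPoly (invExp s) N ξ)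
        (scaledEdge (invExp s) N ξ) v x) := by
    intro v x
    rw [kernelEntry_neg_swap, B]
  have C := fun x y => scaled_eps_eps h hN hpos hξ x y
  by_cases hu : u.im = 0 <;> by_cases hv : v.im = 0
  · obtain ⟨x, rfl⟩ : ∃ x : ℝ, u = x := ⟨_, hreal u hu⟩
    obtain ⟨y, rfl⟩ : ∃ y : ℝ, v = y := ⟨_, hreal v hv⟩
    fin_cases i <;> fin_cases j <;>
    simp [modelEntry, reflFactor, reflPoint, hchi', A, B, B', C] <;> field_simp
  · obtain ⟨x, rfl⟩ : ∃ x : ℝ, u = x := ⟨_, hreal u hu⟩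
    have hs : sgnDiff x v = 0 := if_neg fun hh => hv hh.2
    fin_cases i <;> fin_cases j <;>
    simp [modelEntry, reflFactor, reflPoint, hchi', hchi v hv, A, B', hv, heps v hv,
      kernelEntry_smul_right, hs] <;> field_simp
  · obtain ⟨y, rfl⟩ : ∃ y : ℝ, v = y := ⟨_, hreal v hv⟩
    have hs : sgnDiff u y = 0 := if_neg fun hh => hu hh.1
    fin_cases i <;> fin_cases j <;>
    simp [modelEntry, reflFactor, reflPoint, hchi', hchi u hu, A, B, hu, heps u hu,
      kernelEntry_smul_left, hs] <;> field_simp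
  · have hs : sgnDiff u v = 0 := if_neg fun hh => hu hh.1
    fin_cases i <;> fin_cases j <;>
    simp [modelEntry, reflFactor, reflPoint, hchi u hu, hchi v hv, A, hu, hv, heps u hu, heps v hv,
      kernelEntry_smul_left, kernelEntry_smul_right, hs] <;> field_simp

end Scaled

/-! ### Exponential generating functions and the Kummer function -/

/-- The exponential generating function of a sequence. -/
def expSeries (a : ℕ → ℝ) (z : ℂ) : ℂ := ∑' n : ℕ, (a n : ℂ) * (z ^ n / (n.factorial : ℂ))

lemma summable_expSeries_bound (C R : ℝ) :
    Summable fun n : ℕ => C * 2 ^ n * (R ^ n / (n.factorial : ℝ)) := by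
  have := (Real.summable_pow_div_factorial (2 * R)).mul_left C
  refine this.congr fun n => ?_
  rw [mul_pow]; ring

lemma norm_expSeries_term_le {a : ℕ → ℝ} {C : ℝ} (ha : ∀ n, |a n| ≤ C * 2 ^ n) {z : ℂ} {R : ℝ}
    (hz : ‖z‖ ≤ R) (n : ℕ) :
    ‖(a n : ℂ) * (z ^ n / (n.factorial : ℂ))‖ ≤ C * 2 ^ n * (R ^ n / (n.factorial : ℝ)) := by
  rw [norm_mul, norm_div, norm_pow, Complex.norm_real, Complex.norm_natCast, Real.norm_eq_abs]
  have := (abs_nonneg _).trans (ha n)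
  gcongr
  exact ha n

lemma summable_expSeries {a : ℕ → ℝ} {C : ℝ} (ha : ∀ n, |a n| ≤ C * 2 ^ n) (z : ℂ) :
    Summable fun n : ℕ => (a n : ℂ) * (z ^ n / (n.factorial : ℂ)) :=
  Summable.of_norm_bounded (summable_expSeries_bound C ‖z‖)
    (norm_expSeries_term_le ha le_rfl)

/-- Termwise differentiation on a ball; dividing by factorials makes differentiation a shift of the
coefficient sequence. -/
lemma hasDerivAt_expSeries {a : ℕ → ℝ} {C : ℝ} (ha : ∀ n, |a n| ≤ C * 2 ^ n) (z : ℂ) :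
    HasDerivAt (expSeries a) (expSeries (fun n => a (n + 1)) z) z := by
  set R := ‖z‖ + 1 with hR
  have hR0 : 0 ≤ R := by positivity
  have ha' : ∀ n, |a (n + 1)| ≤ (2 * C) * 2 ^ n := fun n => by
    rw [mul_comm 2 C, mul_assoc, ← pow_succ']; exact ha (n + 1)
  set g' : ℕ → ℂ → ℂ := fun n w => (a n : ℂ) * (n * w ^ (n - 1) / (n.factorial : ℂ)) with hg'
  have hsucc : ∀ n w, g' (n + 1) w = (a (n + 1) : ℂ) * (w ^ n / (n.factorial : ℂ)) := by
    intro n w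
    simp only [hg', Nat.add_sub_cancel, Nat.factorial_succ]
    have h1 : ((n + 1 : ℕ) : ℂ) ≠ 0 := by exact_mod_cast n.succ_ne_zero
    have h2 : (n.factorial : ℂ) ≠ 0 := by exact_mod_cast n.factorial_ne_zero
    push_cast at h1 ⊢
    field_simp
  set u : ℕ → ℝ := fun n => match n with
    | 0 => 0
    | n + 1 => 2 * C * 2 ^ n * (R ^ n / (n.factorial : ℝ)) with hu
  have hus : Summable u := (summable_nat_add_iff 1).1 (summable_expSeries_bound (2 * C) R)
  have key := hasDerivAt_tsum_of_isPreconnected hus (t := Metric.ball (0 : ℂ) R) Metric.isOpen_ball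
    (convex_ball (0 : ℂ) R).isPreconnected
    (g := fun n w => (a n : ℂ) * (w ^ n / (n.factorial : ℂ))) (g' := g')
    (fun n w _ => ((hasDerivAt_pow n w).div_const _).const_mul _)
    (fun n w hw => by
      have hw' : ‖w‖ ≤ R := (mem_ball_zero_iff.1 hw).le
      cases n with
      | zero => simp [hg', hu]
      | succ n =>
        rw [hsucc]
        exact norm_expSeries_term_le ha' hw' n)
    (Metric.mem_ball_self (by positivity)) (summable_expSeries ha 0)
    (y := z) (mem_ball_zero_iff.2 (by rw [hR]; linarith))
  have h1 : ∑' n, g' n z = expSeries (fun n => a (n + 1)) z := by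
    have hs : Summable fun n => g' n z := by
      rw [← summable_nat_add_iff 1]
      simp only [hsucc]
      exact summable_expSeries ha' z
    rw [hs.tsum_eq_zero_add]
    simp only [hsucc]
    simp [hg', expSeries]
  rw [h1] at key
  exact key

lemma abs_risingCoeff_three_halves_le (n : ℕ) : |risingCoeff (3 / 2) n| ≤ 1 * 2 ^ n := by
  rw [abs_of_pos (risingCoeff_pos (by norm_num) n), one_mul, risingCoeff]
  refine (Finset.prod_le_prod (fun i _ => by positivity) (g := fun _ => (2 : ℝ)) fun i _ => ?_).trans
    (by simp)
  rw [div_le_iff₀ (by positivity)]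
  have : (0 : ℝ) ≤ i := by positivity
  linarith

lemma abs_risingCoeff_three_halves_succ_le (n : ℕ) :
    |risingCoeff (3 / 2) (n + 1)| ≤ 2 * 2 ^ n := by
  have := abs_risingCoeff_three_halves_le (n + 1)
  rwa [one_mul, pow_succ'] at this

lemma Gamma_div_eq_risingCoeff (n : ℕ) :
    Real.Gamma (n + 3 / 2) / Real.Gamma (n + 1) = Real.Gamma (3 / 2) * risingCoeff (3 / 2) n := by
  induction n with
  | zero => simp
  | succ n ih =>
    have h1 : ((n + 1 : ℕ) : ℝ) + 3 / 2 = (n + 3 / 2) + 1 := by push_cast; ring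
    have h2 : ((n + 1 : ℕ) : ℝ) + 1 = (n + 1) + 1 := by push_cast; ring
    rw [h1, h2, Real.Gamma_add_one (by positivity), Real.Gamma_add_one (by positivity),
      mul_div_mul_comm, ih, risingCoeff_succ]
    ring

lemma kummerM_eq (z : ℂ) : kummerM z = expSeries (risingCoeff (3 / 2)) z := by
  have h0 : (Real.Gamma (3 / 2) : ℂ) ≠ 0 := by
    exact_mod_cast (Real.Gamma_pos_of_pos (by norm_num : (0 : ℝ) < 3 / 2)).ne'
  rw [kummerM, expSeries, ← tsum_mul_left]
  refine tsum_congr fun n => ?_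
  have : (Real.Gamma (n + 3 / 2) : ℂ) / (Real.Gamma (n + 1) : ℂ)
      = (Real.Gamma (3 / 2) : ℂ) * (risingCoeff (3 / 2) n : ℂ) := by
    exact_mod_cast Gamma_div_eq_risingCoeff n
  rw [this]
  field_simp

lemma deriv_kummerM (z : ℂ) :
    deriv kummerM z = expSeries (fun n => risingCoeff (3 / 2) (n + 1)) z := by
  rw [show kummerM = expSeries (risingCoeff (3 / 2)) from funext kummerM_eq]
  exact (hasDerivAt_expSeries abs_risingCoeff_three_halves_le z).deriv

lemma continuous_kummerM : Continuous kummerM := by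
  rw [show kummerM = expSeries (risingCoeff (3 / 2)) from funext kummerM_eq]
  exact continuous_iff_continuousAt.2 fun z =>
    (hasDerivAt_expSeries abs_risingCoeff_three_halves_le z).continuousAt

lemma continuous_deriv_kummerM : Continuous (deriv kummerM) := by
  rw [show deriv kummerM = expSeries (fun n => risingCoeff (3 / 2) (n + 1)) from
    funext deriv_kummerM]
  exact continuous_iff_continuousAt.2 fun z =>
    (hasDerivAt_expSeries abs_risingCoeff_three_halves_succ_le z).continuousAt

/-! ### The ingredients of the limiting kernel -/

/-- The limit of the scaled weights. -/
def limWeight (lam ξ : ℝ) (u : ℂ) : ℝ := omega lam (u * ξ)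

/-- The limiting scalar kernel without the weights. -/
def limPoly (lam ξ : ℝ) (u v : ℂ) : ℂ :=
  (ξ : ℂ) / 4 * ∫ τ in (0 : ℝ)..1, (τ : ℂ) * (1 - (lam : ℂ) * τ) *
    (deriv kummerM (u * ξ * τ) * kummerM (v * ξ * τ)
      - kummerM (u * ξ * τ) * deriv kummerM (v * ξ * τ))

/-- The integrand of the correction terms without the weight. -/
def limEdge (lam ξ : ℝ) (u : ℂ) : ℂ :=
  1 / 4 * ∫ τ in (0 : ℝ)..1, (1 - (lam : ℂ) * τ) * kummerM (u * ξ * τ)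

lemma kappa_eq (lam ξ : ℝ) (u v : ℂ) :
    kappa lam ξ u v = limWeight lam ξ u * limWeight lam ξ v * limPoly lam ξ u v := by
  simp only [kappa, limWeight, limPoly, mul_assoc]

lemma corrFun_eq (lam ξ : ℝ) (u : ℂ) :
    corrFun lam ξ u = limWeight lam ξ u * limEdge lam ξ u := by
  simp only [corrFun, limWeight, limEdge]
  ring

lemma limPoly_swap (lam ξ : ℝ) (u v : ℂ) : limPoly lam ξ u v = -limPoly lam ξ v u := by
  rw [limPoly, limPoly, ← mul_neg, ← intervalIntegral.integral_neg]
  congr 2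
  ext τ
  ring

lemma continuous_limPoly (lam ξ : ℝ) : Continuous (Function.uncurry (limPoly lam ξ)) := by
  refine continuous_const.mul
    (intervalIntegral.continuous_parametric_intervalIntegral_of_continuous' ?_ 0 1)
  have h1 := continuous_kummerM
  have h2 := continuous_deriv_kummerM
  simp only [Function.uncurry_def]
  fun_prop

lemma continuous_limEdge (lam ξ : ℝ) : Continuous (limEdge lam ξ) := by
  refine continuous_const.mul
    (intervalIntegral.continuous_parametric_intervalIntegral_of_continuous' ?_ 0 1)
  have h1 := continuous_kummerM
  simp only [Function.uncurry_def]
  fun_prop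

lemma omega_nonneg (lam : ℝ) (τ : ℂ) : 0 ≤ omega lam τ := by
  unfold omega; split_ifs <;> positivity

lemma omega_le_one (lam : ℝ) (τ : ℂ) : omega lam τ ≤ 1 := by
  unfold omega
  split_ifs
  · exact le_rfl
  · exact zero_le_one
  · exact min_le_left _ _

lemma measurable_omega (lam : ℝ) : Measurable (omega lam) := by
  unfold omega
  split_ifs
  · exact Measurable.ite (measurableSet_le Complex.measurable_re measurable_const) measurable_const
      measurable_const
  · fun_prop

lemma continuousAt_omega {lam : ℝ} {τ : ℂ} (h : lam ≠ 0 ∨ τ.re ≠ 0) :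
    ContinuousAt (omega lam) τ := by
  by_cases h0 : lam = 0
  · have hτ := h.resolve_left (not_not.2 h0)
    have e : omega lam = fun τ => if τ.re ≤ 0 then 1 else 0 := by
      ext τ; rw [omega, if_pos h0]
    rw [e]
    rcases lt_or_gt_of_ne hτ with hτ | hτ
    · have : ∀ᶠ w : ℂ in 𝓝 τ, w.re < 0 :=
        Complex.continuous_re.continuousAt.eventually (gt_mem_nhds hτ)
      refine (continuousAt_const (y := (1 : ℝ))).congr ?_
      filter_upwards [this] with w hw
      rw [if_pos hw.le]
    · have : ∀ᶠ w : ℂ in 𝓝 τ, 0 < w.re :=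
        Complex.continuous_re.continuousAt.eventually (lt_mem_nhds hτ)
      refine (continuousAt_const (y := (0 : ℝ))).congr ?_
      filter_upwards [this] with w hw
      rw [if_neg (not_le.2 hw)]
  · have e : omega lam = fun τ => min 1 (Real.exp (-τ.re / lam)) := by
      ext τ; rw [omega, if_neg h0]
    rw [e]
    fun_prop

lemma measurable_limWeight (lam ξ : ℝ) : Measurable (limWeight lam ξ) :=
  (measurable_omega lam).comp (by fun_prop : Continuous fun u : ℂ => u * ξ).measurable

lemma continuousAt_limWeight {lam ξ : ℝ} (hξ : ξ ≠ 0) {u : ℂ} (h : lam ≠ 0 ∨ u.re ≠ 0) :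
    ContinuousAt (limWeight lam ξ) u := by
  have h1 : ContinuousAt (omega lam) (u * ξ) :=
    continuousAt_omega (h.imp_right fun hu => by simp [hu, hξ])
  exact ContinuousAt.comp (f := fun u : ℂ => u * ξ) h1 (by fun_prop)

/-! ### Integrals along segments -/

/-- A measurable weight with values in the unit interval. -/
structure IsUnitWeight (ω : ℂ → ℝ) : Prop where
  measurable : Measurable ω
  nonneg : ∀ u, 0 ≤ ω u
  le_one : ∀ u, ω u ≤ 1

lemma isUnitWeight_limWeight (lam ξ : ℝ) : IsUnitWeight (limWeight lam ξ) :=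
  ⟨measurable_limWeight lam ξ, fun _ => omega_nonneg _ _, fun _ => omega_le_one _ _⟩

lemma IsUnitWeight.norm_le_one {ω : ℂ → ℝ} (h : IsUnitWeight ω) (u : ℂ) : ‖(ω u : ℂ)‖ ≤ 1 := by
  rw [Complex.norm_real, Real.norm_of_nonneg (h.nonneg u)]
  exact h.le_one u

lemma IsUnitWeight.measurable_coe {ω : ℂ → ℝ} (h : IsUnitWeight ω) :
    Measurable fun u => (ω u : ℂ) := Complex.measurable_ofReal.comp h.measurable

lemma IsUnitWeight.intervalIntegrable {ω : ℂ → ℝ} (h : IsUnitWeight ω) {f : ℝ → ℂ}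
    (hf : Continuous f) {g : ℝ → ℂ} (hg : Continuous g) (a b : ℝ) :
    IntervalIntegrable (fun x => (ω (g x) : ℂ) * f x) volume a b := by
  have h1 := hf.intervalIntegrable (μ := volume) a b
  rw [intervalIntegrable_iff] at h1 ⊢
  exact h1.bdd_mul (c := 1) (h.measurable_coe.comp hg.measurable).aestronglyMeasurable
    (ae_of_all _ fun y => h.norm_le_one _)

/-- The weight, possibly discontinuous, depends on the integration variable only, so dominated
convergence needs continuity of `S` alone. -/
lemma continuous_segInt_weighted {ω : ℂ → ℝ} (h : IsUnitWeight ω) {S : ℂ → ℂ → ℂ}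
    (hS : Continuous (Function.uncurry S)) (x : ℂ) :
    Continuous fun u => segInt (fun y => ω y * S u y) x := by
  unfold segInt
  refine continuous_const.mul (continuous_iff_continuousAt.2 fun u₀ => ?_)
  have hc : Continuous fun p : ℂ × ℝ => S p.1 ((p.2 : ℂ) * x) :=
    hS.comp (by fun_prop : Continuous fun p : ℂ × ℝ => (p.1, (p.2 : ℂ) * x))
  obtain ⟨C, hC⟩ := ((isCompact_closedBall u₀ 1).prod isCompact_Icc).exists_bound_of_continuousOn
    (s := Metric.closedBall u₀ 1 ×ˢ Set.Icc (0 : ℝ) 1) hc.continuousOn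
  refine intervalIntegral.continuousAt_of_dominated_interval (bound := fun _ => C) ?_ ?_
    intervalIntegrable_const ?_
  · refine Eventually.of_forall fun u => Measurable.aestronglyMeasurable ?_
    exact (h.measurable_coe.comp (by fun_prop : Continuous fun t : ℝ => (t : ℂ) * x).measurable).mul
      (hc.comp (by fun_prop : Continuous fun t : ℝ => (u, t))).measurable
  · filter_upwards [Metric.closedBall_mem_nhds u₀ one_pos] with u hu
    refine ae_of_all _ fun t ht => ?_
    rw [Set.uIoc_of_le zero_le_one] at ht
    have h1 := hC (u, t) ⟨hu, ht.1.le, ht.2⟩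
    rw [norm_mul]
    calc _ ≤ 1 * C := mul_le_mul (h.norm_le_one _) h1 (norm_nonneg _) zero_le_one
      _ = C := one_mul C
  · refine ae_of_all _ fun t _ => ?_
    exact (continuous_const.mul (hc.comp
      (by fun_prop : Continuous fun u : ℂ => (u, t)))).continuousAt

lemma segInt_ofReal_mul (f : ℂ → ℂ) (r : ℝ) (d : ℂ) :
    segInt f (r * d) = d * ∫ x in (0 : ℝ)..r, f (x * d) := by
  have := intervalIntegral.smul_integral_comp_mul_right (a := 0) (b := 1)
    (fun y : ℝ => f (y * d)) r
  rw [zero_mul, one_mul] at this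
  rw [segInt, ← this, Complex.real_smul]
  have e : ∀ t : ℝ, (t : ℂ) * (r * d) = ((t * r : ℝ) : ℂ) * d := by intro t; push_cast; ring
  simp only [e]
  ring

/-- The parameter of `z` along the line (or ray) of `dir z`. -/
def rayParam (z : ℂ) : ℝ := if z.im = 0 then z.re else 1

lemma rayParam_mul_dir (z : ℂ) : (rayParam z : ℂ) * dir z = z := by
  unfold rayParam dir
  split_ifs with h
  · rw [mul_one]; exact Complex.ext rfl (by simp [h])
  · simp

lemma dir_ne_zero (z : ℂ) : dir z ≠ 0 := by
  unfold dir
  split_ifs with h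
  · exact one_ne_zero
  · rintro rfl; simp at h

/-- Both the real line and the ray through `z` contain the base point `0`. Along them `segInt` is an
ordinary integral with upper limit `rayParam z + t`, and the fundamental theorem of calculus
requires continuity of the integrand at that end point only. -/
lemma hasDerivAt_segInt {ω : ℂ → ℝ} (h : IsUnitWeight ω) {f : ℂ → ℂ} (hf : Continuous f) {z : ℂ}
    (hz : ContinuousAt ω z) :
    HasDerivAt (fun t : ℝ => segInt (fun u => ω u * f u) (z + t * dir z))
      (dir z * (ω z * f z)) 0 := by
  have hline : Continuous fun x : ℝ => (x : ℂ) * dir z := by fun_prop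
  have hrz := rayParam_mul_dir z
  have e : (fun t : ℝ => segInt (fun u => ω u * f u) (z + t * dir z))
      = fun t : ℝ => dir z * ∫ x in (0 : ℝ)..rayParam z + t,
        (ω ((x : ℂ) * dir z) : ℂ) * f ((x : ℂ) * dir z) := by
    ext t
    refine Eq.trans (congrArg _ ?_)
      (segInt_ofReal_mul (fun u => ω u * f u) (rayParam z + t) (dir z))
    push_cast
    rw [add_mul, hrz]
  rw [e]
  refine HasDerivAt.const_mul _ ?_
  have hint := h.intervalIntegrable (hf.comp hline) hline 0 (rayParam z)
  have hmeas : StronglyMeasurableAtFilter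
      (fun x : ℝ => (ω ((x : ℂ) * dir z) : ℂ) * f ((x : ℂ) * dir z)) (𝓝 (rayParam z)) :=
    ((h.measurable_coe.comp hline.measurable).mul
      (hf.comp hline).measurable).stronglyMeasurable.stronglyMeasurableAtFilter
  have hcont : ContinuousAt
      (fun x : ℝ => (ω ((x : ℂ) * dir z) : ℂ) * f ((x : ℂ) * dir z)) (rayParam z) := by
    refine ContinuousAt.mul ?_ (hf.comp hline).continuousAt
    refine Complex.continuous_ofReal.continuousAt.comp ?_
    refine ContinuousAt.comp (g := ω) ?_ hline.continuousAt
    rw [hrz]; exact hz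
  have hd := intervalIntegral.integral_hasDerivAt_right hint hmeas hcont
  simp only [Function.comp_def, hrz] at hd
  have hd' : HasDerivAt (fun r : ℝ => ∫ x in (0 : ℝ)..r,
      (ω ((x : ℂ) * dir z) : ℂ) * f ((x : ℂ) * dir z)) (ω z * f z) (rayParam z + 0) := by
    rw [add_zero]; exact hd
  exact HasDerivAt.comp_const_add (rayParam z) 0 hd'

lemma diffAlong_of_hasDerivAt {f : ℂ → ℂ} {z d : ℂ}
    (h : HasDerivAt (fun t : ℝ => f (z + t * dir z)) (dir z * d) 0) :
    DiffAlong f z ∧ derivAlong f z = d := by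
  refine ⟨h.differentiableAt, ?_⟩
  rw [derivAlong, h.deriv, mul_div_cancel_left₀ _ (dir_ne_zero z)]

lemma segInt_const_mul (c : ℂ) (f : ℂ → ℂ) (x : ℂ) :
    segInt (fun y => c * f y) x = c * segInt f x := by
  rw [segInt, segInt, intervalIntegral.integral_const_mul]; ring

lemma segInt_neg (f : ℂ → ℂ) (x : ℂ) : segInt (fun y => -f y) x = -segInt f x := by
  rw [segInt, segInt, intervalIntegral.integral_neg]; ring

/-! ### The matrix kernel of the function `A` -/

lemma segInt_segInt_swap {ω : ℂ → ℝ} (h : IsUnitWeight ω) {S : ℂ → ℂ → ℂ}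
    (hS : Continuous (Function.uncurry S)) (a b : ℂ) :
    segInt (fun u => segInt (fun v => ω u * ω v * S u v) b) a
      = segInt (fun v => segInt (fun u => ω u * ω v * S u v) a) b := by
  have hc : Continuous fun p : ℝ × ℝ => S ((p.1 : ℂ) * a) ((p.2 : ℂ) * b) :=
    hS.comp (by fun_prop : Continuous fun p : ℝ × ℝ => ((p.1 : ℂ) * a, (p.2 : ℂ) * b))
  have hint : IntegrableOn (Function.uncurry fun t r : ℝ =>
      (ω ((t : ℂ) * a) : ℂ) * ω ((r : ℂ) * b) * S ((t : ℂ) * a) ((r : ℂ) * b))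
      (Set.uIoc 0 1 ×ˢ Set.uIoc 0 1) volume := by
    rw [Measure.volume_eq_prod]
    have h1 : IntegrableOn (fun p : ℝ × ℝ => S ((p.1 : ℂ) * a) ((p.2 : ℂ) * b))
        (Set.uIoc 0 1 ×ˢ Set.uIoc 0 1) (volume.prod volume) := by
      refine (hc.continuousOn.integrableOn_compact
        (K := Set.Icc (0 : ℝ) 1 ×ˢ Set.Icc (0 : ℝ) 1) (isCompact_Icc.prod isCompact_Icc)).mono_set ?_
      rw [Set.uIoc_of_le zero_le_one]
      exact Set.prod_mono Set.Ioc_subset_Icc_self Set.Ioc_subset_Icc_self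
    refine h1.bdd_mul (c := 1) (f := fun p : ℝ × ℝ => (ω ((p.1 : ℂ) * a) : ℂ) * ω ((p.2 : ℂ) * b))
      ?_ (ae_of_all _ fun p => ?_)
    · refine Measurable.aestronglyMeasurable ?_
      exact (h.measurable_coe.comp
          (by fun_prop : Continuous fun p : ℝ × ℝ => (p.1 : ℂ) * a).measurable).mul
        (h.measurable_coe.comp
          (by fun_prop : Continuous fun p : ℝ × ℝ => (p.2 : ℂ) * b).measurable)
    · rw [norm_mul]
      exact mul_le_one₀ (h.norm_le_one _) (norm_nonneg _) (h.norm_le_one _)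
  have key := intervalIntegral_intervalIntegral_swap hint
  simp only [segInt, intervalIntegral.integral_const_mul]
  rw [key]
  ring

section

variable {lam ξ : ℝ}

lemma segInt_kappa (u b : ℂ) :
    segInt (fun v => kappa lam ξ u v) b
      = limWeight lam ξ u * segInt (fun v => limWeight lam ξ v * limPoly lam ξ u v) b := by
  rw [← segInt_const_mul]
  congr 1
  ext v
  rw [kappa_eq]; ring

/-- Fubini makes the second variable the outer one and antisymmetry of `limPoly` supplies the sign.
The result has the form in which the `ε`-`ε` entry of the finite kernel is written. -/
lemma Afun_eq_modelReal (a b : ℂ) :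
    Afun lam ξ a b = modelReal (limWeight lam ξ) (limPoly lam ξ) (limEdge lam ξ) a b := by
  have h1 := segInt_segInt_swap (isUnitWeight_limWeight lam ξ) (continuous_limPoly lam ξ) a b
  have e1 : (fun u => segInt (fun v => kappa lam ξ u v) b)
      = fun u => segInt (fun v => limWeight lam ξ u * limWeight lam ξ v * limPoly lam ξ u v) b := by
    ext u; congr 1; ext v; rw [kappa_eq]
  have e2 : (fun v => segInt (fun u => limWeight lam ξ u * limWeight lam ξ v * limPoly lam ξ u v) a)
      = fun v => -(limWeight lam ξ v *
        segInt (fun u => limWeight lam ξ u * limPoly lam ξ v u) a) := by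
    ext v
    rw [← segInt_const_mul, ← segInt_neg]
    congr 1
    ext u
    rw [limPoly_swap lam ξ u v]; ring
  have e3 : (corrFun lam ξ) = fun u => limWeight lam ξ u * limEdge lam ξ u :=
    funext fun u => corrFun_eq lam ξ u
  have hω := isUnitWeight_limWeight lam ξ
  have e4 : segInt (fun y => modelEdge (limWeight lam ξ) (limPoly lam ξ) (limEdge lam ξ) y a) b
      = segInt (fun y => limWeight lam ξ y * limEdge lam ξ y) b
        - segInt (fun v => limWeight lam ξ v *
          segInt (fun u => limWeight lam ξ u * limPoly lam ξ v u) a) b := by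
    simp only [modelEdge, segInt, mul_sub]
    rw [intervalIntegral.integral_sub]
    · ring
    · exact hω.intervalIntegrable ((continuous_limEdge lam ξ).comp (by fun_prop)) (by fun_prop) 0 1
    · have h2 := (continuous_segInt_weighted hω (continuous_limPoly lam ξ) a)
      unfold segInt at h2
      exact hω.intervalIntegrable (f := fun x : ℝ => a * ∫ t in (0 : ℝ)..1,
        (limWeight lam ξ (t * a) : ℂ) * limPoly lam ξ (x * b) (t * a))
        (h2.comp (by fun_prop : Continuous fun x : ℝ => (x : ℂ) * b)) (by fun_prop) 0 1
  rw [Afun, e1, h1, e2, e3, modelReal, e4, segInt_neg]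
  ring

lemma hasDerivAt_Afun_right (hξ : ξ ≠ 0) (u : ℂ) {v : ℂ} (hv : lam ≠ 0 ∨ v.re ≠ 0) :
    HasDerivAt (fun t : ℝ => Afun lam ξ u (v + t * dir v))
      (dir v * modelEdge (limWeight lam ξ) (limPoly lam ξ) (limEdge lam ξ) v u) 0 := by
  simp only [Afun_eq_modelReal, modelReal, modelEdge]
  refine HasDerivAt.sub_const _ ?_
  exact hasDerivAt_segInt (isUnitWeight_limWeight lam ξ)
    ((continuous_limEdge lam ξ).sub (continuous_segInt_weighted (isUnitWeight_limWeight lam ξ)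
      (continuous_limPoly lam ξ) u)) (continuousAt_limWeight hξ hv)

/-- In the defining order of integration the first variable is the outer one, so no interchange is
needed here. -/
lemma hasDerivAt_Afun_left (hξ : ξ ≠ 0) (v : ℂ) {u : ℂ} (hu : lam ≠ 0 ∨ u.re ≠ 0) :
    HasDerivAt (fun t : ℝ => Afun lam ξ (u + t * dir u) v)
      (dir u * -modelEdge (limWeight lam ξ) (limPoly lam ξ) (limEdge lam ξ) u v) 0 := by
  have hω := isUnitWeight_limWeight lam ξ
  have e3 : (corrFun lam ξ) = fun u => limWeight lam ξ u * limEdge lam ξ u :=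
    funext fun u => corrFun_eq lam ξ u
  have h1 := hasDerivAt_segInt hω (continuous_segInt_weighted hω (continuous_limPoly lam ξ) v)
    (continuousAt_limWeight hξ hu)
  have h2 := hasDerivAt_segInt hω (continuous_limEdge lam ξ) (continuousAt_limWeight hξ hu)
  have h3 := h1.add ((h2.neg).const_add
    (segInt (fun u => limWeight lam ξ u * limEdge lam ξ u) v))
  simp only [Afun, segInt_kappa, e3]
  convert! h3 using 1
  rw [modelEdge]; ring

lemma DL_Afun (hξ : ξ ≠ 0) (v : ℂ) {u : ℂ} (hu : lam ≠ 0 ∨ u.re ≠ 0) :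
    DL (Afun lam ξ) u v = -modelEdge (limWeight lam ξ) (limPoly lam ξ) (limEdge lam ξ) u v :=
  (diffAlong_of_hasDerivAt (f := fun a => Afun lam ξ a v) (hasDerivAt_Afun_left hξ v hu)).2

lemma DR_Afun (hξ : ξ ≠ 0) (u : ℂ) {v : ℂ} (hv : lam ≠ 0 ∨ v.re ≠ 0) :
    DR (Afun lam ξ) u v = modelEdge (limWeight lam ξ) (limPoly lam ξ) (limEdge lam ξ) v u :=
  (diffAlong_of_hasDerivAt (f := fun b => Afun lam ξ u b) (hasDerivAt_Afun_right hξ u hv)).2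

/-- Since `DR` is known explicitly for every first argument, one more application of the fundamental
theorem to its inner integral suffices. -/
lemma diffAlong_DR_Afun (hξ : ξ ≠ 0) {u v : ℂ} (hu : lam ≠ 0 ∨ u.re ≠ 0)
    (hv : lam ≠ 0 ∨ v.re ≠ 0) :
    DiffAlong (fun a => DR (Afun lam ξ) a v) u ∧
      DLR (Afun lam ξ) u v = kappa lam ξ u v := by
  have hω := isUnitWeight_limWeight lam ξ
  have h1 := hasDerivAt_segInt hω
    ((continuous_limPoly lam ξ).comp (by fun_prop : Continuous fun y : ℂ => (v, y)))
    (continuousAt_limWeight hξ hu)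
  have h2 := ((h1.const_sub (limEdge lam ξ v)).const_mul (limWeight lam ξ v : ℂ))
  refine diffAlong_of_hasDerivAt (f := fun a => DR (Afun lam ξ) a v) ?_
  have e : (fun t : ℝ => DR (Afun lam ξ) (u + t * dir u) v) = fun t : ℝ =>
      modelEdge (limWeight lam ξ) (limPoly lam ξ) (limEdge lam ξ) v (u + t * dir u) :=
    funext fun t => DR_Afun hξ _ hv
  simp only [e]
  simp only [modelEdge]
  convert! h2 using 1
  rw [kappa_eq, limPoly_swap lam ξ u v]
  simp only [Function.comp_apply, Function.uncurry_apply_pair]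
  ring

/-- The matrix kernel of `A` in terms of its ingredients. -/
lemma kernelOf_Afun_apply (hξ : ξ ≠ 0) {u v : ℂ} {i j : Fin 2}
    (hu : (lam ≠ 0 ∨ u.re ≠ 0) ∨ (i = 1 ∧ u.im = 0))
    (hv : (lam ≠ 0 ∨ v.re ≠ 0) ∨ (j = 1 ∧ v.im = 0)) :
    kernelOf (Afun lam ξ) u v i j
      = modelEntry (limWeight lam ξ) (limPoly lam ξ) (limEdge lam ξ) i j u v := by
  have hconj : ∀ w : ℂ, (lam ≠ 0 ∨ w.re ≠ 0) → (lam ≠ 0 ∨ (conj w).re ≠ 0) := fun w h => by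
    simpa using h
  by_cases hu0 : u.im = 0 <;> by_cases hv0 : v.im = 0
  · rw [kernelOf, if_pos hu0, if_pos hv0, KRR]
    fin_cases i <;> fin_cases j
    · have hu' : lam ≠ 0 ∨ u.re ≠ 0 := by simpa using hu
      have hv' : lam ≠ 0 ∨ v.re ≠ 0 := by simpa using hv
      simp [modelEntry, reflFactor, reflPoint, (diffAlong_DR_Afun hξ hu' hv').2, kappa_eq]
    · have hu' : lam ≠ 0 ∨ u.re ≠ 0 := by simpa using hu
      simp [modelEntry, reflFactor, reflPoint, hv0, DL_Afun hξ v hu']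
    · have hv' : lam ≠ 0 ∨ v.re ≠ 0 := by simpa using hv
      simp [modelEntry, reflFactor, reflPoint, hu0, DR_Afun hξ u hv']
    · simp [modelEntry, hu0, hv0, Afun_eq_modelReal]
  · have hv' : lam ≠ 0 ∨ v.re ≠ 0 := by simpa [hv0] using hv
    have hvc := hconj v hv'
    rw [kernelOf, if_pos hu0, if_neg hv0, KCR]
    fin_cases i <;> fin_cases j
    · have hu' : lam ≠ 0 ∨ u.re ≠ 0 := by simpa using hu
      simp [modelEntry, reflFactor, reflPoint, (diffAlong_DR_Afun hξ hv' hu').2, kappa_eq]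
      rw [limPoly_swap]; ring
    · have hu' : lam ≠ 0 ∨ u.re ≠ 0 := by simpa using hu
      simp [modelEntry, reflFactor, reflPoint, hv0, (diffAlong_DR_Afun hξ hvc hu').2, kappa_eq]
      rw [limPoly_swap]; ring
    · simp [modelEntry, reflFactor, reflPoint, hu0, DL_Afun hξ u hv']
    · simp [modelEntry, reflFactor, reflPoint, hu0, hv0, DL_Afun hξ u hvc]
  · have hu' : lam ≠ 0 ∨ u.re ≠ 0 := by simpa [hu0] using hu
    have huc := hconj u hu'
    rw [kernelOf, if_neg hu0, if_pos hv0, KCR]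
    fin_cases i <;> fin_cases j
    · have hv' : lam ≠ 0 ∨ v.re ≠ 0 := by simpa using hv
      simp [modelEntry, reflFactor, reflPoint, (diffAlong_DR_Afun hξ hu' hv').2, kappa_eq]
    · simp [modelEntry, reflFactor, reflPoint, hv0, DL_Afun hξ v hu']
    · have hv' : lam ≠ 0 ∨ v.re ≠ 0 := by simpa using hv
      simp [modelEntry, reflFactor, reflPoint, hu0, (diffAlong_DR_Afun hξ huc hv').2, kappa_eq]
    · simp [modelEntry, reflFactor, reflPoint, hu0, hv0, DL_Afun hξ v huc]
  · have hu' : lam ≠ 0 ∨ u.re ≠ 0 := by simpa [hu0] using hu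
    have huc := hconj u hu'
    have hv' : lam ≠ 0 ∨ v.re ≠ 0 := by simpa [hv0] using hv
    have hvc := hconj v hv'
    rw [kernelOf, if_neg hu0, if_neg hv0, KCC]
    fin_cases i <;> fin_cases j <;>
    simp [modelEntry, reflFactor, reflPoint, hu0, hv0, (diffAlong_DR_Afun hξ hu' hv').2,
      (diffAlong_DR_Afun hξ hu' hvc).2, (diffAlong_DR_Afun hξ huc hv').2,
      (diffAlong_DR_Afun hξ huc hvc).2, kappa_eq]

end

/-! ### Riemann sums -/

lemma ae_floor_eq {J : ℕ} (hJ : 0 < J) (k : ℕ) {E : Type*} (f : ℕ → E) :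
    (fun _ : ℝ => f k) =ᵐ[volume.restrict (Set.uIoc ((k : ℝ) / J) ((k + 1 : ℕ) / J))]
      fun τ : ℝ => f ⌊J * τ⌋₊ := by
  have hJ' : (0 : ℝ) < J := by exact_mod_cast hJ
  have hle : (k : ℝ) / J ≤ (k + 1 : ℕ) / J := by
    push_cast; gcongr; linarith
  rw [Set.uIoc_of_le hle, ← Measure.restrict_congr_set Ioo_ae_eq_Ioc]
  filter_upwards [self_mem_ae_restrict measurableSet_Ioo] with τ hτ
  have h1 := (div_lt_iff₀ hJ').1 hτ.1
  have h2 := (lt_div_iff₀ hJ').1 hτ.2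
  have h0 : (0 : ℝ) ≤ J * τ := by
    have : (0 : ℝ) ≤ k := k.cast_nonneg
    linarith
  congr 1
  refine ((Nat.floor_eq_iff h0).2 ⟨?_, ?_⟩).symm
  · linarith
  · push_cast at h2; linarith

lemma integral_floor {J : ℕ} (hJ : 0 < J) (f : ℕ → ℂ) :
    ∫ τ in (0 : ℝ)..1, f ⌊J * τ⌋₊ = (∑ j ∈ Finset.range J, f j) / J := by
  have hJ' : (J : ℝ) ≠ 0 := by positivity
  have hJc : (J : ℂ) ≠ 0 := by exact_mod_cast hJ.ne'
  have h := intervalIntegral.sum_integral_adjacent_intervals (μ := volume)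
    (f := fun τ : ℝ => f ⌊J * τ⌋₊) (a := fun k : ℕ => (k : ℝ) / J) (n := J)
    fun k _ => (intervalIntegrable_const (c := f k)).congr_ae (ae_floor_eq hJ k f)
  simp only [Nat.cast_zero, zero_div, div_self hJ'] at h
  rw [← h, Finset.sum_div]
  refine Finset.sum_congr rfl fun k _ => ?_
  rw [← intervalIntegral.integral_congr_ae_restrict (ae_floor_eq hJ k f),
    intervalIntegral.integral_const, Complex.real_smul]
  push_cast
  field_simp
  ring

/-- The normalized sum is the integral over `[0, 1]` of the step function `τ ↦ f i ⌊J τ⌋₊`, to which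
dominated convergence applies. Pointwise limits along `j ≈ τ J` and a uniform bound are enough. -/
lemma tendsto_riemann_sum {ι : Type*} {F : Filter ι} [F.IsCountablyGenerated] {J : ι → ℕ}
    (hJ : ∀ᶠ i in F, 0 < J i) {f : ι → ℕ → ℂ} {g : ℝ → ℂ} {C : ℝ}
    (hb : ∀ᶠ i in F, ∀ j < J i, ‖f i j‖ ≤ C)
    (hf : ∀ τ ∈ Set.Ioc (0 : ℝ) 1, Tendsto (fun i => f i ⌊J i * τ⌋₊) F (𝓝 (g τ))) :
    Tendsto (fun i => (∑ j ∈ Finset.range (J i), f i j) / J i) F (𝓝 (∫ τ in (0 : ℝ)..1, g τ)) := by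
  have h : Tendsto (fun i => ∫ τ in (0 : ℝ)..1, f i ⌊J i * τ⌋₊) F (𝓝 (∫ τ in (0 : ℝ)..1, g τ)) := by
    refine intervalIntegral.tendsto_integral_filter_of_dominated_convergence (fun _ => C)
      (Eventually.of_forall fun i => ?_) ?_ intervalIntegrable_const (ae_of_all _ fun τ hτ => ?_)
    · refine Measurable.aestronglyMeasurable ?_
      exact (measurable_from_nat (f := f i)).comp
        (Nat.measurable_floor.comp (measurable_const.mul measurable_id))
    · filter_upwards [hb, hJ] with i hi hJi
      -- At `τ = 1` the index would be `J i`, outside the range of the bound.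
      have h1 : ∀ᵐ τ : ℝ, τ ≠ 1 := by simp [ae_iff, measure_singleton]
      filter_upwards [h1] with τ hτ1 hτ
      rw [Set.uIoc_of_le zero_le_one] at hτ
      refine hi _ ?_
      have hJ' : (0 : ℝ) < J i := by exact_mod_cast hJi
      rw [Nat.floor_lt (by have := hτ.1.le; positivity)]
      have := lt_of_le_of_ne hτ.2 hτ1
      nlinarith
    · rw [Set.uIoc_of_le zero_le_one] at hτ
      exact hf τ hτ
  refine h.congr' ?_
  filter_upwards [hJ] with i hi using integral_floor hi _

/-! ### Asymptotics of the polynomials near `± 1` -/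

section Asymptotics

variable {ι : Type*} {F : Filter ι} {N : ι → ℕ}

lemma tendsto_inv_natCast (hN : Tendsto N F atTop) :
    Tendsto (fun i => ((N i : ℝ))⁻¹) F (𝓝 0) :=
  tendsto_inv_atTop_zero.comp (tendsto_natCast_atTop_atTop.comp hN)

lemma tendsto_natCast_sub (hN : Tendsto N F atTop) {a : ι → ℕ} {τ : ℝ}
    (ha : Tendsto (fun i => (a i : ℝ) * (2 / N i)) F (𝓝 τ)) (k : ℕ) :
    Tendsto (fun i => ((a i - k : ℕ) : ℝ) * (2 / N i)) F (𝓝 τ) := by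
  have h1 : Tendsto (fun i => (a i : ℝ) * (2 / N i) - k * (2 * ((N i : ℝ))⁻¹)) F (𝓝 τ) := by
    simpa using ha.sub (((tendsto_inv_natCast hN).const_mul 2).const_mul (k : ℝ))
  refine tendsto_of_tendsto_of_tendsto_of_le_of_le h1 ha (fun i => ?_) fun i => ?_
  · have : (a i : ℝ) - k ≤ ((a i - k : ℕ) : ℝ) := by
      rw [sub_le_iff_le_add]; exact_mod_cast Nat.sub_le_iff_le_add.1 le_rfl
    have h0 : (0 : ℝ) ≤ 2 / N i := by positivity
    calc (a i : ℝ) * (2 / N i) - k * (2 * ((N i : ℝ))⁻¹) = ((a i : ℝ) - k) * (2 / N i) := by ring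
      _ ≤ _ := by gcongr
  · have : ((a i - k : ℕ) : ℝ) ≤ a i := by exact_mod_cast Nat.sub_le _ _
    gcongr

lemma tendsto_choose_mul (hN : Tendsto N F atTop) {a : ι → ℕ} {τ : ℝ}
    (ha : Tendsto (fun i => (a i : ℝ) * (2 / N i)) F (𝓝 τ)) (k : ℕ) :
    Tendsto (fun i => ((a i).choose k : ℝ) * (2 / N i) ^ k) F (𝓝 (τ ^ k / k.factorial)) := by
  induction k with
  | zero => simpa using tendsto_const_nhds
  | succ k ih =>
    have h := (ih.mul (tendsto_natCast_sub hN ha k)).div_const ((k : ℝ) + 1)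
    have hk : (k : ℝ) + 1 ≠ 0 := by positivity
    have e : τ ^ (k + 1) / ((k + 1).factorial : ℝ) = τ ^ k / k.factorial * τ / (k + 1) := by
      rw [Nat.factorial_succ]
      push_cast
      field_simp
      ring
    rw [e]
    refine h.congr fun i => ?_
    have : ((a i).choose (k + 1) : ℝ) * (k + 1) = (a i).choose k * ((a i - k : ℕ) : ℝ) := by
      exact_mod_cast Nat.choose_succ_right_eq (a i) k
    rw [div_eq_iff hk, pow_succ]
    linear_combination (-(2 / (N i : ℝ)) ^ k * (2 / N i)) * this

/-- The binomial coefficient is at most `M ^ (m + e) / m!`, and `M ^ m` is absorbed by `y = O(1 /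
M)`. The resulting majorant does not depend on `n`, so it serves both for limits in `m` and for
bounds uniform in the degree. -/
lemma norm_binomial_term_le {e : ℕ} {n M : ℕ} (hn : n + e ≤ M) {y : ℂ} {C : ℝ}
    (hy : ‖y‖ * M ≤ C) (m : ℕ) :
    ‖(risingCoeff (3 / 2) m : ℂ) * ((n + e).choose (m + e) : ℂ) * y ^ m‖
      ≤ M ^ e * (1 * 2 ^ m * (C ^ m / (m.factorial : ℝ))) := by
  rw [norm_mul, norm_mul, norm_pow, Complex.norm_real, Complex.norm_natCast, Real.norm_eq_abs]
  have h1 : ((n + e).choose (m + e) : ℝ) ≤ M ^ e * M ^ m / m.factorial := by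
    refine (Nat.choose_le_pow_div (α := ℝ) (m + e) (n + e)).trans ?_
    rw [← pow_add, add_comm e m]
    have h2 : (m.factorial : ℝ) ≤ (m + e).factorial := by
      exact_mod_cast Nat.factorial_le (Nat.le_add_right m e)
    have h3 : ((n + e : ℕ) : ℝ) ≤ M := by exact_mod_cast hn
    have h4 : (0 : ℝ) < m.factorial := by positivity
    gcongr
  calc |risingCoeff (3 / 2) m| * ((n + e).choose (m + e) : ℝ) * ‖y‖ ^ m
      ≤ (1 * 2 ^ m) * (M ^ e * M ^ m / m.factorial) * ‖y‖ ^ m := by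
        gcongr
        exact abs_risingCoeff_three_halves_le m
    _ = M ^ e * (1 * 2 ^ m * ((‖y‖ * M) ^ m / (m.factorial : ℝ))) := by
        rw [mul_pow]; ring
    _ ≤ _ := by gcongr

/-- Dominated convergence for series, with `choose · k * (2 / N) ^ k → τ ^ k / k!` in each term. The
cases `e = 0` and `e = 1` are the even polynomials with `b = -1/2` and `b = 1/2`. -/
lemma tendsto_binomial_sum (hN : Tendsto N F atTop) (e : ℕ) {n : ι → ℕ} {τ : ℝ}
    (hn : ∀ᶠ i in F, n i + e ≤ N i)
    (hτ : Tendsto (fun i => (n i : ℝ) * (2 / N i)) F (𝓝 τ)) {y : ι → ℂ} {x : ℂ}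
    (hy : Tendsto (fun i => y i * (N i / 2)) F (𝓝 x)) :
    Tendsto (fun i => (2 / (N i : ℂ)) ^ e * ∑ m ∈ Finset.range (n i + 1),
      (risingCoeff (3 / 2) m : ℂ) * ((n i + e).choose (m + e) : ℂ) * (y i) ^ m) F
      (𝓝 (∑' m : ℕ, (risingCoeff (3 / 2) m : ℂ) * ((τ : ℂ) ^ (m + e) / ((m + e).factorial : ℂ))
        * x ^ m)) := by
  have hpos : ∀ᶠ i in F, 0 < N i := hN.eventually_gt_atTop 0
  have hne : Tendsto (fun i => ((n i + e : ℕ) : ℝ) * (2 / N i)) F (𝓝 τ) := by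
    have := hτ.add (((tendsto_inv_natCast hN).const_mul 2).const_mul (e : ℝ))
    simp only [mul_zero, add_zero] at this
    refine this.congr fun i => ?_
    push_cast; ring
  obtain ⟨C, hC⟩ : ∃ C : ℝ, ∀ᶠ i in F, ‖y i‖ * N i ≤ C := by
    refine ⟨2 * (‖x‖ + 1), ?_⟩
    filter_upwards [hy.norm.eventually_le_const (lt_add_one ‖x‖)] with i hi
    rw [norm_mul, norm_div, Complex.norm_natCast, Complex.norm_two] at hi
    linarith
  have key : Tendsto (fun i => ∑' m : ℕ, (2 / (N i : ℂ)) ^ e *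
      ((risingCoeff (3 / 2) m : ℂ) * ((n i + e).choose (m + e) : ℂ) * (y i) ^ m)) F
      (𝓝 (∑' m : ℕ, (risingCoeff (3 / 2) m : ℂ) * ((τ : ℂ) ^ (m + e) / ((m + e).factorial : ℂ))
        * x ^ m)) := by
    refine tendsto_tsum_of_dominated_convergence
      (bound := fun m => 2 ^ e * (1 * 2 ^ m * (C ^ m / (m.factorial : ℝ))))
      ((summable_expSeries_bound 1 C).mul_left _) (fun m => ?_) ?_
    · have h1 := (Complex.continuous_ofReal.tendsto _).comp (tendsto_choose_mul hN hne (m + e))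
      have h2 := (h1.const_mul (risingCoeff (3 / 2) m : ℂ)).mul (hy.pow m)
      have e1 : ((τ ^ (m + e) / ((m + e).factorial : ℝ) : ℝ) : ℂ)
          = (τ : ℂ) ^ (m + e) / ((m + e).factorial : ℂ) := by push_cast; rfl
      rw [e1] at h2
      refine h2.congr' ?_
      filter_upwards [hpos] with i hi
      have hc : (N i : ℂ) ≠ 0 := by exact_mod_cast hi.ne'
      have e2 : (2 / (N i : ℂ)) ^ m * (N i / 2 : ℂ) ^ m = 1 := by
        rw [← mul_pow]
        have : (2 / (N i : ℂ)) * (N i / 2 : ℂ) = 1 := by field_simp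
        rw [this, one_pow]
      simp only [Function.comp_apply]
      push_cast
      rw [mul_pow, pow_add]
      linear_combination ((risingCoeff (3 / 2) m : ℂ) * ((n i + e).choose (m + e) : ℂ) * y i ^ m
        * (2 / (N i : ℂ)) ^ e) * e2
    · filter_upwards [hC, hn, hpos] with i hi hni hp m
      rw [norm_mul, norm_pow, norm_div, Complex.norm_natCast, Complex.norm_two]
      have hr : (0 : ℝ) < N i := by exact_mod_cast hp
      refine (mul_le_mul_of_nonneg_left (norm_binomial_term_le hni hi m) (by positivity)).trans_eq ?_
      rw [← mul_assoc, ← mul_pow, div_mul_cancel₀ _ hr.ne']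
  refine key.congr fun i => ?_
  rw [tsum_mul_left, tsum_eq_sum (s := Finset.range (n i + 1))]
  intro m hm
  rw [Nat.choose_eq_zero_of_lt (by simp at hm; omega)]
  simp

lemma tsum_risingCoeff_zero (τ : ℝ) (x : ℂ) :
    ∑' m : ℕ, (risingCoeff (3 / 2) m : ℂ) * ((τ : ℂ) ^ (m + 0) / ((m + 0).factorial : ℂ)) * x ^ m
      = kummerM (x * τ) := by
  rw [kummerM_eq, expSeries]
  refine tsum_congr fun m => ?_
  rw [mul_pow, add_zero]; ring

/-- With `c m = (3/2)_m / m!` one has `c (m+1) - c m = c m / (2 (m+1))`; the factor `1 / (m+1)`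
completes `m!` to `(m+1)!`. -/
lemma tsum_risingCoeff_one (τ : ℝ) (x : ℂ) :
    ∑' m : ℕ, (risingCoeff (3 / 2) m : ℂ) * ((τ : ℂ) ^ (m + 1) / ((m + 1).factorial : ℂ)) * x ^ m
      = 2 * τ * (deriv kummerM (x * τ) - kummerM (x * τ)) := by
  rw [kummerM_eq, deriv_kummerM, expSeries, expSeries,
    ← (summable_expSeries abs_risingCoeff_three_halves_succ_le _).tsum_sub
      (summable_expSeries abs_risingCoeff_three_halves_le _), ← tsum_mul_left]
  refine tsum_congr fun m => ?_
  have h1 : ((m : ℂ) + 1) * (risingCoeff (3 / 2) (m + 1) : ℂ)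
      = (3 / 2 + m) * (risingCoeff (3 / 2) m : ℂ) := by
    have := congrArg (fun r : ℝ => (r : ℂ)) (succ_mul_risingCoeff_succ (3 / 2) m)
    push_cast at this
    exact this
  have h2 : (m : ℂ) + 1 ≠ 0 := by exact_mod_cast m.succ_ne_zero
  have h3 : (m.factorial : ℂ) ≠ 0 := by exact_mod_cast m.factorial_ne_zero
  rw [Nat.factorial_succ, mul_pow]
  push_cast
  field_simp
  linear_combination (-2 * (τ : ℂ) ^ (m + 1) * x ^ m) * h1

end Asymptotics

section ScalingLimit

variable {ι : Type*} {F : Filter ι} {N : ι → ℕ} {ξ : ℝ} {u v : ι → ℂ} {u₀ v₀ : ℂ}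

/-- The limit of `2 / N` times the polynomials of even degree `2 n`, where `2 n / N → τ`. -/
def evenLimit (ξ : ℝ) (u : ℂ) (τ : ℝ) : ℂ :=
  2 * τ * (deriv kummerM (u * ξ * τ) - kummerM (u * ξ * τ))

lemma tendsto_scaled_sq_sub_one (hN : Tendsto N F atTop) (hξ : ξ = 1 ∨ ξ = -1)
    (hu : Tendsto u F (𝓝 u₀)) :
    Tendsto (fun i => (((ξ : ℂ) + u i / N i) ^ 2 - 1) * (N i / 2)) F (𝓝 (u₀ * ξ)) := by
  have h1 : Tendsto (fun i => ((N i : ℂ))⁻¹) F (𝓝 0) := by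
    have := (Complex.continuous_ofReal.tendsto _).comp (tendsto_inv_natCast hN)
    simpa [Function.comp_def] using this
  have h2 : Tendsto (fun i => u i * ξ + u i ^ 2 / 2 * ((N i : ℂ))⁻¹) F (𝓝 (u₀ * ξ)) := by
    simpa using (hu.mul_const (ξ : ℂ)).add (((hu.pow 2).div_const 2).mul h1)
  refine h2.congr' ?_
  filter_upwards [hN.eventually_gt_atTop 0] with i hi
  have hc : (N i : ℂ) ≠ 0 := by exact_mod_cast hi.ne'
  have hsq : (ξ : ℂ) ^ 2 = 1 := by rcases hξ with rfl | rfl <;> simp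
  field_simp
  linear_combination (-(N i : ℂ) ^ 2) * hsq

lemma tendsto_scaled (hN : Tendsto N F atTop) (ξ : ℝ) (hu : Tendsto u F (𝓝 u₀)) :
    Tendsto (fun i => (ξ : ℂ) + u i / N i) F (𝓝 ξ) := by
  have h1 : Tendsto (fun i => ((N i : ℂ))⁻¹) F (𝓝 0) := by
    have := (Complex.continuous_ofReal.tendsto _).comp (tendsto_inv_natCast hN)
    simpa [Function.comp_def] using this
  simpa [div_eq_mul_inv] using (hu.mul h1).const_add (ξ : ℂ)

lemma tendsto_evenPoly_neg_half (hN : Tendsto N F atTop) (hξ : ξ = 1 ∨ ξ = -1)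
    (hu : Tendsto u F (𝓝 u₀)) {n : ι → ℕ} {τ : ℝ} (hn : ∀ᶠ i in F, n i + 1 ≤ N i)
    (hτ : Tendsto (fun i => (n i : ℝ) * (2 / N i)) F (𝓝 τ)) :
    Tendsto (fun i => Polynomial.aeval ((ξ : ℂ) + u i / N i) (evenPoly (-(1 / 2)) (n i))) F
      (𝓝 (kummerM (u₀ * ξ * τ))) := by
  have h := tendsto_binomial_sum hN 0 (hn.mono fun i hi => by omega) hτ
    (tendsto_scaled_sq_sub_one hN hξ hu)
  rw [tsum_risingCoeff_zero] at h
  refine h.congr fun i => ?_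
  rw [aeval_evenPoly_neg_half]
  simp

lemma tendsto_evenPoly_half (hN : Tendsto N F atTop) (hξ : ξ = 1 ∨ ξ = -1)
    (hu : Tendsto u F (𝓝 u₀)) {n : ι → ℕ} {τ : ℝ} (hn : ∀ᶠ i in F, n i + 1 ≤ N i)
    (hτ : Tendsto (fun i => (n i : ℝ) * (2 / N i)) F (𝓝 τ)) :
    Tendsto (fun i => 2 / (N i : ℂ) *
      Polynomial.aeval ((ξ : ℂ) + u i / N i) (evenPoly (1 / 2) (n i))) F
      (𝓝 (evenLimit ξ u₀ τ)) := by
  have h := tendsto_binomial_sum hN 1 hn hτ (tendsto_scaled_sq_sub_one hN hξ hu)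
  rw [tsum_risingCoeff_one] at h
  refine h.congr fun i => ?_
  rw [aeval_evenPoly_half, pow_one]

/-- Uniformity in the degree is the purpose: this is the domination required by the Riemann sums. -/
lemma exists_bound_evenPoly (hN : Tendsto N F atTop) (hξ : ξ = 1 ∨ ξ = -1)
    (hu : Tendsto u F (𝓝 u₀)) :
    ∃ B : ℝ, 0 ≤ B ∧ ∀ᶠ i in F, ∀ n, n + 1 ≤ N i →
      ‖Polynomial.aeval ((ξ : ℂ) + u i / N i) (evenPoly (-(1 / 2)) n)‖ ≤ B ∧
      ‖2 / (N i : ℂ) * Polynomial.aeval ((ξ : ℂ) + u i / N i) (evenPoly (1 / 2) n)‖ ≤ B := by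
  set x := u₀ * ξ
  set C := 2 * (‖x‖ + 1) with hC
  set B := ∑' m : ℕ, 1 * 2 ^ m * (C ^ m / (m.factorial : ℝ)) with hB
  have hsum := summable_expSeries_bound 1 C
  have hC0 : 0 ≤ C := by positivity
  have hB0 : 0 ≤ B := tsum_nonneg fun m => by positivity
  refine ⟨2 * B, by positivity, ?_⟩
  filter_upwards [(tendsto_scaled_sq_sub_one hN hξ hu).norm.eventually_le_const (lt_add_one ‖x‖),
    hN.eventually_gt_atTop 0] with i hi hp n hn
  have hy : ‖((ξ : ℂ) + u i / N i) ^ 2 - 1‖ * N i ≤ C := by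
    rw [norm_mul, norm_div, Complex.norm_natCast, Complex.norm_two] at hi
    linarith
  have hr : (0 : ℝ) < N i := by exact_mod_cast hp
  have hpart : ∑ m ∈ Finset.range (n + 1), 1 * 2 ^ m * (C ^ m / (m.factorial : ℝ)) ≤ B :=
    hsum.sum_le_tsum _ fun m _ => by positivity
  constructor
  · rw [aeval_evenPoly_neg_half]
    refine (norm_sum_le_of_le _ fun m _ => norm_binomial_term_le (e := 0) (M := N i) (by omega) hy
      m).trans ?_
    simp only [pow_zero, one_mul] at hpart ⊢
    linarith
  · rw [aeval_evenPoly_half, norm_mul, norm_div, Complex.norm_natCast, Complex.norm_two]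
    have := norm_sum_le_of_le (Finset.range (n + 1)) fun m _ =>
      norm_binomial_term_le (e := 1) (M := N i) hn hy m
    rw [← Finset.mul_sum, pow_one] at this
    calc _ ≤ 2 / (N i : ℝ) * (N i * B) := by
          gcongr
          exact this.trans (by gcongr)
      _ = 2 * B := by field_simp

variable {t : ι → ℝ} {lam : ℝ}

lemma tendsto_oddPoly (hN : Tendsto N F atTop) (hξ : ξ = 1 ∨ ξ = -1)
    (ht : Tendsto (fun i => N i * t i) F (𝓝 lam))
    (hu : Tendsto u F (𝓝 u₀)) {n : ι → ℕ} {τ : ℝ} (hn : ∀ᶠ i in F, n i + 1 ≤ N i)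
    (hτ : Tendsto (fun i => (n i : ℝ) * (2 / N i)) F (𝓝 τ)) :
    Tendsto (fun i => Polynomial.aeval ((ξ : ℂ) + u i / N i) (oddPoly (t i) (n i))) F
      (𝓝 (ξ * ((1 - τ * lam) * kummerM (u₀ * ξ * τ) - lam / 2 * evenLimit ξ u₀ τ))) := by
  have hpos := hN.eventually_gt_atTop 0
  have h1 : Tendsto (fun i => (2 * (n i : ℝ) + 1) * t i) F (𝓝 (τ * lam)) := by
    have := (hτ.add (tendsto_inv_natCast hN)).mul ht
    rw [add_zero] at this
    refine this.congr' ?_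
    filter_upwards [hpos] with i hi
    have hr : (N i : ℝ) ≠ 0 := by exact_mod_cast hi.ne'
    field_simp
  have h1c : Tendsto (fun i => (1 : ℂ) - (2 * (n i : ℂ) + 1) * t i) F (𝓝 (1 - τ * lam)) := by
    have := ((Complex.continuous_ofReal.tendsto _).comp h1).const_sub (1 : ℂ)
    simpa [Function.comp_def] using this
  have htc : Tendsto (fun i => (N i * t i / 2 : ℂ)) F (𝓝 (lam / 2)) := by
    have := ((Complex.continuous_ofReal.tendsto _).comp ht).div_const (2 : ℂ)
    simpa [Function.comp_def] using this
  have h2 := (tendsto_scaled hN ξ hu).mul ((h1c.mul (tendsto_evenPoly_neg_half hN hξ hu hn hτ)).sub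
    (htc.mul (tendsto_evenPoly_half hN hξ hu hn hτ)))
  refine h2.congr' ?_
  filter_upwards [hpos] with i hi
  have hc : (N i : ℂ) ≠ 0 := by exact_mod_cast hi.ne'
  rw [aeval_oddPoly_eq]
  field_simp

lemma exists_bound_oddPoly (hN : Tendsto N F atTop) (hξ : ξ = 1 ∨ ξ = -1)
    (ht : Tendsto (fun i => N i * t i) F (𝓝 lam)) (hu : Tendsto u F (𝓝 u₀)) :
    ∃ B : ℝ, 0 ≤ B ∧ ∀ᶠ i in F, ∀ n, n + 1 ≤ N i →
      ‖Polynomial.aeval ((ξ : ℂ) + u i / N i) (oddPoly (t i) n)‖ ≤ B := by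
  obtain ⟨B, hB0, hB⟩ := exists_bound_evenPoly hN hξ hu
  set L := |lam| + 1 with hL
  have hL0 : 0 ≤ L := by positivity
  refine ⟨(‖(ξ : ℂ)‖ + 1) * ((1 + 2 * L) * B + L / 2 * B), by positivity, ?_⟩
  filter_upwards [hB, (tendsto_scaled hN ξ hu).norm.eventually_le_const (lt_add_one _),
    ht.abs.eventually_le_const (lt_add_one |lam|), hN.eventually_gt_atTop 0] with i hi hz hti hp n hn
  obtain ⟨hR, hP⟩ := hi n hn
  have hr : (0 : ℝ) < N i := by exact_mod_cast hp
  have hc : (N i : ℂ) ≠ 0 := by exact_mod_cast hp.ne'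
  have e : (t i : ℂ) * Polynomial.aeval ((ξ : ℂ) + u i / N i) (evenPoly (1 / 2) n)
      = ((N i * t i : ℝ) : ℂ) / 2 *
        (2 / (N i : ℂ) * Polynomial.aeval ((ξ : ℂ) + u i / N i) (evenPoly (1 / 2) n)) := by
    push_cast
    field_simp
  have h1 : ‖(1 : ℂ) - (2 * (n : ℂ) + 1) * t i‖ ≤ 1 + 2 * L := by
    have e1 : (1 : ℂ) - (2 * (n : ℂ) + 1) * t i = ((1 - (2 * n + 1) * t i : ℝ) : ℂ) := by
      push_cast; rfl
    rw [e1, Complex.norm_real, Real.norm_eq_abs]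
    refine (abs_sub _ _).trans ?_
    rw [abs_one, abs_mul, abs_of_nonneg (by positivity : (0 : ℝ) ≤ 2 * n + 1)]
    rw [abs_mul, abs_of_pos hr] at hti
    have h2 : (2 * (n : ℝ) + 1) ≤ 2 * N i := by
      have : (n : ℝ) + 1 ≤ N i := by exact_mod_cast hn
      linarith
    nlinarith [abs_nonneg (t i), mul_le_mul_of_nonneg_right h2 (abs_nonneg (t i))]
  rw [aeval_oddPoly_eq, e, norm_mul]
  gcongr
  refine (norm_sub_le _ _).trans ?_
  rw [norm_mul, norm_mul, norm_div, Complex.norm_real, Complex.norm_two, Real.norm_eq_abs]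
  gcongr

end ScalingLimit

/-! ### Scaling limits of the polynomial kernel and of the edge function -/

section ScalingLimit

variable {ι : Type*} {F : Filter ι} {N : ι → ℕ} {ξ : ℝ} {u v : ι → ℂ} {u₀ v₀ : ℂ}
  {t : ι → ℝ} {lam : ℝ}

lemma tendsto_half_mul (hN : Tendsto N F atTop) :
    Tendsto (fun i => ((N i / 2 : ℕ) : ℝ) * (2 / N i)) F (𝓝 1) := by
  have h1 : Tendsto (fun i => 1 - ((N i : ℝ))⁻¹) F (𝓝 1) := by
    simpa using (tendsto_inv_natCast hN).const_sub (1 : ℝ)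
  refine tendsto_of_tendsto_of_tendsto_of_le_of_le' h1 tendsto_const_nhds ?_ ?_
  · filter_upwards [hN.eventually_gt_atTop 0] with i hi
    have hr : (0 : ℝ) < N i := by exact_mod_cast hi
    have : (N i : ℝ) ≤ 2 * (N i / 2 : ℕ) + 1 := by
      exact_mod_cast (by omega : N i ≤ 2 * (N i / 2) + 1)
    rw [← sub_nonneg]
    have e : ((N i / 2 : ℕ) : ℝ) * (2 / N i) - (1 - ((N i : ℝ))⁻¹)
        = (2 * (N i / 2 : ℕ) + 1 - N i) / N i := by
      field_simp
      ring
    rw [e]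
    exact div_nonneg (by linarith) hr.le
  · filter_upwards [hN.eventually_gt_atTop 0] with i hi
    have hr : (0 : ℝ) < N i := by exact_mod_cast hi
    have : 2 * ((N i / 2 : ℕ) : ℝ) ≤ N i := by
      exact_mod_cast (by omega : 2 * (N i / 2) ≤ N i)
    rw [mul_div_assoc', div_le_one hr]
    linarith

lemma tendsto_half_atTop (hN : Tendsto N F atTop) : Tendsto (fun i => N i / 2) F atTop :=
  (Nat.tendsto_div_const_atTop two_ne_zero).comp hN

lemma tendsto_floor_mul (hN : Tendsto N F atTop) {τ : ℝ} (hτ : 0 ≤ τ) :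
    Tendsto (fun i => ((⌊((N i / 2 : ℕ) : ℝ) * τ⌋₊ : ℕ) : ℝ) * (2 / N i)) F (𝓝 τ) := by
  have h1 : Tendsto (fun i => ((⌊τ * ((N i / 2 : ℕ) : ℝ)⌋₊ : ℕ) : ℝ) / ((N i / 2 : ℕ) : ℝ)) F
      (𝓝 τ) :=
    (tendsto_nat_floor_mul_div_atTop hτ).comp
      (tendsto_natCast_atTop_atTop.comp (tendsto_half_atTop hN))
  have h2 := h1.mul (tendsto_half_mul hN)
  rw [mul_one] at h2
  refine h2.congr' ?_
  filter_upwards [(tendsto_half_atTop hN).eventually_gt_atTop 0] with i hi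
  have hr : ((N i / 2 : ℕ) : ℝ) ≠ 0 := by exact_mod_cast hi.ne'
  rw [mul_comm τ, ← mul_assoc, div_mul_cancel₀ _ hr]

lemma eventually_floor_add_one_le (hN : Tendsto N F atTop) {τ : ℝ} (hτ : τ ≤ 1) :
    ∀ᶠ i in F, ⌊((N i / 2 : ℕ) : ℝ) * τ⌋₊ + 1 ≤ N i := by
  filter_upwards [hN.eventually_gt_atTop 1] with i hi
  have : ⌊((N i / 2 : ℕ) : ℝ) * τ⌋₊ ≤ N i / 2 :=
    Nat.floor_le_of_le (mul_le_of_le_one_right (Nat.cast_nonneg _) hτ)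
  omega

lemma eventually_half_add_one_le (hN : Tendsto N F atTop) : ∀ᶠ i in F, N i / 2 + 1 ≤ N i := by
  filter_upwards [hN.eventually_gt_atTop 1] with i hi
  omega

lemma tendsto_half_mul_complex (hN : Tendsto N F atTop) :
    Tendsto (fun i => ((N i / 2 : ℕ) : ℂ) * (2 / N i)) F (𝓝 1) := by
  have := (Complex.continuous_ofReal.tendsto _).comp (tendsto_half_mul hN)
  refine (this.congr fun i => ?_)
  simp only [Function.comp_apply]
  push_cast
  rfl

/-- The term with index `n` of the sum in `scaledPoly`, relative to the step of the Riemann sum. -/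
lemma tendsto_antisymm (hN : Tendsto N F atTop) (hξ : ξ = 1 ∨ ξ = -1)
    (ht : Tendsto (fun i => N i * t i) F (𝓝 lam)) (hu : Tendsto u F (𝓝 u₀))
    (hv : Tendsto v F (𝓝 v₀)) {n : ι → ℕ} {τ : ℝ} (hn : ∀ᶠ i in F, n i + 1 ≤ N i)
    (hτ : Tendsto (fun i => (n i : ℝ) * (2 / N i)) F (𝓝 τ)) :
    Tendsto (fun i => 2 / (N i : ℂ) * Polynomial.aeval ((ξ : ℂ) + u i / N i) (evenPoly (1 / 2) (n i))
        * Polynomial.aeval ((ξ : ℂ) + v i / N i) (oddPoly (t i) (n i))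
      - 2 / (N i : ℂ) * Polynomial.aeval ((ξ : ℂ) + v i / N i) (evenPoly (1 / 2) (n i))
        * Polynomial.aeval ((ξ : ℂ) + u i / N i) (oddPoly (t i) (n i))) F
      (𝓝 (2 * ξ * (τ * (1 - lam * τ) *
        (deriv kummerM (u₀ * ξ * τ) * kummerM (v₀ * ξ * τ)
          - kummerM (u₀ * ξ * τ) * deriv kummerM (v₀ * ξ * τ))))) := by
  have h := ((tendsto_evenPoly_half hN hξ hu hn hτ).mul (tendsto_oddPoly hN hξ ht hv hn hτ)).sub
    ((tendsto_evenPoly_half hN hξ hv hn hτ).mul (tendsto_oddPoly hN hξ ht hu hn hτ))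
  -- Antisymmetrization removes the products of two `evenLimit`s and the `M M` terms, leaving the
  -- factor `1 - lam τ`.
  refine h.trans (le_of_eq (congrArg 𝓝 ?_))
  simp only [evenLimit]
  ring

/-- The parity of `N` does not stabilize, so the limit exists only because the odd correction itself
tends to zero. -/
lemma tendsto_ite_odd {x : ι → ℂ} {c : ℂ} (h : Tendsto x F (𝓝 c)) (hc : c = 0) :
    Tendsto (fun i => if Odd (N i) then x i else 0) F (𝓝 0) := by
  subst hc
  refine squeeze_zero_norm (fun i => ?_) (tendsto_zero_iff_norm_tendsto_zero.1 h)
  split_ifs <;> simp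

lemma tendsto_one_sub_mul (ht : Tendsto (fun i => N i * t i) F (𝓝 lam)) :
    Tendsto (fun i => (1 : ℂ) - N i * t i) F (𝓝 (1 - lam)) := by
  have := ((Complex.continuous_ofReal.tendsto _).comp ht).const_sub (1 : ℂ)
  simpa [Function.comp_def] using this

/-- The polynomial with `b = -1/2` has a finite limit and is lost at scale `2 / N`. The difference
thus has the same limit as the first term alone, which is why the odd corrections cancel. -/
lemma tendsto_half_evenPoly_sub (hN : Tendsto N F atTop) (hξ : ξ = 1 ∨ ξ = -1)
    (hu : Tendsto u F (𝓝 u₀)) :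
    Tendsto (fun i => 2 / (N i : ℂ) *
      (Polynomial.aeval ((ξ : ℂ) + u i / N i) (evenPoly (1 / 2) (N i / 2))
        - Polynomial.aeval ((ξ : ℂ) + u i / N i) (evenPoly (-(1 / 2)) (N i / 2)))) F
      (𝓝 (evenLimit ξ u₀ 1)) := by
  have hn := eventually_half_add_one_le hN
  have h0 : Tendsto (fun i => 2 / (N i : ℂ)) F (𝓝 0) := by
    have := ((Complex.continuous_ofReal.tendsto _).comp (tendsto_inv_natCast hN)).const_mul (2 : ℂ)
    simpa [Function.comp_def, div_eq_mul_inv] using this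
  have h := (tendsto_evenPoly_half hN hξ hu hn (tendsto_half_mul hN)).sub
    (h0.mul (tendsto_evenPoly_neg_half hN hξ hu hn (tendsto_half_mul hN)))
  rw [zero_mul, sub_zero] at h
  exact h.congr fun i => by ring

variable [F.IsCountablyGenerated]

lemma tendsto_scaledPoly (hN : Tendsto N F atTop) (hξ : ξ = 1 ∨ ξ = -1)
    (ht : Tendsto (fun i => N i * t i) F (𝓝 lam)) (hu : Tendsto u F (𝓝 u₀))
    (hv : Tendsto v F (𝓝 v₀)) :
    Tendsto (fun i => scaledPoly (t i) (N i) ξ (u i) (v i)) F (𝓝 (limPoly lam ξ u₀ v₀)) := by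
  obtain ⟨B₁, hB₁0, hB₁⟩ := exists_bound_evenPoly hN hξ hu
  obtain ⟨B₂, hB₂0, hB₂⟩ := exists_bound_evenPoly hN hξ hv
  obtain ⟨B₃, hB₃0, hB₃⟩ := exists_bound_oddPoly hN hξ ht hu
  obtain ⟨B₄, hB₄0, hB₄⟩ := exists_bound_oddPoly hN hξ ht hv
  have hmain := tendsto_riemann_sum (C := B₁ * B₄ + B₂ * B₃)
    ((tendsto_half_atTop hN).eventually_gt_atTop 0)
    (f := fun i j =>
      2 / (N i : ℂ) * Polynomial.aeval ((ξ : ℂ) + u i / N i) (evenPoly (1 / 2) j)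
        * Polynomial.aeval ((ξ : ℂ) + v i / N i) (oddPoly (t i) j)
      - 2 / (N i : ℂ) * Polynomial.aeval ((ξ : ℂ) + v i / N i) (evenPoly (1 / 2) j)
        * Polynomial.aeval ((ξ : ℂ) + u i / N i) (oddPoly (t i) j)) (by
      filter_upwards [hB₁, hB₂, hB₃, hB₄] with i h1 h2 h3 h4 j hj
      have hj' : j + 1 ≤ N i := by omega
      refine (norm_sub_le _ _).trans ?_
      rw [norm_mul, norm_mul (2 / (N i : ℂ) * _) (Polynomial.aeval ((ξ : ℂ) + u i / N i) _)]
      gcongr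
      exacts [(h1 j hj').2, h4 j hj', (h2 j hj').2, h3 j hj'])
    (fun τ hτ => tendsto_antisymm hN hξ ht hu hv
      (eventually_floor_add_one_le hN hτ.2) (tendsto_floor_mul hN hτ.1.le))
  have hp := tendsto_half_evenPoly_sub hN hξ hu
  have hq := tendsto_half_evenPoly_sub hN hξ hv
  have hn := eventually_half_add_one_le hN
  have hP := tendsto_evenPoly_half hN hξ hu hn (tendsto_half_mul hN)
  have hQ := tendsto_evenPoly_half hN hξ hv hn (tendsto_half_mul hN)
  have hodd := tendsto_ite_odd (N := N) (((tendsto_one_sub_mul ht).mul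
    ((hP.mul ((tendsto_scaled hN ξ hv).mul hq)).sub
      (hQ.mul ((tendsto_scaled hN ξ hu).mul hp)))).mul_const (-(1 / 8) : ℂ)) (by ring)
  -- The constant `1 / 8` collects the prefactor `1/2`, the `1/2` from `2 / N` in the scaled even
  -- polynomial, and the `1/2` from `N / 2` summands; with the `2 ξ` of `tendsto_antisymm` it gives
  -- `ξ / 4`.
  have hall := ((hmain.mul (tendsto_half_mul_complex hN)).mul_const (1 / 8 : ℂ)).add hodd
  have e : (∫ τ in (0 : ℝ)..1, 2 * (ξ : ℂ) * (τ * (1 - lam * τ) *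
        (deriv kummerM (u₀ * ξ * τ) * kummerM (v₀ * ξ * τ)
          - kummerM (u₀ * ξ * τ) * deriv kummerM (v₀ * ξ * τ)))) * 1 * (1 / 8) + 0
      = limPoly lam ξ u₀ v₀ := by
    rw [intervalIntegral.integral_const_mul, limPoly]
    ring
  rw [e] at hall
  refine hall.congr' ?_
  filter_upwards [hN.eventually_gt_atTop 1] with i hi
  have hc : (N i : ℂ) ≠ 0 := by exact_mod_cast (by omega : N i ≠ 0)
  have hJ : ((N i / 2 : ℕ) : ℂ) ≠ 0 := by exact_mod_cast (by omega : N i / 2 ≠ 0)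
  have h1 : ∀ S : ℂ, S / ((N i / 2 : ℕ) : ℂ) * (((N i / 2 : ℕ) : ℂ) * (2 / N i)) = S * (2 / N i) :=
    fun S => by field_simp
  rw [scaledPoly, polyKernel, h1, add_div]
  congr 1
  · simp only [mul_assoc (2 / (N i : ℂ)), ← mul_sub, ← Finset.mul_sum]
    field_simp
    ring
  · split_ifs
    · field_simp
      ring
    · simp

/-- Since `ξ ^ 2 = 1`, the limit `(lam / 2) * evenLimit` of `t P_j` cancels against the same term in
the limit of `ξ Q_j`, so that only `(1 - lam τ) M` survives. The same identity annihilates the odd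
correction. -/
lemma tendsto_scaledEdge (hN : Tendsto N F atTop) (hξ : ξ = 1 ∨ ξ = -1)
    (ht : Tendsto (fun i => N i * t i) F (𝓝 lam)) (hu : Tendsto u F (𝓝 u₀)) :
    Tendsto (fun i => scaledEdge (t i) (N i) ξ (u i)) F (𝓝 (limEdge lam ξ u₀)) := by
  obtain ⟨B₁, hB₁0, hB₁⟩ := exists_bound_evenPoly hN hξ hu
  obtain ⟨B₃, hB₃0, hB₃⟩ := exists_bound_oddPoly hN hξ ht hu
  have hsq : (ξ : ℂ) ^ 2 = 1 := by rcases hξ with rfl | rfl <;> simp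
  have htc : Tendsto (fun i => (N i * t i / 2 : ℂ)) F (𝓝 (lam / 2)) := by
    have := ((Complex.continuous_ofReal.tendsto _).comp ht).div_const (2 : ℂ)
    simpa [Function.comp_def] using this
  have hmain := tendsto_riemann_sum (C := (‖(lam / 2 : ℂ)‖ + 1) * B₁ + ‖(ξ : ℂ)‖ * B₃)
    ((tendsto_half_atTop hN).eventually_gt_atTop 0)
    (f := fun i j => (N i * t i / 2 : ℂ) * (2 / (N i : ℂ) *
        Polynomial.aeval ((ξ : ℂ) + u i / N i) (evenPoly (1 / 2) j))
      + ξ * Polynomial.aeval ((ξ : ℂ) + u i / N i) (oddPoly (t i) j)) (by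
      filter_upwards [hB₁, hB₃, htc.norm.eventually_le_const (lt_add_one _)] with i h1 h3 h5 j hj
      have hj' : j + 1 ≤ N i := by omega
      refine (norm_add_le _ _).trans ?_
      rw [norm_mul, norm_mul (ξ : ℂ)]
      gcongr
      exacts [(h1 j hj').2, h3 j hj'])
    (fun τ hτ => (htc.mul (tendsto_evenPoly_half hN hξ hu
        (eventually_floor_add_one_le hN hτ.2) (tendsto_floor_mul hN hτ.1.le))).add
      ((tendsto_oddPoly hN hξ ht hu
        (eventually_floor_add_one_le hN hτ.2) (tendsto_floor_mul hN hτ.1.le)).const_mul (ξ : ℂ)))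
  have hp := tendsto_half_evenPoly_sub hN hξ hu
  have hn := eventually_half_add_one_le hN
  have hP := tendsto_evenPoly_half hN hξ hu hn (tendsto_half_mul hN)
  have hodd := tendsto_ite_odd (N := N) (((tendsto_one_sub_mul ht).mul
    (hP.sub (((tendsto_scaled hN ξ hu).const_mul (ξ : ℂ)).mul hp))).mul_const (1 / 4 : ℂ)) (by
      linear_combination (-(1 - (lam : ℂ)) * evenLimit ξ u₀ 1 * (1 / 4)) * hsq)
  have hall := ((hmain.mul (tendsto_half_mul_complex hN)).mul_const (1 / 4 : ℂ)).add hodd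
  have e : (∫ τ in (0 : ℝ)..1, ((lam / 2 : ℂ) * evenLimit ξ u₀ τ + ξ * (ξ *
        ((1 - τ * lam) * kummerM (u₀ * ξ * τ) - lam / 2 * evenLimit ξ u₀ τ)))) * 1 * (1 / 4) + 0
      = limEdge lam ξ u₀ := by
    rw [limEdge, mul_one, add_zero, mul_comm]
    congr 2
    ext τ
    linear_combination ((1 - τ * lam) * kummerM (u₀ * ξ * τ) - lam / 2 * evenLimit ξ u₀ τ) * hsq
  rw [e] at hall
  refine hall.congr' ?_
  filter_upwards [hN.eventually_gt_atTop 1] with i hi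
  have hc : (N i : ℂ) ≠ 0 := by exact_mod_cast (by omega : N i ≠ 0)
  have hJ : ((N i / 2 : ℕ) : ℂ) ≠ 0 := by exact_mod_cast (by omega : N i / 2 ≠ 0)
  have h1 : ∀ S : ℂ, S / ((N i / 2 : ℕ) : ℂ) * (((N i / 2 : ℕ) : ℂ) * (2 / N i)) = S * (2 / N i) :=
    fun S => by field_simp
  have h2 : ∀ P : ℂ, (N i * t i / 2 : ℂ) * (2 / (N i : ℂ) * P) = t i * P := fun P => by
    field_simp
  simp only [scaledEdge, edgeKernel, h1, h2, add_div]
  congr 1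
  · field_simp
    ring
  · split_ifs
    · field_simp
      ring
    · simp

end ScalingLimit

/-! ### The limit of the scaled weights -/

lemma isUnitWeight_scaledWeight (s : ℝ≥0∞) (N : ℕ) (ξ : ℝ) : IsUnitWeight (scaledWeight s N ξ) :=
  ⟨(measurable_weight s).comp (by fun_prop : Continuous fun u : ℂ => (ξ : ℂ) + u / N).measurable,
    fun _ => weight_nonneg _ _, fun _ => weight_le_one _ _⟩

lemma weight_eq_exp {s : ℝ≥0∞} (hs : invExp s ≠ 0) (u : ℂ) :
    weight s u = Real.exp (-(max 0 (Real.log ‖u‖)) / invExp s) := by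
  have h1 : s ≠ ∞ := by rintro rfl; simp at hs
  have h2 : Real.log (max 1 ‖u‖) = max 0 (Real.log ‖u‖) := by
    rcases le_total ‖u‖ 1 with h | h
    · rw [max_eq_left h, max_eq_left (Real.log_nonpos (norm_nonneg _) h), Real.log_one]
    · rw [max_eq_right h, max_eq_right (Real.log_nonneg h)]
  rw [weight, if_neg h1, Real.rpow_def_of_pos (lt_max_of_lt_left one_pos), h2, invExp_eq, div_inv_eq_mul]
  congr 1
  ring

/-- From `exp (-x) ≤ 1 / x`. The bound is linear in `1 / s` and thus treats `s = ∞` and finite `s`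
alike when `lam = 0`. -/
lemma weight_le_div_log {s : ℝ≥0∞} (hs : s ≠ 0) {u : ℂ} (hu : 1 < ‖u‖) :
    weight s u ≤ invExp s / Real.log ‖u‖ := by
  have hl := Real.log_pos hu
  by_cases h : s = ∞
  · rw [weight_of_one_lt_norm s hu, if_pos h]
    exact div_nonneg (invExp_nonneg s) hl.le
  · have hpos : 0 < s.toReal := ENNReal.toReal_pos hs h
    have ht : 0 < invExp s := by rw [invExp_eq]; positivity
    rw [weight_eq_exp ht.ne', max_eq_right hl.le, neg_div, Real.exp_neg,
      ← inv_div (Real.log ‖u‖) (invExp s)]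
    exact inv_anti₀ (by positivity) ((Real.add_one_le_exp _).trans' (by linarith))

section

variable {ι : Type*} {F : Filter ι} {N : ι → ℕ} {ξ : ℝ} {u : ι → ℂ} {u₀ : ℂ}
  {s : ι → ℝ≥0∞} {lam : ℝ}

lemma norm_sq_scaled (hξ : ξ = 1 ∨ ξ = -1) {N : ℕ} (hN : 0 < N) (u : ℂ) :
    ‖(ξ : ℂ) + u / N‖ ^ 2 = 1 + (ξ * u.re + Complex.normSq u / 2 * (N : ℝ)⁻¹) * (2 / N) := by
  have hr : (N : ℝ) ≠ 0 := by positivity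
  have hsq : ξ ^ 2 = 1 := by rcases hξ with rfl | rfl <;> simp
  rw [← Complex.normSq_eq_norm_sq, Complex.normSq_apply, Complex.normSq_apply]
  simp only [Complex.add_re, Complex.add_im, Complex.ofReal_re, Complex.ofReal_im,
    Complex.div_natCast_re, Complex.div_natCast_im]
  field_simp
  linear_combination ((N : ℝ) ^ 2) * hsq

/-- Here `|ξ + u / N| ^ 2 = 1 + 2 b / N` with `b → ξ Re u`, and `1 - 1/x ≤ log x ≤ x - 1` squeezes
the logarithm. -/
lemma tendsto_natCast_mul_log_norm (hN : Tendsto N F atTop) (hξ : ξ = 1 ∨ ξ = -1)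
    (hu : Tendsto u F (𝓝 u₀)) :
    Tendsto (fun i => N i * Real.log ‖(ξ : ℂ) + u i / N i‖) F (𝓝 (ξ * u₀.re)) := by
  have h0 := tendsto_inv_natCast hN
  set b : ι → ℝ := fun i => ξ * (u i).re + Complex.normSq (u i) / 2 * (N i : ℝ)⁻¹ with hb
  have h1 : Tendsto b F (𝓝 (ξ * u₀.re)) := by
    have := ((Complex.continuous_re.tendsto _).comp hu).const_mul ξ |>.add
      ((((Complex.continuous_normSq.tendsto _).comp hu).div_const 2).mul h0)
    simpa using this
  have h2 : Tendsto (fun i => 1 + b i * (2 / N i)) F (𝓝 1) := by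
    have := (h1.mul (h0.const_mul 2)).const_add 1
    simpa [div_eq_mul_inv] using this
  have h3 : Tendsto (fun i => b i / (1 + b i * (2 / N i))) F (𝓝 (ξ * u₀.re)) := by
    have := h1.div h2 one_ne_zero
    rwa [div_one] at this
  refine tendsto_of_tendsto_of_tendsto_of_le_of_le' h3 h1 ?_ ?_
  all_goals
    filter_upwards [hN.eventually_gt_atTop 0, h2.eventually_const_lt one_pos] with i hi hp
    have hr : (0 : ℝ) < N i := by exact_mod_cast hi
    have e : N i * Real.log ‖(ξ : ℂ) + u i / N i‖ = N i / 2 * Real.log (1 + b i * (2 / N i)) := by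
      rw [hb, ← norm_sq_scaled hξ hi, Real.log_pow]
      push_cast; ring
    rw [e]
  · have := Real.one_sub_inv_le_log_of_pos hp
    calc b i / (1 + b i * (2 / N i)) = N i / 2 * (1 - (1 + b i * (2 / N i))⁻¹) := by
          generalize hx : 1 + b i * (2 / (N i : ℝ)) = x at *
          have : b i = (x - 1) * (N i / 2) := by rw [← hx]; field_simp; ring
          rw [this]; field_simp
      _ ≤ _ := by gcongr
  · have := Real.log_le_sub_one_of_pos hp
    calc _ ≤ N i / 2 * (1 + b i * (2 / N i) - 1) := by gcongr
      _ = b i := by field_simp; ring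

/-- For `lam > 0` the weight is eventually `exp (-max (0, N log |ξ + u / N|) / (N t))`, a continuous
function of two convergent quantities. For `lam = 0` the sign of `ξ Re u₀` decides whether the point
is eventually inside or outside the unit disk. -/
lemma tendsto_scaledWeight (hN : Tendsto N F atTop) (hξ : ξ = 1 ∨ ξ = -1)
    (hs : ∀ i, (N i : ℝ≥0∞) < s i) (ht : Tendsto (fun i => N i * invExp (s i)) F (𝓝 lam))
    (hu : Tendsto u F (𝓝 u₀)) (h0 : 0 ≤ lam) (h : lam ≠ 0 ∨ u₀.re ≠ 0) :
    Tendsto (fun i => scaledWeight (s i) (N i) ξ (u i)) F (𝓝 (limWeight lam ξ u₀)) := by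
  have hlog := tendsto_natCast_mul_log_norm hN hξ hu
  have hre : (u₀ * ξ).re = ξ * u₀.re := by simp [mul_comm]
  by_cases hl : lam = 0
  · have hne : ξ * u₀.re ≠ 0 := mul_ne_zero (by rcases hξ with rfl | rfl <;> simp)
      (h.resolve_left (not_not.2 hl))
    rw [limWeight, omega, if_pos hl, hre]
    rcases lt_or_gt_of_ne hne with hneg | hpos
    · rw [if_pos hneg.le]
      refine tendsto_const_nhds.congr' ?_
      filter_upwards [hlog.eventually_lt_const hneg, hN.eventually_gt_atTop 0] with i hi hp
      have hr : (0 : ℝ) < N i := by exact_mod_cast hp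
      refine (weight_of_norm_le_one _ ?_).symm
      by_contra! hc
      have := mul_pos hr (Real.log_pos hc)
      linarith
    · rw [if_neg (not_le.2 hpos)]
      have h1 : Tendsto (fun i => N i * invExp (s i) / (N i * Real.log ‖(ξ : ℂ) + u i / N i‖)) F
          (𝓝 0) := by
        have := ht.div hlog hne
        rwa [hl, zero_div] at this
      refine tendsto_of_tendsto_of_tendsto_of_le_of_le' tendsto_const_nhds h1
        (Eventually.of_forall fun i => weight_nonneg _ _) ?_
      filter_upwards [hlog.eventually_const_lt hpos, hN.eventually_gt_atTop 0] with i hi hp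
      have hr : (0 : ℝ) < N i := by exact_mod_cast hp
      rw [mul_div_mul_left _ _ hr.ne']
      refine weight_le_div_log (ne_zero_of_natCast_lt (hs i)) ?_
      by_contra! hc
      have := mul_nonpos_of_nonneg_of_nonpos hr.le (Real.log_nonpos (norm_nonneg _) hc)
      linarith
  · have hpos : 0 < lam := lt_of_le_of_ne h0 (Ne.symm hl)
    have e : limWeight lam ξ u₀ = Real.exp (-(max 0 (ξ * u₀.re)) / lam) := by
      rw [limWeight, omega, if_neg hl, hre]
      rcases le_total 0 (ξ * u₀.re) with hc | hc
      · rw [max_eq_right hc, min_eq_right]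
        rw [Real.exp_le_one_iff]
        exact div_nonpos_of_nonpos_of_nonneg (by linarith) h0
      · rw [max_eq_left hc, min_eq_left]
        · simp
        · rw [Real.one_le_exp_iff]
          exact div_nonneg (by linarith) h0
    rw [e]
    have h1 := (Real.continuous_exp.tendsto _).comp
      ((((tendsto_const_nhds (x := (0 : ℝ))).max hlog).neg).div ht hl)
    refine h1.congr' ?_
    filter_upwards [ht.eventually_const_lt hpos, hN.eventually_gt_atTop 0] with i hi hp
    have hr : (0 : ℝ) < N i := by exact_mod_cast hp
    have ht0 : invExp (s i) ≠ 0 := fun hc => by rw [hc, mul_zero] at hi; exact lt_irrefl _ hi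
    have hmax : max 0 (N i * Real.log ‖(ξ : ℂ) + u i / N i‖)
        = N i * max 0 (Real.log ‖(ξ : ℂ) + u i / N i‖) := by
      rw [mul_max_of_nonneg _ _ hr.le, mul_zero]
    rw [scaledWeight, weight_eq_exp ht0, Function.comp_apply, Pi.div_apply, hmax, ← mul_neg,
      mul_div_mul_left _ _ hr.ne']

end

/-! ### Continuous convergence -/

section ContinuousConvergence

variable {ι X Y : Type*} [TopologicalSpace X] [TopologicalSpace Y]

/-- Continuous convergence of the functions `H i` to `H₀`: the values at convergent arguments
converge. -/
def TendstoCts (l : Filter ι) (H : ι → X → Y) (H₀ : X → Y) : Prop :=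
  ∀ x, Tendsto (fun p : ι × X => H p.1 p.2) (l ×ˢ 𝓝 x) (𝓝 (H₀ x))

lemma TendstoCts.comp {l : Filter ι} {H : ι → X → Y} {H₀ : X → Y} (h : TendstoCts l H H₀)
    {κ : Type*} {k : Filter κ} {φ : κ → ι} (hφ : Tendsto φ k l) {x : κ → X} {x₀ : X}
    (hx : Tendsto x k (𝓝 x₀)) : Tendsto (fun a => H (φ a) (x a)) k (𝓝 (H₀ x₀)) :=
  (h x₀).comp (hφ.prodMk hx)

/-- Continuous convergence bounds the functions near each point for late indices; compactness needs
only finitely many such neighbourhoods. -/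
lemma TendstoCts.exists_bound {l : Filter ι} {H : ι → X → ℂ} {H₀ : X → ℂ} (h : TendstoCts l H H₀)
    {K : Set X} (hK : IsCompact K) : ∃ C : ℝ, 0 ≤ C ∧ ∀ᶠ i in l, ∀ x ∈ K, ‖H i x‖ ≤ C := by
  refine hK.induction_on (p := fun K => ∃ C : ℝ, 0 ≤ C ∧ ∀ᶠ i in l, ∀ x ∈ K, ‖H i x‖ ≤ C)
    ⟨0, le_rfl, by simp⟩ ?_ ?_ ?_
  · rintro s t hst ⟨C, hC0, hC⟩
    exact ⟨C, hC0, hC.mono fun i hi x hx => hi x (hst hx)⟩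
  · rintro s t ⟨C, hC0, hC⟩ ⟨D, hD0, hD⟩
    refine ⟨max C D, le_max_of_le_left hC0, ?_⟩
    filter_upwards [hC, hD] with i h1 h2 x hx
    exact hx.elim (fun hx => (h1 x hx).trans (le_max_left _ _))
      fun hx => (h2 x hx).trans (le_max_right _ _)
  · intro x _
    have h1 := (h x).norm.eventually_le_const (lt_add_one _)
    obtain ⟨p, hp, q, hq, hpq⟩ := eventually_prod_iff.1 h1
    exact ⟨{y | q y}, mem_nhdsWithin_of_mem_nhds hq, ‖H₀ x‖ + 1, by positivity,
      hp.mono fun i hi y hy => hpq hi hy⟩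

end ContinuousConvergence

section Segments

variable {ι : Type*} {l : Filter ι} [l.IsCountablyGenerated] {ω : ι → ℂ → ℝ} {ω₀ : ℂ → ℝ}
  {H : ι → ℂ → ℂ} {H₀ : ℂ → ℂ} {x : ι → ℂ} {x₀ : ℂ}

/-- Convergence of the weights is assumed only off the imaginary axis. If `x₀` is real and nonzero,
the segment meets that axis at `0` alone and dominated convergence applies; if `x₀ = 0`, the
segments shrink and the integrands stay bounded. The `x i` themselves need not be real. -/
lemma tendsto_segInt (hω : ∀ i, IsUnitWeight (ω i))
    (hw : ∀ u : ℂ, u.re ≠ 0 → Tendsto (fun p : ι × ℂ => ω p.1 p.2) (l ×ˢ 𝓝 u) (𝓝 (ω₀ u)))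
    (hc : ∀ i, Continuous (H i)) (hH : TendstoCts l H H₀) (hx : Tendsto x l (𝓝 x₀))
    (him : x₀.im = 0) :
    Tendsto (fun i => segInt (fun y => ω i y * H i y) (x i)) l
      (𝓝 (segInt (fun y => ω₀ y * H₀ y) x₀)) := by
  obtain ⟨C, hC0, hC⟩ := hH.exists_bound (isCompact_closedBall (0 : ℂ) (‖x₀‖ + 1))
  have hb : ∀ᶠ i in l, ∀ t ∈ Set.uIoc (0 : ℝ) 1,
      ‖(ω i ((t : ℂ) * x i) : ℂ) * H i ((t : ℂ) * x i)‖ ≤ C := by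
    filter_upwards [hC, hx.norm.eventually_le_const (lt_add_one _)] with i hi hxi t ht
    rw [Set.uIoc_of_le zero_le_one] at ht
    have h1 : ‖(t : ℂ) * x i‖ ≤ ‖x₀‖ + 1 := by
      rw [norm_mul, Complex.norm_real, Real.norm_of_nonneg ht.1.le]
      exact (mul_le_of_le_one_left (norm_nonneg _) ht.2).trans hxi
    rw [norm_mul]
    calc _ ≤ 1 * C := mul_le_mul ((hω i).norm_le_one _) (hi _ (by simpa using h1)) (norm_nonneg _)
          zero_le_one
      _ = C := one_mul C
  by_cases h0 : x₀ = 0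
  · have h1 : Tendsto (fun i => ‖x i‖ * C) l (𝓝 0) := by
      simpa [h0] using hx.norm.mul_const C
    have h2 : segInt (fun y => ω₀ y * H₀ y) x₀ = 0 := by simp [segInt, h0]
    rw [h2]
    refine squeeze_zero_norm' ?_ h1
    filter_upwards [hb] with i hi
    rw [segInt, norm_mul]
    have := intervalIntegral.norm_integral_le_of_norm_le_const hi
    rw [sub_zero, abs_one, mul_one] at this
    gcongr
  · have hre : x₀.re ≠ 0 := fun hre => h0 (Complex.ext hre him)
    refine hx.mul (intervalIntegral.tendsto_integral_filter_of_dominated_convergence (fun _ => C)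
      (Eventually.of_forall fun i => ?_) (hb.mono fun i hi => ae_of_all _ hi)
      intervalIntegrable_const (ae_of_all _ fun t ht => ?_))
    · refine Measurable.aestronglyMeasurable ?_
      have hm : Continuous fun t : ℝ => (t : ℂ) * x i := by fun_prop
      exact ((hω i).measurable_coe.comp hm.measurable).mul ((hc i).comp hm).measurable
    · rw [Set.uIoc_of_le zero_le_one] at ht
      have hxt := hx.const_mul (t : ℂ)
      have hre' : ((t : ℂ) * x₀).re ≠ 0 := by
        rw [Complex.re_ofReal_mul]
        exact mul_ne_zero ht.1.ne' hre
      exact ((Complex.continuous_ofReal.tendsto _).comp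
        ((hw _ hre').comp (tendsto_id.prodMk hxt))).mul (hH.comp tendsto_id hxt)

end Segments

/-! ### Convergence of the entries -/

/-- Convergence of the ingredients of `modelEntry`; that of the weights is required on `G`. -/
structure ModelConv {ι : Type*} (l : Filter ι) (G : Set ℂ) (ω : ι → ℂ → ℝ) (S : ι → ℂ → ℂ → ℂ)
    (C : ι → ℂ → ℂ) (ω₀ : ℂ → ℝ) (S₀ : ℂ → ℂ → ℂ) (C₀ : ℂ → ℂ) : Prop where
  isUnitWeight : ∀ i, IsUnitWeight (ω i)
  continuous_poly : ∀ i, Continuous (Function.uncurry (S i))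
  continuous_edge : ∀ i, Continuous (C i)
  weight : ∀ u ∈ G, Tendsto (fun p : ι × ℂ => ω p.1 p.2) (l ×ˢ 𝓝 u) (𝓝 (ω₀ u))
  poly : TendstoCts l (fun i p => S i p.1 p.2) fun p : ℂ × ℂ => S₀ p.1 p.2
  edge : TendstoCts l C C₀

namespace ModelConv

variable {ι : Type*} {l : Filter ι} {G : Set ℂ} {ω : ι → ℂ → ℝ}
  {S : ι → ℂ → ℂ → ℂ} {C : ι → ℂ → ℂ} {ω₀ : ℂ → ℝ} {S₀ : ℂ → ℂ → ℂ} {C₀ : ℂ → ℂ}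
  {u v : ι → ℂ} {u₀ v₀ : ℂ}

lemma tendsto_weight (h : ModelConv l G ω S C ω₀ S₀ C₀) (hu : Tendsto u l (𝓝 u₀)) (hG : u₀ ∈ G) :
    Tendsto (fun i => (ω i (u i) : ℂ)) l (𝓝 (ω₀ u₀)) :=
  (Complex.continuous_ofReal.tendsto _).comp ((h.weight u₀ hG).comp (tendsto_id.prodMk hu))

lemma mono (h : ModelConv l G ω S C ω₀ S₀ C₀) {l' : Filter ι} (hl : l' ≤ l) :
    ModelConv l' G ω S C ω₀ S₀ C₀ :=
  ⟨h.isUnitWeight, h.continuous_poly, h.continuous_edge,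
    fun u hu => (h.weight u hu).mono_left (prod_mono_left _ hl),
    fun u => (h.poly u).mono_left (prod_mono_left _ hl),
    fun u => (h.edge u).mono_left (prod_mono_left _ hl)⟩

variable [l.IsCountablyGenerated]

lemma tendsto_modelEdge (h : ModelConv l G ω S C ω₀ S₀ C₀) (hG : ∀ u : ℂ, u.re ≠ 0 → u ∈ G)
    (hu : Tendsto u l (𝓝 u₀)) (hu₀ : u₀ ∈ G) (hv : Tendsto v l (𝓝 v₀)) (hv₀ : v₀.im = 0) :
    Tendsto (fun i => modelEdge (ω i) (S i) (C i) (u i) (v i)) l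
      (𝓝 (modelEdge ω₀ S₀ C₀ u₀ v₀)) := by
  refine (h.tendsto_weight hu hu₀).mul ((h.edge.comp tendsto_id hu).sub ?_)
  refine tendsto_segInt (H := fun i y => S i (u i) y) h.isUnitWeight
    (fun u hu => h.weight u (hG u hu)) (fun i => ?_) (fun y => ?_) hv hv₀
  · exact (h.continuous_poly i).comp (by fun_prop : Continuous fun y : ℂ => (u i, y))
  · exact h.poly.comp tendsto_fst ((hu.comp tendsto_fst).prodMk_nhds tendsto_snd)

lemma tendsto_modelReal (h : ModelConv l G ω S C ω₀ S₀ C₀) (hG : ∀ u : ℂ, u.re ≠ 0 → u ∈ G)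
    (hu : Tendsto u l (𝓝 u₀)) (hu₀ : u₀.im = 0) (hv : Tendsto v l (𝓝 v₀)) (hv₀ : v₀.im = 0) :
    Tendsto (fun i => modelReal (ω i) (S i) (C i) (u i) (v i)) l
      (𝓝 (modelReal ω₀ S₀ C₀ u₀ v₀)) := by
  have hw := fun u hu => h.weight u (hG u hu)
  refine Tendsto.sub ?_ (tendsto_segInt h.isUnitWeight hw h.continuous_edge h.edge hu hu₀)
  refine tendsto_segInt (H := fun i y => C i y - segInt (fun x => ω i x * S i y x) (u i))
    (H₀ := fun y => C₀ y - segInt (fun x => ω₀ x * S₀ y x) u₀) h.isUnitWeight hw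
    (fun i => ?_) (fun y => ?_) hv hv₀
  · exact (h.continuous_edge i).sub
      (continuous_segInt_weighted (h.isUnitWeight i) (h.continuous_poly i) _)
  -- The inner integral must converge continuously in `y`; this is the same lemma over the filter `l
  -- ×ˢ 𝓝 y`.
  · refine (h.edge y).sub (tendsto_segInt (ι := ι × ℂ) (ω := fun p => ω p.1)
      (H := fun p x => S p.1 p.2 x) (fun p => h.isUnitWeight p.1) (fun x hx => ?_) (fun p => ?_)
      (fun x => ?_) (hu.comp tendsto_fst) hu₀)
    · exact (hw x hx).comp ((tendsto_fst.comp tendsto_fst).prodMk tendsto_snd)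
    · exact (h.continuous_poly p.1).comp (by fun_prop : Continuous fun y : ℂ => (p.2, y))
    · exact h.poly.comp (tendsto_fst.comp tendsto_fst)
        ((tendsto_snd.comp tendsto_fst).prodMk_nhds tendsto_snd)

end ModelConv

lemma continuous_reflPoint (i : Fin 2) : Continuous (reflPoint i) := by
  unfold reflPoint
  split_ifs
  · exact continuous_id
  · exact Complex.continuous_conj

lemma reflPoint_re (i : Fin 2) (u : ℂ) : (reflPoint i u).re = u.re := by
  unfold reflPoint
  split_ifs <;> simp

lemma norm_reflFactor_le_one (i : Fin 2) (u : ℂ) : ‖reflFactor i u‖ ≤ 1 := by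
  unfold reflFactor iota
  split_ifs
  · simp
  · rcases lt_trichotomy u.im 0 with h | h | h
    · simp [Real.sign_of_neg h]
    · simp [h]
    · simp [Real.sign_of_pos h]

/-- The factors `r` will be values of `reflFactor`, bounded but without a limit at the real axis;
differences are insensitive to them. -/
lemma tendsto_sub_zero_of_mul {ι : Type*} {l : Filter ι} {r a b : ι → ℂ} {c : ℂ}
    (hr : ∀ i, ‖r i‖ ≤ 1) (ha : Tendsto a l (𝓝 c)) (hb : Tendsto b l (𝓝 c)) :
    Tendsto (fun i => r i * a i - r i * b i) l (𝓝 0) := by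
  have h := (ha.sub hb).norm
  rw [sub_self, norm_zero] at h
  refine squeeze_zero_norm (fun i => ?_) h
  rw [← mul_sub, norm_mul]
  exact mul_le_of_le_one_left (norm_nonneg _) (hr i)

lemma tendsto_of_inf_principal {ι X : Type*} {l : Filter ι} {m : Filter X} {f : ι → X} (P : Set ι)
    (h : Tendsto f (l ⊓ 𝓟 P) m) (h' : Tendsto f (l ⊓ 𝓟 Pᶜ) m) : Tendsto f l m := by
  have : l = l ⊓ 𝓟 P ⊔ l ⊓ 𝓟 Pᶜ := by
    rw [← inf_sup_left, sup_principal, Set.union_compl_self, principal_univ, inf_top_eq]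
  rw [this]
  exact h.sup h'

namespace ModelConv

variable {ι : Type*} {l : Filter ι} [l.IsCountablyGenerated] {G : Set ℂ} {ω ω' : ι → ℂ → ℝ}
  {S S' : ι → ℂ → ℂ → ℂ} {C C' : ι → ℂ → ℂ} {ω₀ : ℂ → ℝ} {S₀ : ℂ → ℂ → ℂ} {C₀ : ℂ → ℂ}
  {u v : ι → ℂ} {u₀ v₀ : ℂ}

/-- On each branch of `modelEntry` both families have the same limit up to a common bounded factor
and, on the real-real branch, a common sign term. Neither needs to converge, as both appear
identically in the two entries. -/
lemma tendsto_modelEntry_sub_of_cases (h : ModelConv l G ω S C ω₀ S₀ C₀)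
    (h' : ModelConv l G ω' S' C' ω₀ S₀ C₀) (hG : ∀ u : ℂ, u.re ≠ 0 → u ∈ G)
    (hGr : ∀ i, ∀ u ∈ G, reflPoint i u ∈ G) {i j : Fin 2}
    (hu : Tendsto u l (𝓝 u₀)) (hv : Tendsto v l (𝓝 v₀))
    (hP : ((∀ᶠ a in l, i = 1 ∧ (u a).im = 0) ∧ u₀.im = 0) ∨
      ((∀ᶠ a in l, ¬(i = 1 ∧ (u a).im = 0)) ∧ u₀ ∈ G))
    (hQ : ((∀ᶠ a in l, j = 1 ∧ (v a).im = 0) ∧ v₀.im = 0) ∨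
      ((∀ᶠ a in l, ¬(j = 1 ∧ (v a).im = 0)) ∧ v₀ ∈ G)) :
    Tendsto (fun a => modelEntry (ω a) (S a) (C a) i j (u a) (v a)
      - modelEntry (ω' a) (S' a) (C' a) i j (u a) (v a)) l (𝓝 0) := by
  have hru := ((continuous_reflPoint i).tendsto u₀).comp hu
  have hrv := ((continuous_reflPoint j).tendsto v₀).comp hv
  rcases hP with ⟨hP, hu₀⟩ | ⟨hP, hu₀⟩ <;> rcases hQ with ⟨hQ, hv₀⟩ | ⟨hQ, hv₀⟩
  · have hd := (h.tendsto_modelReal hG hu hu₀ hv hv₀).sub (h'.tendsto_modelReal hG hu hu₀ hv hv₀)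
    rw [sub_self] at hd
    refine hd.congr' ?_
    filter_upwards [hP, hQ] with a hPa hQa
    rw [modelEntry, modelEntry, if_pos hPa, if_pos hQa, if_pos hPa, if_pos hQa]
    ring
  · have hd := tendsto_sub_zero_of_mul (r := fun a => -reflFactor j (v a))
      (fun a => by rw [norm_neg]; exact norm_reflFactor_le_one j _)
      (h.tendsto_modelEdge hG hrv (hGr j _ hv₀) hu hu₀)
      (h'.tendsto_modelEdge hG hrv (hGr j _ hv₀) hu hu₀)
    refine hd.congr' ?_
    filter_upwards [hP, hQ] with a hPa hQa
    rw [modelEntry, modelEntry, if_pos hPa, if_neg hQa, if_pos hPa, if_neg hQa, neg_mul, neg_mul]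
    rfl
  · have hd := tendsto_sub_zero_of_mul (fun a => norm_reflFactor_le_one i (u a))
      (h.tendsto_modelEdge hG hru (hGr i _ hu₀) hv hv₀)
      (h'.tendsto_modelEdge hG hru (hGr i _ hu₀) hv hv₀)
    refine hd.congr' ?_
    filter_upwards [hP, hQ] with a hPa hQa
    rw [modelEntry, modelEntry, if_neg hPa, if_pos hQa, if_neg hPa, if_pos hQa]
    rfl
  · have hruv := hru.prodMk_nhds hrv
    have hd := tendsto_sub_zero_of_mul (r := fun a => reflFactor i (u a) * reflFactor j (v a))
      (fun a => by
        rw [norm_mul]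
        exact mul_le_one₀ (norm_reflFactor_le_one i _) (norm_nonneg _) (norm_reflFactor_le_one j _))
      (((h.tendsto_weight hru (hGr i _ hu₀)).mul (h.tendsto_weight hrv (hGr j _ hv₀))).mul
        (h.poly.comp tendsto_id hruv))
      (((h'.tendsto_weight hru (hGr i _ hu₀)).mul (h'.tendsto_weight hrv (hGr j _ hv₀))).mul
        (h'.poly.comp tendsto_id hruv))
    refine hd.congr' ?_
    filter_upwards [hP, hQ] with a hPa hQa
    rw [modelEntry, modelEntry, if_neg hPa, if_neg hQa, if_neg hPa, if_neg hQa]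
    rfl

/-- Splitting the filter by the branch taken in each variable leaves four filters on which the
branches are fixed. On a nontrivial piece where the arguments are real, the limit point is real as
well, the real axis being closed. -/
lemma tendsto_modelEntry_sub (h : ModelConv l G ω S C ω₀ S₀ C₀)
    (h' : ModelConv l G ω' S' C' ω₀ S₀ C₀) (hG : ∀ u : ℂ, u.re ≠ 0 → u ∈ G)
    (hGr : ∀ i, ∀ u ∈ G, reflPoint i u ∈ G) {i j : Fin 2}
    (hu : Tendsto u l (𝓝 u₀)) (hv : Tendsto v l (𝓝 v₀))
    (hP : u₀ ∈ G ∨ (i = 1 ∧ ∀ᶠ a in l, (u a).im = 0))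
    (hQ : v₀ ∈ G ∨ (j = 1 ∧ ∀ᶠ a in l, (v a).im = 0)) :
    Tendsto (fun a => modelEntry (ω a) (S a) (C a) i j (u a) (v a)
      - modelEntry (ω' a) (S' a) (C' a) i j (u a) (v a)) l (𝓝 0) := by
  have key : ∀ {l' : Filter ι} [NeBot l'] (_ : l' ≤ l) {i : Fin 2} {u : ι → ℂ} {u₀ : ℂ}
      (_ : Tendsto u l (𝓝 u₀)) (_ : u₀ ∈ G ∨ (i = 1 ∧ ∀ᶠ a in l, (u a).im = 0))
      (_ : (∀ᶠ a in l', i = 1 ∧ (u a).im = 0) ∨ ∀ᶠ a in l', ¬(i = 1 ∧ (u a).im = 0)),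
      ((∀ᶠ a in l', i = 1 ∧ (u a).im = 0) ∧ u₀.im = 0) ∨
        ((∀ᶠ a in l', ¬(i = 1 ∧ (u a).im = 0)) ∧ u₀ ∈ G) := by
    intro l' _ hl i u u₀ hu hP hc
    rcases hc with hc | hc
    · refine Or.inl ⟨hc, ?_⟩
      have h1 : Tendsto (fun a => (u a).im) l' (𝓝 u₀.im) :=
        (Complex.continuous_im.tendsto _).comp (hu.mono_left hl)
      exact tendsto_nhds_unique h1 (tendsto_const_nhds.congr' (hc.mono fun a ha => ha.2.symm))
    · refine Or.inr ⟨hc, hP.resolve_right fun hP => ?_⟩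
      obtain ⟨a, ha, ha'⟩ := (hc.and (hl hP.2)).exists
      exact ha ⟨hP.1, ha'⟩
  have main : ∀ P Q : Set ι,
      ((∀ a ∈ P, i = 1 ∧ (u a).im = 0) ∨ ∀ a ∈ P, ¬(i = 1 ∧ (u a).im = 0)) →
      ((∀ a ∈ Q, j = 1 ∧ (v a).im = 0) ∨ ∀ a ∈ Q, ¬(j = 1 ∧ (v a).im = 0)) →
      Tendsto (fun a => modelEntry (ω a) (S a) (C a) i j (u a) (v a)
        - modelEntry (ω' a) (S' a) (C' a) i j (u a) (v a)) (l ⊓ 𝓟 P ⊓ 𝓟 Q) (𝓝 0) := by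
    intro P Q hPc hQc
    rcases eq_or_neBot (l ⊓ 𝓟 P ⊓ 𝓟 Q) with hbot | hne
    · rw [hbot]; exact tendsto_bot
    have hl : l ⊓ 𝓟 P ⊓ 𝓟 Q ≤ l := inf_le_left.trans inf_le_left
    have hlP : ∀ᶠ a in l ⊓ 𝓟 P ⊓ 𝓟 Q, a ∈ P :=
      (inf_le_left.trans inf_le_right : l ⊓ 𝓟 P ⊓ 𝓟 Q ≤ 𝓟 P) (mem_principal_self P)
    have hlQ : ∀ᶠ a in l ⊓ 𝓟 P ⊓ 𝓟 Q, a ∈ Q :=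
      (inf_le_right : l ⊓ 𝓟 P ⊓ 𝓟 Q ≤ 𝓟 Q) (mem_principal_self Q)
    exact tendsto_modelEntry_sub_of_cases (h.mono hl) (h'.mono hl) hG hGr (hu.mono_left hl)
      (hv.mono_left hl)
      (key hl hu hP (hPc.imp (fun hc => hlP.mono hc) fun hc => hlP.mono hc))
      (key hl hv hQ (hQc.imp (fun hc => hlQ.mono hc) fun hc => hlQ.mono hc))
  refine tendsto_of_inf_principal {a | i = 1 ∧ (u a).im = 0} ?_ ?_ <;>
    refine tendsto_of_inf_principal {a | j = 1 ∧ (v a).im = 0} ?_ ?_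
  · exact main _ _ (Or.inl fun a ha => ha) (Or.inl fun a ha => ha)
  · exact main _ _ (Or.inl fun a ha => ha) (Or.inr fun a ha => ha)
  · exact main _ _ (Or.inr fun a ha => ha) (Or.inl fun a ha => ha)
  · exact main _ _ (Or.inr fun a ha => ha) (Or.inr fun a ha => ha)

end ModelConv

/-! ### Convergence of the scaled kernel -/

lemma continuous_scaledPoly (t : ℝ) (N : ℕ) (ξ : ℝ) :
    Continuous (Function.uncurry (scaledPoly t N ξ)) := by
  have h1 : ∀ p : ℝ[X], Continuous fun q : ℂ × ℂ => Polynomial.aeval ((ξ : ℂ) + q.1 / N) p :=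
    fun p => p.continuous_aeval.comp (by fun_prop)
  have h2 : ∀ p : ℝ[X], Continuous fun q : ℂ × ℂ => Polynomial.aeval ((ξ : ℂ) + q.2 / N) p :=
    fun p => p.continuous_aeval.comp (by fun_prop)
  simp only [Function.uncurry_def, scaledPoly, polyKernel]
  split_ifs <;> fun_prop

lemma continuous_scaledEdge (t : ℝ) (N : ℕ) (ξ : ℝ) : Continuous (scaledEdge t N ξ) := by
  have h1 : ∀ p : ℝ[X], Continuous fun q : ℂ => Polynomial.aeval ((ξ : ℂ) + q / N) p :=
    fun p => p.continuous_aeval.comp (by fun_prop)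
  unfold scaledEdge edgeKernel
  split_ifs <;> fun_prop

section

variable {ι : Type*} {l : Filter ι} {N : ι → ℕ} {ξ lam : ℝ} {s : ι → ℝ≥0∞}

/-- The scaling limits hold for moving arguments along any countably generated filter; on the
product of `l` with a neighbourhood filter they become continuous convergence. -/
lemma modelConv_scaled [l.IsCountablyGenerated] (hN : Tendsto N l atTop) (hξ : ξ = 1 ∨ ξ = -1)
    (hs : ∀ i, (N i : ℝ≥0∞) < s i) (ht : Tendsto (fun i => N i * invExp (s i)) l (𝓝 lam))
    (h0 : 0 ≤ lam) :
    ModelConv l {u | lam ≠ 0 ∨ u.re ≠ 0} (fun i => scaledWeight (s i) (N i) ξ)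
      (fun i => scaledPoly (invExp (s i)) (N i) ξ) (fun i => scaledEdge (invExp (s i)) (N i) ξ)
      (limWeight lam ξ) (limPoly lam ξ) (limEdge lam ξ) where
  isUnitWeight _ := isUnitWeight_scaledWeight _ _ _
  continuous_poly _ := continuous_scaledPoly _ _ _
  continuous_edge _ := continuous_scaledEdge _ _ _
  weight _ hu := tendsto_scaledWeight (ι := ι × ℂ) (s := fun p => s p.1) (hN.comp tendsto_fst) hξ
    (fun p => hs p.1) (ht.comp tendsto_fst) tendsto_snd h0 hu
  poly p := tendsto_scaledPoly (ι := ι × ℂ × ℂ) (t := fun p => invExp (s p.1))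
    (hN.comp tendsto_fst) hξ (ht.comp tendsto_fst)
    ((continuous_fst.tendsto p).comp tendsto_snd) ((continuous_snd.tendsto p).comp tendsto_snd)
  edge _ := tendsto_scaledEdge (ι := ι × ℂ) (t := fun p => invExp (s p.1))
    (hN.comp tendsto_fst) hξ (ht.comp tendsto_fst) tendsto_snd

/-- The limit, viewed as a constant family, is the comparison term, because its own entries are not
continuous. -/
lemma modelConv_lim (hξ : ξ ≠ 0) :
    ModelConv l {u | lam ≠ 0 ∨ u.re ≠ 0} (fun _ => limWeight lam ξ) (fun _ => limPoly lam ξ)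
      (fun _ => limEdge lam ξ) (limWeight lam ξ) (limPoly lam ξ) (limEdge lam ξ) where
  isUnitWeight _ := isUnitWeight_limWeight _ _
  continuous_poly _ := continuous_limPoly _ _
  continuous_edge _ := continuous_limEdge _ _
  weight _ hu := (continuousAt_limWeight hξ hu).tendsto.comp tendsto_snd
  poly p := ((continuous_limPoly lam ξ).tendsto p).comp tendsto_snd
  edge u := ((continuous_limEdge lam ξ).tendsto u).comp tendsto_snd

end

/-- On a compact set uniform convergence is local, and locally it says that the difference tends to
zero along `atTop ×ˢ 𝓝[K] p₀`. Restricting to `K` keeps the information that a variable is real. -/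
lemma tendstoUniformlyOn_scaledKernel {s : ℕ → ℝ≥0∞} (hs : ∀ N : ℕ, (N : ℝ≥0∞) < s N) {lam : ℝ}
    (ht : Tendsto (fun N : ℕ => N * invExp (s N)) atTop (𝓝 lam)) (h0 : 0 ≤ lam)
    {π : ℕ → ℕ → ℝ[X]} (hπ : ∀ N : ℕ, IsSkewOrthonormal (s N) N (π N)) {ξ : ℝ}
    (hξ : ξ = 1 ∨ ξ = -1) {i j : Fin 2} {K : Set (ℂ × ℂ)} (hK : IsCompact K)
    (hu : (∀ p ∈ K, lam ≠ 0 ∨ p.1.re ≠ 0) ∨ (i = 1 ∧ ∀ p ∈ K, p.1.im = 0))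
    (hv : (∀ p ∈ K, lam ≠ 0 ∨ p.2.re ≠ 0) ∨ (j = 1 ∧ ∀ p ∈ K, p.2.im = 0)) :
    TendstoUniformlyOn (fun (N : ℕ) (p : ℂ × ℂ) => scaledKernel (s N) N (π N) ξ p.1 p.2 i j)
      (fun p : ℂ × ℂ => kernelOf (Afun lam ξ) p.1 p.2 i j) atTop K := by
  rw [← tendstoLocallyUniformlyOn_iff_tendstoUniformlyOn_of_compact hK,
    tendstoLocallyUniformlyOn_iff_forall_tendsto]
  intro p₀ hp₀
  rw [uniformity_eq_comap_nhds_zero, tendsto_comap_iff]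
  have hξ0 : ξ ≠ 0 := by rcases hξ with rfl | rfl <;> norm_num
  set l : Filter (ℕ × ℂ × ℂ) := atTop ×ˢ 𝓝[K] p₀ with hl
  have hK' : ∀ᶠ q in l, q.2 ∈ K := tendsto_snd.eventually self_mem_nhdsWithin
  have hN : Tendsto (fun q : ℕ × ℂ × ℂ => q.1) l atTop := tendsto_fst
  have hp : Tendsto (fun q : ℕ × ℂ × ℂ => q.2) l (𝓝 p₀) :=
    tendsto_snd.mono_right nhdsWithin_le_nhds
  have h1 : ModelConv l _ _ _ _ _ _ _ := modelConv_scaled (s := fun q : ℕ × ℂ × ℂ => s q.1) hN hξ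
    (fun q => hs q.1) (ht.comp tendsto_fst) h0
  have hmain := h1.tendsto_modelEntry_sub (modelConv_lim hξ0) (fun u hu => Or.inr hu)
    (fun i u hu => hu.imp_right fun h => by rwa [reflPoint_re]) (i := i) (j := j)
    ((continuous_fst.tendsto p₀).comp hp) ((continuous_snd.tendsto p₀).comp hp)
    (hu.imp (fun h => h p₀ hp₀) fun h => ⟨h.1, hK'.mono fun q hq => h.2 _ hq⟩)
    (hv.imp (fun h => h p₀ hp₀) fun h => ⟨h.1, hK'.mono fun q hq => h.2 _ hq⟩)
  refine hmain.congr' ?_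
  filter_upwards [hK', hN.eventually_gt_atTop 0] with q hq hpos
  simp only [Function.comp_apply]
  rw [scaledKernel_apply (hπ q.1) (hs q.1) hpos hξ, kernelOf_Afun_apply hξ0
    (hu.imp (fun h => h _ hq) fun h => ⟨h.1, h.2 _ hq⟩)
    (hv.imp (fun h => h _ hq) fun h => ⟨h.1, h.2 _ hq⟩)]

end RealMahler

end

/-! ### The theorem -/

theorem theorem2p4
    (s : ℕ → ℝ≥0∞) (hs : ∀ N : ℕ, (N : ℝ≥0∞) < s N)
    (lam : ℝ) (hlam : Tendsto (fun N : ℕ => ((N : ℝ≥0∞) / s N).toReal) atTop (𝓝 lam))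
    (π : ℕ → ℕ → ℝ[X]) (hπ : ∀ N : ℕ, RealMahler.IsSkewOrthonormal (s N) N (π N))
    (ξ : ℝ) (hξ : ξ = 1 ∨ ξ = -1) :
    -- the derivatives in the kernel matrix exist, and `D A_ξ D` is the scalar kernel
    (∀ u v : ℂ, (0 < lam ∨ u.re ≠ 0) →
      RealMahler.DiffAlong (fun a => RealMahler.Afun lam ξ a v) u) ∧
    (∀ u v : ℂ, (0 < lam ∨ v.re ≠ 0) →
      RealMahler.DiffAlong (fun b => RealMahler.Afun lam ξ u b) v) ∧
    (∀ u v : ℂ, (0 < lam ∨ (u.re ≠ 0 ∧ v.re ≠ 0)) →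
      RealMahler.DiffAlong (fun a => RealMahler.DR (RealMahler.Afun lam ξ) a v) u ∧
      RealMahler.DLR (RealMahler.Afun lam ξ) u v = RealMahler.kappa lam ξ u v) ∧
    -- locally uniform convergence of all entries; for `lam = 0` the compact set has to avoid the
    -- imaginary axis in each variable, except in a real variable on which `ε` acts
    (∀ (i j : Fin 2) (K : Set (ℂ × ℂ)), IsCompact K →
      (0 < lam ∨
        (((∀ p ∈ K, p.1.re ≠ 0) ∨ (i = 1 ∧ ∀ p ∈ K, p.1.im = 0)) ∧
         ((∀ p ∈ K, p.2.re ≠ 0) ∨ (j = 1 ∧ ∀ p ∈ K, p.2.im = 0)))) →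
      TendstoUniformlyOn
        (fun (N : ℕ) (p : ℂ × ℂ) => RealMahler.scaledKernel (s N) N (π N) ξ p.1 p.2 i j)
        (fun p : ℂ × ℂ => RealMahler.kernelOf (RealMahler.Afun lam ξ) p.1 p.2 i j)
        atTop K) := by
  have hξ0 : ξ ≠ 0 := by rcases hξ with rfl | rfl <;> norm_num
  have ht : Tendsto (fun N : ℕ => N * RealMahler.invExp (s N)) atTop (𝓝 lam) := by
    refine hlam.congr fun N => ?_
    rw [div_eq_mul_inv, ENNReal.toReal_mul, ENNReal.toReal_natCast, RealMahler.invExp]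
  have h0 : 0 ≤ lam := ge_of_tendsto' hlam fun N => ENNReal.toReal_nonneg
  refine ⟨fun u v hu => ?_, fun u v hv => ?_, fun u v huv => ?_, fun i j K hK h => ?_⟩
  · exact (RealMahler.diffAlong_of_hasDerivAt
      (RealMahler.hasDerivAt_Afun_left hξ0 v (hu.imp_left ne_of_gt))).1
  · exact (RealMahler.diffAlong_of_hasDerivAt
      (RealMahler.hasDerivAt_Afun_right hξ0 u (hv.imp_left ne_of_gt))).1
  · exact RealMahler.diffAlong_DR_Afun hξ0 (huv.imp ne_of_gt And.left) (huv.imp ne_of_gt And.right)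
  · refine RealMahler.tendstoUniformlyOn_scaledKernel hs ht h0 hπ hξ hK ?_ ?_
    · exact h.elim (fun h => Or.inl fun _ _ => Or.inl h.ne')
        fun h => h.1.imp_left fun h p hp => Or.inr (h p hp)
    · exact h.elim (fun h => Or.inl fun _ _ => Or.inl h.ne')
        fun h => h.2.imp_left fun h p hp => Or.inr (h p hp)
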